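/- Let $L,M,J>0$, let $\mu,\Lambda\in C^4[0,L]$ be strictly positive, and for $j=1,2$ let $A_j\in\mathbb R^{n\times n}$ be Hurwitz, $b_j,c_j\in\mathbb R^n$, $k_j>0$, $d_j\ge\delta_j>0$ with $\operatorname{Re}\big((i\omega I-A_j)^{-1}b_j\cdot c_j+d_j\big)\ge d_j$ for all $\omega\ge 0$. Let $P_j$ be symmetric positive definite, $\epsilon_j>0$, $q_j\in\mathbb R^n$ with $$P_jA_j+A_j^\top P_j=-q_jq_j^\top-\epsilon_jP_j,\qquad P_jb_j=c_j-\sqrt{2(d_j-\delta_j)}\,q_j .$$ Write $\tilde H^k_0=\{w\in H^k(0,L): w(0)=w_x(0)=0\}$, and, for $w_1,w_2\in\tilde H_0^2$, $$a(w_1,w_2)=\int_0^L\Lambda (w_1)_{xx}(w_2)_{xx}\,dx+k_1(w_1)_x(L)(w_2)_x(L)+k_2w_1(L)w_2(L).$$ For $z=(u,v,\zeta_1,\zeta_2)\in\tilde H^2_0\times\tilde H^2_0\times\mathbb R^n\times\mathbb R^n$ put $$\|z\|^2=\tfrac12\int_0^L(\Lambda u_{xx}^2+\mu v^2)\,dx+\tfrac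 M2v(L)^2+\tfrac J2v_x(L)^2+\tfrac{k_1}2u_x(L)^2+\tfrac{k_2}2u(L)^2+\tfrac12\sum_{j=1}^2\zeta_j^\top P_j\zeta_j .$$ Fix $T>0$. With the spaces $H=\mathbb R\times\mathbb R\times L^2(0,L)$, with inner product $(\varphi,\nu)_H=J\varphi^1\nu^1+M\varphi^2\nu^2+\int_0^L\mu\varphi^3\nu^3\,dx$, and $V=\{\hat w=(w_x(L),w(L),w): w\in\tilde H^2_0\}$, a weak solution $(u,\zeta_1,\zeta_2)$ on $(0,T)$ with initial data $u_0\in\tilde H^2_0$, $\hat v_0\in H$, $\zeta_{j,0}\in\mathbb R^n$ consists of $\hat u=(u_x(L),u(L),u)\in L^2(0,T;V)\cap H^1(0,T;H)\cap H^2(0,T;V')$ and $\zeta_j\in H^1(0,T;\mathbb R^n)$ with $\hat u(0)=\hat u_0$, $\hat u_t(0)=\hat v_0$, $\zeta_j(0)=\zeta_{j,0}$ such that for a.e. $t\in(0,T)$ and all $\hat w\in V$ $$\langle\hat u_{tt},\hat w\rangle+a(u,w)+\big(d_1{}\,{}^1\hat u_t+c_1\cdot\zeta_1\big)w_x(L)+\big(d_2\,{}^2\hat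 u_t+c_2\cdot\zeta_2\big)w(L)=0,$$ $$(\zeta_1)_t=A_1\zeta_1+b_1\,{}^1\hat u_t,\qquad(\zeta_2)_t=A_2\zeta_2+b_2\,{}^2\hat u_t ,$$ where $\langle\cdot,\cdot\rangle$ is the pairing of $V'$ and $V$ extending $(\cdot,\cdot)_H$, and ${}^i\hat u_t$ is the $i$-th component of $\hat u_t$. Let $N,S\ge1$ be integers, $h=L/N$, $\Delta t=T/S$, $t_k=k\Delta t$, and let $W_h\subset\tilde H^2_0$ be the space of $C^1$ functions $w$ with $w(0)=w_x(0)=0$ that are polynomials of degree at most $3$ on each $[mh,(m+1)h]$, $0\le m<N$ (Hermite cubics), with a basis $(w_i)$. A Crank–Nicolson solution is a sequence $z^k=(u^k,v^k,\zeta_1^k,\zeta_2^k)\in W_h\times W_h\times\mathbb R^n\times\mathbb R^n$, $0\le k\le S$, whose coefficient vectors $\mathbb U^k,\mathbb V^k$ (of $u^k$, $v^k$) satisfy for $0\le k<S$ $$\frac{\mathbb U^{k+1}-\mathbb U^k}{\Delta t}=\frac{\mathbb V^{k+1}+\mathbb V^k}2,\qquad \mathbb A\frac{\mathbb V^{k+1}-\mathbb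 V^k}{\Delta t}=-\mathbb K\frac{\mathbb U^{k+1}+\mathbb U^k}2-\mathbb B\frac{\mathbb V^{k+1}+\mathbb V^k}2-\frac{\mathbb C^{k+1}+\mathbb C^k}2,$$ $$\frac{\zeta_1^{k+1}-\zeta_1^k}{\Delta t}=A_1\frac{\zeta_1^{k+1}+\zeta_1^k}2+b_1\frac{v_x^{k+1}(L)+v_x^k(L)}2,\qquad \frac{\zeta_2^{k+1}-\zeta_2^k}{\Delta t}=A_2\frac{\zeta_2^{k+1}+\zeta_2^k}2+b_2\frac{v^{k+1}(L)+v^k(L)}2,$$ where $\mathbb A_{ij}=(\hat w_i,\hat w_j)_H$, $\mathbb B_{ij}=d_1(w_i)_x(L)(w_j)_x(L)+d_2w_i(L)w_j(L)$, $\mathbb K_{ij}=a(w_i,w_j)$ and $\mathbb C^k_j=c_1\cdot\zeta_1^k\,(w_j)_x(L)+c_2\cdot\zeta_2^k\,w_j(L)$. **Theorem.** There is a constant $C>0$, depending only on the coefficients above and on $T$, such that the following holds. Let $(u,\zeta_1,\zeta_2)$ be a weak solution with $u\in H^2(0,T;\tilde H^4_0)\cap H^4(0,T;\tilde H^2_0)$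 and $\zeta_1,\zeta_2\in H^3(0,T;\mathbb R^n)$, let $z(t)=(u(t),u_t(t),\zeta_1(t),\zeta_2(t))$, let $N,S\ge1$, and let $(z^k)$ be any Crank–Nicolson solution. Let $\breve u(t)\in W_h$ be the projection of $u(t)$ defined by $a(\breve u(t),w_h)=a(u(t),w_h)$ for all $w_h\in W_h$, and let $z_e^0=\big(u^0-\breve u(0),\,v^0-\breve u_t(0),\,\zeta_1^0-\zeta_1(0),\,\zeta_2^0-\zeta_2(0)\big)$. Then for every $k\in\{0,\dots,S\}$ $$\|z^k-z(t_k)\|\le C\Big[\|z_e^0\|+h^2\|u\|_{H^2(0,T;H^4(0,L))}+(\Delta t)^2\Big(\|u_{tt}\|_{L^2(0,T;H^4(0,L))}+\|u_{tt}\|_{H^2(0,T;H^2(0,L))}+\|(\zeta_1)_{tt}\|_{H^1(0,T;\mathbb R^n)}+\|(\zeta_2)_{tt}\|_{H^1(0,T;\mathbb R^n)}\Big)\Big].$$ -/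

import Mathlib

open MeasureTheory Set Filter Topology
open scoped ContDiff Matrix

noncomputable section

/-! ### Sobolev spaces of vector valued functions on a bounded interval -/

/-- Lebesgue measure on the open interval `(a, b)`. -/
abbrev intervalMeasure (a b : ℝ) : Measure ℝ := volume.restrict (Ioo a b)

/-- `φ ∈ C_c^∞(a, b)`. -/
def IsTestFunction (a b : ℝ) (φ : ℝ → ℝ) : Prop :=
  ContDiff ℝ ∞ φ ∧ HasCompactSupport φ ∧ tsupport φ ⊆ Ioo a b

/-- `g` is the weak (distributional) derivative of `f` on `(a, b)`. -/
def HasWeakDeriv {X : Type*} [NormedAddCommGroup X] [NormedSpace ℝ X]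
    (a b : ℝ) (f g : ℝ → X) : Prop :=
  ∀ φ : ℝ → ℝ, IsTestFunction a b φ →
    ∫ t in Ioo a b, deriv φ t • f t = - ∫ t in Ioo a b, φ t • g t

theorem integrable_smul_of_Lp {X : Type*} [NormedAddCommGroup X] [NormedSpace ℝ X]
    {a b : ℝ} {φ : ℝ → ℝ} (hφ : Continuous φ) (hc : HasCompactSupport φ)
    (f : Lp X 2 (intervalMeasure a b)) :
    Integrable (fun t => φ t • f t) (intervalMeasure a b) := by
  obtain ⟨K, hK⟩ := hφ.bounded_above_of_compact_support hc
  exact ((Lp.memLp f).integrable one_le_two).bdd_smul K hφ.aestronglyMeasurable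
    (Eventually.of_forall hK)

/-- The space `H^m(a, b; X)`: the tuples `(u, u', …, u^{(m)})` in `L²(a, b; X)` in which every
entry is the weak derivative of the previous one.  The norm inherited from the `ℓ²`-product is
`‖u‖² = ∑_{i ≤ m} ‖u^{(i)}‖²_{L²(a, b; X)}`. -/
def sobolevSubmodule (a b : ℝ) (X : Type*) [NormedAddCommGroup X] [NormedSpace ℝ X] (m : ℕ) :
    Submodule ℝ (PiLp 2 fun _ : Fin (m + 1) => Lp X 2 (intervalMeasure a b)) where
  carrier := {u | ∀ i : Fin m, HasWeakDeriv a b (u i.castSucc) (u i.succ)}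
  zero_mem' := by
    intro i φ hφ
    have h : (⇑(0 : Lp X 2 (intervalMeasure a b))) =ᵐ[intervalMeasure a b] 0 :=
      Lp.coeFn_zero X 2 _
    have h1 : ∫ t in Ioo a b, deriv φ t • (0 : Lp X 2 (intervalMeasure a b)) t = 0 := by
      rw [integral_congr_ae (g := fun _ => 0), integral_zero]
      filter_upwards [h] with t ht
      rw [ht, Pi.zero_apply, smul_zero]
    have h2 : ∫ t in Ioo a b, φ t • (0 : Lp X 2 (intervalMeasure a b)) t = 0 := by
      rw [integral_congr_ae (g := fun _ => 0), integral_zero]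
      filter_upwards [h] with t ht
      rw [ht, Pi.zero_apply, smul_zero]
    simp only [PiLp.zero_apply]
    rw [h1, h2, neg_zero]
  add_mem' := by
    intro u v hu hv i φ hφ
    have key : ∀ (ψ : ℝ → ℝ), Continuous ψ → HasCompactSupport ψ →
        ∀ f g : Lp X 2 (intervalMeasure a b),
        ∫ t in Ioo a b, ψ t • (f + g) t =
          (∫ t in Ioo a b, ψ t • f t) + ∫ t in Ioo a b, ψ t • g t := by
      intro ψ h1 h2 f g
      rw [← integral_add (integrable_smul_of_Lp h1 h2 f) (integrable_smul_of_Lp h1 h2 g)]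
      refine integral_congr_ae ?_
      filter_upwards [Lp.coeFn_add f g] with t ht
      rw [ht, Pi.add_apply, smul_add]
    simp only [PiLp.add_apply]
    rw [key _ (hφ.1.continuous_deriv (by simp)) hφ.2.1.deriv,
      key _ hφ.1.continuous hφ.2.1, hu i φ hφ, hv i φ hφ, neg_add]
  smul_mem' := by
    intro c u hu i φ hφ
    have key : ∀ (ψ : ℝ → ℝ), ∀ f : Lp X 2 (intervalMeasure a b),
        ∫ t in Ioo a b, ψ t • (c • f) t = c • ∫ t in Ioo a b, ψ t • f t := by
      intro ψ f
      rw [← integral_smul]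
      refine integral_congr_ae ?_
      filter_upwards [Lp.coeFn_smul c f] with t ht
      simp only [ht, Pi.smul_apply]
      exact smul_comm _ _ _
    simp only [PiLp.smul_apply]
    rw [key, key, hu i φ hφ, smul_neg]

/-- `H^m(a, b; X)`. -/
abbrev Sobolev (a b : ℝ) (X : Type*) [NormedAddCommGroup X] [NormedSpace ℝ X] (m : ℕ) : Type _ :=
  sobolevSubmodule a b X m

/-- The `i`-th weak derivative `u^{(i)}`, `i ≤ m`, of `u ∈ H^m(a, b; X)`, as a function defined
almost everywhere. -/
def Sobolev.D {a b : ℝ} {X : Type*} [NormedAddCommGroup X] [NormedSpace ℝ X] {m : ℕ}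
    (u : Sobolev a b X m) (i : Fin (m + 1)) : ℝ → X :=
  u.1 i

/-- The weak derivative as a map `H^{m+1}(a, b; X) → H^m(a, b; X)`. -/
def Sobolev.diff {a b : ℝ} {X : Type*} [NormedAddCommGroup X] [NormedSpace ℝ X] {m : ℕ}
    (u : Sobolev a b X (m + 1)) : Sobolev a b X m :=
  ⟨WithLp.toLp 2 fun i => u.1 i.succ, fun i => u.2 i.succ⟩

/-- `g` is a representative of `f`, as a function on `(a, b)`, which is continuous on `[a, b]`. -/
def IsContRep {X : Type*} [NormedAddCommGroup X] (a b : ℝ) (f g : ℝ → X) : Prop :=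
  ContinuousOn g (Icc a b) ∧ f =ᵐ[intervalMeasure a b] g

open Classical in
/-- The value at `x ∈ [a, b]` of the continuous representative of `f` (such a representative is
unique on `[a, b]`; the value `0` is taken if there is none). -/
def pointValue {X : Type*} [NormedAddCommGroup X] (a b : ℝ) (f : ℝ → X) (x : ℝ) : X :=
  if h : ∃ g, IsContRep a b f g then h.choose x else 0

theorem pointValue_eq {X : Type*} [NormedAddCommGroup X] {a b : ℝ} (hab : a < b)
    {f g : ℝ → X} (hg : IsContRep a b f g) {x : ℝ} (hx : x ∈ Icc a b) :
    pointValue a b f x = g x := by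
  have h : ∃ g, IsContRep a b f g := ⟨g, hg⟩
  rw [pointValue, dif_pos h]
  have h1 := h.choose_spec
  have h2 : h.choose =ᵐ[volume.restrict (Ioo a b)] g := h1.2.symm.trans hg.2
  rw [Measure.restrict_congr_set (Ioo_ae_eq_Icc (μ := volume) (a := a) (b := b))] at h2
  exact Measure.eqOn_Icc_of_ae_eq volume hab.ne h2 h1.1 hg.1 hx

/-- `f` has a continuous representative on `[a, b]`, and it vanishes at `a`. -/
def VanishesAtLeft {X : Type*} [NormedAddCommGroup X] (a b : ℝ) (f : ℝ → X) : Prop :=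
  ∃ g, IsContRep a b f g ∧ g a = 0

/-! The next facts show that the spaces above are complete, so that the vector valued integrals in
`HasWeakDeriv` are genuine Bochner integrals. -/

theorem continuous_integral_smul_Lp {X : Type*} [NormedAddCommGroup X] [NormedSpace ℝ X]
    {a b : ℝ} {φ : ℝ → ℝ} (hφ : Continuous φ) (hc : HasCompactSupport φ) :
    Continuous fun f : Lp X 2 (intervalMeasure a b) => ∫ t in Ioo a b, φ t • f t := by
  obtain ⟨K, hK⟩ := hφ.bounded_above_of_compact_support hc
  have hK0 : 0 ≤ K := (norm_nonneg _).trans (hK 0)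
  set c : ℝ := ((intervalMeasure a b univ) ^ (1 / (1 : ENNReal).toReal - 1 / (2 : ENNReal).toReal)).toReal
    with hcdef
  have hfin : (intervalMeasure a b univ) ^ (1 / (1 : ENNReal).toReal - 1 / (2 : ENNReal).toReal) ≠ ⊤ := by
    refine ENNReal.rpow_ne_top_of_nonneg ?_ (measure_ne_top _ _)
    norm_num
  have hbound : ∀ f : Lp X 2 (intervalMeasure a b),
      ‖∫ t in Ioo a b, φ t • f t‖ ≤ (K * c) * ‖f‖ := by
    intro f
    have hf1 : Integrable f (intervalMeasure a b) := (Lp.memLp f).integrable one_le_two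
    calc ‖∫ t in Ioo a b, φ t • f t‖ ≤ ∫ t in Ioo a b, ‖φ t • f t‖ := norm_integral_le_integral_norm _
      _ ≤ ∫ t in Ioo a b, K * ‖f t‖ := by
          refine integral_mono (integrable_smul_of_Lp hφ hc f).norm (hf1.norm.const_mul K) ?_
          intro t
          simp only [norm_smul]
          exact mul_le_mul_of_nonneg_right (hK t) (norm_nonneg _)
      _ = K * ∫ t in Ioo a b, ‖f t‖ := integral_const_mul _ _
      _ ≤ K * (c * ‖f‖) := by
          refine mul_le_mul_of_nonneg_left ?_ hK0
          rw [integral_norm_eq_lintegral_enorm hf1.1, ← eLpNorm_one_eq_lintegral_enorm, Lp.norm_def,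
            mul_comm, hcdef, ← ENNReal.toReal_mul]
          refine ENNReal.toReal_mono (ENNReal.mul_ne_top (Lp.eLpNorm_ne_top f) hfin) ?_
          exact eLpNorm_le_eLpNorm_mul_rpow_measure_univ one_le_two hf1.1
      _ = _ := by ring
  let l : Lp X 2 (intervalMeasure a b) →ₗ[ℝ] X :=
    { toFun := fun f => ∫ t in Ioo a b, φ t • f t
      map_add' := by
        intro f g
        rw [← integral_add (integrable_smul_of_Lp hφ hc f) (integrable_smul_of_Lp hφ hc g)]
        refine integral_congr_ae ?_
        filter_upwards [Lp.coeFn_add f g] with t ht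
        rw [ht, Pi.add_apply, smul_add]
      map_smul' := by
        intro r f
        rw [RingHom.id_apply, ← integral_smul]
        refine integral_congr_ae ?_
        filter_upwards [Lp.coeFn_smul r f] with t ht
        simp only [ht, Pi.smul_apply]
        exact smul_comm _ _ _ }
  exact (l.mkContinuous (K * c) hbound).continuous

/-- The condition tested by one function, as a closed condition on tuples. -/
theorem isClosed_tested {X : Type*} [NormedAddCommGroup X] [NormedSpace ℝ X]
    {a b : ℝ} {m : ℕ} {φ : ℝ → ℝ} (hφ : ContDiff ℝ ∞ φ) (hc : HasCompactSupport φ)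
    (i j : Fin (m + 1)) :
    IsClosed {u : PiLp 2 fun _ : Fin (m + 1) => Lp X 2 (intervalMeasure a b) |
      ∫ t in Ioo a b, deriv φ t • u i t = - ∫ t in Ioo a b, φ t • u j t} :=
  isClosed_eq
    ((continuous_integral_smul_Lp (hφ.continuous_deriv (by simp)) hc.deriv).comp
      (PiLp.continuous_apply 2 _ i))
    ((continuous_integral_smul_Lp hφ.continuous hc).comp (PiLp.continuous_apply 2 _ j)).neg

instance Sobolev.instCompleteSpace {X : Type*} [NormedAddCommGroup X] [NormedSpace ℝ X]
    [CompleteSpace X] {a b : ℝ} {m : ℕ} : CompleteSpace (Sobolev a b X m) := by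
  have : IsClosed (sobolevSubmodule a b X m : Set
      (PiLp 2 fun _ : Fin (m + 1) => Lp X 2 (intervalMeasure a b))) := by
    have h : (sobolevSubmodule a b X m : Set
      (PiLp 2 fun _ : Fin (m + 1) => Lp X 2 (intervalMeasure a b))) =
      ⋂ (i : Fin m) (φ : ℝ → ℝ) (_ : IsTestFunction a b φ),
        {u | ∫ t in Ioo a b, deriv φ t • u i.castSucc t = - ∫ t in Ioo a b, φ t • u i.succ t} := by
      ext u
      simp only [mem_iInter]
      rfl
    rw [h]
    exact isClosed_iInter fun i => isClosed_iInter fun φ => isClosed_iInter fun hφ =>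
      isClosed_tested hφ.1 hφ.2.1 _ _
  exact this.completeSpace_coe

/-- Integration by parts for a primitive of an integrable function. -/
theorem integral_deriv_mul_primitive {a b : ℝ} (hab : a ≤ b) {g : ℝ → ℝ}
    (hg : IntervalIntegrable g volume a b) {φ : ℝ → ℝ} (hφ : ContDiff ℝ ∞ φ) (hb : φ b = 0) :
    ∫ x in Ioo a b, deriv φ x • (∫ y in a..x, g y) = - ∫ x in Ioo a b, φ x • g x := by
  have hG := hg.absolutelyContinuousOnInterval_intervalIntegral (c := a) (by simp)
  have hφ' : AbsolutelyContinuousOnInterval φ a b :=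
    ContDiffOn.absolutelyContinuousOnInterval ((hφ.of_le (by simp)).contDiffOn)
  have h := hG.integral_mul_deriv_eq_deriv_mul hφ'
  simp only [intervalIntegral.integral_of_le hab, integral_Ioc_eq_integral_Ioo, hb,
    intervalIntegral.integral_same] at h
  have h2 : ∫ x in Ioo a b, deriv (fun x => ∫ y in a..x, g y) x * φ x
      = ∫ x in Ioo a b, φ x • g x := by
    refine setIntegral_congr_ae measurableSet_Ioo ?_
    filter_upwards [hg.ae_hasDerivAt_integral] with x hx hxI
    rw [(hx (by rw [uIcc_of_le hab]; exact Ioo_subset_Icc_self hxI) a (by simp)).deriv,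
      smul_eq_mul, mul_comm]
  rw [h2] at h
  rw [mul_zero, zero_mul, sub_zero, zero_sub] at h
  rw [← h]
  refine integral_congr_ae (Eventually.of_forall fun x => ?_)
  simp [mul_comm]

/-- A function on `(a, b)` with integrable weak derivative `g` is a primitive of `g`. -/
theorem HasWeakDeriv.exists_primitive {a b : ℝ} (hab : a < b) {f g : ℝ → ℝ}
    (hf : Integrable f (intervalMeasure a b)) (hg : Integrable g (intervalMeasure a b))
    (h : HasWeakDeriv a b f g) :
    ∃ c : ℝ, f =ᵐ[intervalMeasure a b] fun x => c + ∫ y in a..x, g y := by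
  have hgi : IntervalIntegrable g volume a b :=
    (intervalIntegrable_iff_integrableOn_Ioo_of_le hab.le).2 hg
  have hGc : ContinuousOn (fun x => ∫ y in a..x, g y) (Icc a b) := by
    have := (hgi.absolutelyContinuousOnInterval_intervalIntegral (c := a) (by simp)).continuousOn
    rwa [uIcc_of_le hab.le] at this
  have hGi : Integrable (fun x => ∫ y in a..x, g y) (intervalMeasure a b) :=
    (hGc.integrableOn_Icc).mono_set Ioo_subset_Icc_self
  set F : ℝ → ℝ := fun x => f x - ∫ y in a..x, g y with hF
  have hFi : Integrable F (intervalMeasure a b) := hf.sub hGi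
  have smul_int : ∀ {ψ : ℝ → ℝ} {k : ℝ → ℝ}, Continuous ψ → HasCompactSupport ψ →
      Integrable k (intervalMeasure a b) →
      Integrable (fun t => ψ t • k t) (intervalMeasure a b) := by
    intro ψ k h1 h2 hk
    obtain ⟨K, hK⟩ := h1.bounded_above_of_compact_support h2
    exact hk.bdd_smul K h1.aestronglyMeasurable (Eventually.of_forall hK)
  have zero_b : ∀ {φ : ℝ → ℝ}, IsTestFunction a b φ → φ a = 0 ∧ φ b = 0 := by
    intro φ hφ
    exact ⟨image_eq_zero_of_notMem_tsupport fun hm => lt_irrefl _ (hφ.2.2 hm).1,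
      image_eq_zero_of_notMem_tsupport fun hm => lt_irrefl _ (hφ.2.2 hm).2⟩
  -- `F` has weak derivative zero
  have hF0 : ∀ φ, IsTestFunction a b φ → ∫ x in Ioo a b, deriv φ x • F x = 0 := by
    intro φ hφ
    have h1 := h φ hφ
    have h2 := integral_deriv_mul_primitive hab.le hgi hφ.1 (zero_b hφ).2
    have hd : Continuous (deriv φ) := hφ.1.continuous_deriv (by simp)
    simp only [hF, smul_sub]
    rw [integral_sub (smul_int hd hφ.2.1.deriv hf) (smul_int hd hφ.2.1.deriv hGi), h1, h2, sub_self]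
  -- a test function with integral one
  obtain ⟨ψ, hψ, hψ1⟩ : ∃ ψ, IsTestFunction a b ψ ∧ ∫ x in Ioo a b, ψ x = 1 := by
    let B : ContDiffBump ((a + b) / 2) := ⟨(b - a) / 8, (b - a) / 4, by linarith, by linarith⟩
    have hsub : tsupport (B.normed volume) ⊆ Ioo a b := by
      rw [B.tsupport_normed_eq, Real.closedBall_eq_Icc]
      intro x hx
      have h1 : (a + b) / 2 - (b - a) / 4 ≤ x := hx.1
      have h2 : x ≤ (a + b) / 2 + (b - a) / 4 := hx.2
      constructor <;> linarith
    refine ⟨B.normed volume, ⟨B.contDiff_normed, B.hasCompactSupport_normed, hsub⟩, ?_⟩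
    rw [setIntegral_eq_integral_of_forall_compl_eq_zero, B.integral_normed]
    intro x hx
    exact image_eq_zero_of_notMem_tsupport (f := B.normed volume) fun hm => hx (hsub hm)
  set c : ℝ := ∫ x in Ioo a b, ψ x • F x with hc
  refine ⟨c, ?_⟩
  have hmain : ∀ φ : ℝ → ℝ, ContDiff ℝ ∞ φ → HasCompactSupport φ → tsupport φ ⊆ Ioo a b →
      ∫ x, φ x • (F x - c) = 0 := by
    intro φ h1 h2 h3
    have hφi : Integrable φ (intervalMeasure a b) :=
      (h1.continuous.integrable_of_hasCompactSupport h2).restrict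
    have hψi : Integrable ψ (intervalMeasure a b) :=
      (hψ.1.continuous.integrable_of_hasCompactSupport hψ.2.1).restrict
    set I : ℝ := ∫ x in Ioo a b, φ x with hI
    set θ : ℝ → ℝ := fun x => φ x - I * ψ x with hθ
    have hθc : ContDiff ℝ ∞ θ := h1.sub (contDiff_const.mul hψ.1)
    set η : ℝ → ℝ := fun x => ∫ y in a..x, θ y with hη
    have hηd : ∀ x, HasDerivAt η (θ x) x := fun x =>
      intervalIntegral.integral_hasDerivAt_right (hθc.continuous.intervalIntegrable _ _)
        (hθc.continuous.stronglyMeasurableAtFilter _ _) hθc.continuous.continuousAt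
    have hηd' : deriv η = θ := funext fun x => (hηd x).deriv
    have hηc : ContDiff ℝ ∞ η := by
      rw [contDiff_infty_iff_deriv]
      exact ⟨fun x => (hηd x).differentiableAt, by rwa [hηd']⟩
    -- the support of `θ` lies in a compact subinterval
    obtain ⟨s, t, hst, has, htb, hsup⟩ : ∃ s t, s ≤ t ∧ a < s ∧ t < b ∧
        ∀ x, x ∉ Icc s t → θ x = 0 := by
      have hK : IsCompact (tsupport φ ∪ tsupport ψ) := h2.isCompact.union hψ.2.1.isCompact
      have hKs : tsupport φ ∪ tsupport ψ ⊆ Ioo a b := union_subset h3 hψ.2.2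
      have hne : (tsupport φ ∪ tsupport ψ).Nonempty := by
        by_contra hcon
        rw [not_nonempty_iff_eq_empty, union_empty_iff] at hcon
        have : ψ = 0 := tsupport_eq_empty_iff.1 hcon.2
        rw [this] at hψ1
        simp at hψ1
      obtain ⟨s, hs⟩ := hK.exists_isLeast hne
      obtain ⟨t, ht⟩ := hK.exists_isGreatest hne
      refine ⟨s, t, hs.2 ht.1, (hKs hs.1).1, (hKs ht.1).2, fun x hx => ?_⟩
      have hx' : x ∉ tsupport φ ∪ tsupport ψ := fun hm => hx ⟨hs.2 hm, ht.2 hm⟩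
      rw [mem_union, not_or] at hx'
      simp [hθ, image_eq_zero_of_notMem_tsupport hx'.1, image_eq_zero_of_notMem_tsupport hx'.2]
    have hθ0 : ∫ y in a..b, θ y = 0 := by
      rw [intervalIntegral.integral_of_le hab.le, integral_Ioc_eq_integral_Ioo]
      simp only [hθ]
      rw [integral_sub hφi (hψi.const_mul I), integral_const_mul, hψ1, ← hI]
      ring
    have hη0 : ∀ x, x ∉ Icc s t → η x = 0 := by
      intro x hx
      rw [mem_Icc, not_and_or, not_le, not_le] at hx
      rcases hx with hx | hx
      · simp only [hη]
        rw [intervalIntegral.integral_congr (g := fun _ => (0 : ℝ)), intervalIntegral.integral_zero]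
        intro y hy
        refine hsup y fun hy' => ?_
        have := hy.2
        have h4 : max a x < s := max_lt has hx
        linarith [hy'.1]
      · have h4 : ∫ y in x..b, θ y = 0 := by
          rw [intervalIntegral.integral_congr (g := fun _ => (0 : ℝ)),
            intervalIntegral.integral_zero]
          intro y hy
          refine hsup y fun hy' => ?_
          have := hy.1
          have h4 : t < min x b := lt_min hx htb
          linarith [hy'.2]
        have h5 := intervalIntegral.integral_add_adjacent_intervals
          (hθc.continuous.intervalIntegrable (μ := volume) a x)
          (hθc.continuous.intervalIntegrable x b)
        rw [h4, add_zero, hθ0] at h5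
        exact h5
    have hηt : IsTestFunction a b η := by
      refine ⟨hηc, HasCompactSupport.intro isCompact_Icc hη0, ?_⟩
      refine (closure_minimal (fun x hx => ?_) isClosed_Icc).trans (Icc_subset_Ioo has htb)
      by_contra hcon
      exact hx (hη0 x hcon)
    have h5 := hF0 η hηt
    rw [hηd'] at h5
    have e1 : ∫ x in Ioo a b, θ x • F x = (∫ x in Ioo a b, φ x • F x) - I * c := by
      have : ∀ x, θ x • F x = φ x • F x - I * (ψ x • F x) := by
        intro x; simp only [hθ, smul_eq_mul]; ring
      simp only [this]
      rw [integral_sub (smul_int h1.continuous h2 hFi)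
        ((smul_int hψ.1.continuous hψ.2.1 hFi).const_mul I), integral_const_mul]
    rw [← setIntegral_eq_integral_of_forall_compl_eq_zero (s := Ioo a b)]
    · simp only [smul_sub]
      rw [integral_sub (smul_int h1.continuous h2 hFi)
        (smul_int h1.continuous h2 (integrable_const c))]
      simp only [smul_eq_mul] at e1 h5 ⊢
      rw [integral_mul_const, ← hI]
      linarith
    · intro x hx
      rw [image_eq_zero_of_notMem_tsupport (f := φ) fun hm => hx (h3 hm), zero_smul]
  have hloc : LocallyIntegrableOn (fun x => F x - c) (Ioo a b) volume :=
    IntegrableOn.locallyIntegrableOn (hFi.sub (integrable_const c))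
  have h6 := isOpen_Ioo.ae_eq_zero_of_integral_contDiff_smul_eq_zero hloc hmain
  refine (ae_restrict_iff' measurableSet_Ioo).2 ?_
  filter_upwards [h6] with x hx hxI
  have := hx hxI
  simp only [hF] at this
  linarith

/-- For a function with an integrable weak derivative, vanishing at the left endpoint can be tested
with functions which need not vanish there. -/
theorem vanishesAtLeft_iff {a b : ℝ} (hab : a < b) {f g : ℝ → ℝ}
    (hf : Integrable f (intervalMeasure a b)) (hg : Integrable g (intervalMeasure a b))
    (h : HasWeakDeriv a b f g) :
    VanishesAtLeft a b f ↔ ∀ φ : ℝ → ℝ, ContDiff ℝ ∞ φ → HasCompactSupport φ → φ b = 0 →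
      ∫ x in Ioo a b, deriv φ x • f x = - ∫ x in Ioo a b, φ x • g x := by
  have hgi : IntervalIntegrable g volume a b :=
    (intervalIntegrable_iff_integrableOn_Ioo_of_le hab.le).2 hg
  have hGc : ContinuousOn (fun x => ∫ y in a..x, g y) (Icc a b) := by
    have := (hgi.absolutelyContinuousOnInterval_intervalIntegral (c := a) (by simp)).continuousOn
    rwa [uIcc_of_le hab.le] at this
  have hGi : Integrable (fun x => ∫ y in a..x, g y) (intervalMeasure a b) :=
    (hGc.integrableOn_Icc).mono_set Ioo_subset_Icc_self
  obtain ⟨c, hc⟩ := h.exists_primitive hab hf hg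
  have hrep : IsContRep a b f (fun x => c + ∫ y in a..x, g y) :=
    ⟨continuousOn_const.add hGc, hc⟩
  have hval : ∀ k, IsContRep a b f k → k a = c := by
    intro k hk
    have ha : a ∈ Icc a b := left_mem_Icc.2 hab.le
    rw [← pointValue_eq hab hk ha, pointValue_eq hab hrep ha]
    simp
  have hc0 : VanishesAtLeft a b f ↔ c = 0 :=
    ⟨fun ⟨k, hk, hk0⟩ => by rw [← hval k hk, hk0], fun h0 => ⟨_, hrep, by simp [h0]⟩⟩
  rw [hc0]
  have key : ∀ φ : ℝ → ℝ, ContDiff ℝ ∞ φ → HasCompactSupport φ → φ b = 0 →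
      ∫ x in Ioo a b, deriv φ x • f x = - φ a * c - ∫ x in Ioo a b, φ x • g x := by
    intro φ h1 h2 h3
    have hd : Continuous (deriv φ) := h1.continuous_deriv (by simp)
    have e1 : ∫ x in Ioo a b, deriv φ x • f x
        = ∫ x in Ioo a b, (deriv φ x * c + deriv φ x • ∫ y in a..x, g y) := by
      refine integral_congr_ae ?_
      filter_upwards [hc] with x hx
      rw [hx, smul_eq_mul, smul_eq_mul, mul_add]
    obtain ⟨K, hK⟩ := hd.bounded_above_of_compact_support h2.deriv
    have e2 : ∫ x in Ioo a b, deriv φ x = - φ a := by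
      rw [← integral_Ioc_eq_integral_Ioo, ← intervalIntegral.integral_of_le hab.le,
        intervalIntegral.integral_deriv_eq_sub (fun x _ => (h1.differentiable (by simp)) x)
          (hd.intervalIntegrable _ _), h3, zero_sub]
    rw [e1, integral_add, integral_mul_const, e2, integral_deriv_mul_primitive hab.le hgi h1 h3]
    · ring
    · exact ((hd.integrable_of_hasCompactSupport h2.deriv).restrict).mul_const c
    · exact hGi.bdd_smul K hd.aestronglyMeasurable (Eventually.of_forall hK)
  constructor
  · rintro rfl φ h1 h2 h3
    rw [key φ h1 h2 h3]
    ring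
  · intro H
    let B : ContDiffBump a := ⟨(b - a) / 4, (b - a) / 2, by linarith, by linarith⟩
    have h3 : B b = 0 := B.zero_of_le_dist (by
      rw [Real.dist_eq, abs_of_pos (by linarith)]
      change (b - a) / 2 ≤ b - a
      linarith)
    have h4 : B a = 1 := B.one_of_mem_closedBall (Metric.mem_closedBall_self B.rIn_pos.le)
    have e := H B B.contDiff B.hasCompactSupport h3
    rw [key B B.contDiff B.hasCompactSupport h3, h4] at e
    linarith

/-- The space `H̃₀^k(0, L) = {w ∈ H^k(0, L) : w(0) = w_x(0) = 0}`, `k ≥ 2`, with the norm of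
`H^k(0, L)`. -/
def tildeSubmodule (L : ℝ) (k : ℕ) : Submodule ℝ (Sobolev 0 L ℝ k) where
  carrier := {w | ∀ i : Fin (k + 1), (i : ℕ) < 2 → VanishesAtLeft 0 L (w.D i)}
  zero_mem' := fun _ _ => ⟨0, ⟨continuousOn_const, Lp.coeFn_zero ℝ 2 _⟩, rfl⟩
  add_mem' := by
    intro u v hu hv i hi
    obtain ⟨g, hg, hg0⟩ := hu i hi
    obtain ⟨g', hg', hg0'⟩ := hv i hi
    exact ⟨g + g', ⟨hg.1.add hg'.1, (Lp.coeFn_add _ _).trans (hg.2.add hg'.2)⟩, by simp [*]⟩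
  smul_mem' := by
    intro c u hu i hi
    obtain ⟨g, hg, hg0⟩ := hu i hi
    exact ⟨c • g, ⟨hg.1.const_smul c, (Lp.coeFn_smul _ _).trans (hg.2.const_smul c)⟩,
      by simp [*]⟩

/-- `H̃₀^k(0, L)`. -/
abbrev TildeH (L : ℝ) (k : ℕ) : Type := tildeSubmodule L k

theorem TildeH.completeSpace {L : ℝ} (hL : 0 < L) (k : ℕ) : CompleteSpace (TildeH L (k + 2)) := by
  have h : IsClosed (tildeSubmodule L (k + 2) : Set (Sobolev 0 L ℝ (k + 2))) := by
    have hset : (tildeSubmodule L (k + 2) : Set (Sobolev 0 L ℝ (k + 2))) =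
        ⋂ (i : Fin (k + 2)) (_ : (i : ℕ) < 2) (φ : ℝ → ℝ) (_ : ContDiff ℝ ∞ φ)
          (_ : HasCompactSupport φ) (_ : φ L = 0),
          (Subtype.val : Sobolev 0 L ℝ (k + 2) → _) ⁻¹'
            {u | ∫ t in Ioo 0 L, deriv φ t • u i.castSucc t = - ∫ t in Ioo 0 L, φ t • u i.succ t} := by
      ext w
      have hw : ∀ i : Fin (k + 2), VanishesAtLeft 0 L (w.D i.castSucc) ↔ _ := fun i =>
        vanishesAtLeft_iff hL ((Lp.memLp (w.1 i.castSucc)).integrable one_le_two)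
          ((Lp.memLp (w.1 i.succ)).integrable one_le_two) (w.2 i)
      simp only [mem_iInter]
      constructor
      · intro h i hi φ h1 h2 h3
        exact (hw i).1 (h i.castSucc hi) φ h1 h2 h3
      · intro h i hi
        have := (hw ⟨i, by omega⟩).2 (fun φ h1 h2 h3 => h ⟨i, by omega⟩ hi φ h1 h2 h3)
        exact this
    rw [hset]
    exact isClosed_iInter fun i => isClosed_iInter fun _ => isClosed_iInter fun φ =>
      isClosed_iInter fun hφ => isClosed_iInter fun hc => isClosed_iInter fun _ =>
        (isClosed_tested hφ hc _ _).preimage continuous_subtype_val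
  exact h.completeSpace_coe

/-- The `i`-th spatial weak derivative of `w ∈ H̃₀^k(0, L)`. -/
def TildeH.D {L : ℝ} {k : ℕ} (w : TildeH L k) (i : Fin (k + 1)) : ℝ → ℝ := Sobolev.D w.1 i

/-- The tip value `w(L)`. -/
def TildeH.tip {L : ℝ} (w : TildeH L 2) : ℝ := pointValue 0 L (w.D 0) L

/-- The tip slope `w_x(L)`. -/
def TildeH.tipSlope {L : ℝ} (w : TildeH L 2) : ℝ := pointValue 0 L (w.D 1) L

/-! ### The beam and its controller -/

/-- The Euclidean space `ℝⁿ` of controller states. -/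
abbrev CtrlState (n : ℕ) : Type := EuclideanSpace ℝ (Fin n)

/-- The coefficients of one of the two dynamic boundary controllers,
`ζ' = A ζ + b y'`, `Θ = k y + c · ζ + d y'`. -/
structure Controller (n : ℕ) where
  A : Matrix (Fin n) (Fin n) ℝ
  b : Fin n → ℝ
  c : Fin n → ℝ
  k : ℝ
  d : ℝ

/-- `A` is a Hurwitz matrix. -/
def IsHurwitz {n : ℕ} (A : Matrix (Fin n) (Fin n) ℝ) : Prop :=
  ∀ z ∈ spectrum ℂ (A.map (algebraMap ℝ ℂ)), z.re < 0

/-- The transfer function `G(s) = (s I - A)⁻¹ b · c + d`. -/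
def Controller.transfer {n : ℕ} (K : Controller n) (s : ℂ) : ℂ :=
  ((s • (1 : Matrix (Fin n) (Fin n) ℂ) - K.A.map (algebraMap ℝ ℂ))⁻¹ *ᵥ fun i => (K.b i : ℂ)) ⬝ᵥ
    (fun i => (K.c i : ℂ)) + K.d

/-- The standing assumptions on a controller: `A` is Hurwitz, `k > 0`, and
`Re G(iy) ≥ d ≥ δ > 0` for all `y ≥ 0`. -/
structure Controller.IsAdmissible {n : ℕ} (K : Controller n) (δ : ℝ) : Prop where
  hurwitz : IsHurwitz K.A
  k_pos : 0 < K.k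
  δ_pos : 0 < δ
  δ_le : δ ≤ K.d
  re_transfer : ∀ y : ℝ, 0 ≤ y → K.d ≤ (K.transfer (Complex.I * y)).re

/-- The matrix `P` (together with `q`, `ε`) which defines the controller part of the energy norm:
`P` is symmetric positive definite, `ε > 0`, `P A + Aᵀ P = - q qᵀ - ε P` and
`P b = c - √(2 (d - δ)) q`. -/
structure Controller.IsStorage {n : ℕ} (K : Controller n) (δ : ℝ)
    (P : Matrix (Fin n) (Fin n) ℝ) (q : Fin n → ℝ) (ε : ℝ) : Prop where
  posDef : P.PosDef
  ε_pos : 0 < ε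
  lyapunov : P * K.A + K.Aᵀ * P = - Matrix.vecMulVec q q - ε • P
  output : P *ᵥ K.b = K.c - Real.sqrt (2 * (K.d - δ)) • q

/-- The coefficients of the beam: length `L`, mass density `μ`, flexural rigidity `Λ`, tip mass
`M`, tip moment of inertia `J`, and the two controllers (`ctrl₁` acts on the tip slope `u_x(L)`,
`ctrl₂` on the tip position `u(L)`). -/
structure Beam (n : ℕ) where
  L : ℝ
  μ : ℝ → ℝ
  Λ : ℝ → ℝ
  M : ℝ
  J : ℝ
  ctrl₁ : Controller n
  ctrl₂ : Controller n

/-- The standing assumptions on the beam: `μ, Λ ∈ C⁴[0, L]` are strictly positive, and so are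
`L`, `M`, `J`. -/
structure Beam.IsAdmissible {n : ℕ} (S : Beam n) : Prop where
  L_pos : 0 < S.L
  μ_smooth : ContDiffOn ℝ 4 S.μ (Icc 0 S.L)
  Λ_smooth : ContDiffOn ℝ 4 S.Λ (Icc 0 S.L)
  μ_pos : ∀ x ∈ Icc 0 S.L, 0 < S.μ x
  Λ_pos : ∀ x ∈ Icc 0 S.L, 0 < S.Λ x
  M_pos : 0 < S.M
  J_pos : 0 < S.J

/-! ### Weak formulation -/

/-- The space `H = ℝ × ℝ × L²(0, L)` (as a topological vector space; its inner product is
`Beam.innerH`). -/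
abbrev PivotH (L : ℝ) : Type := ℝ × ℝ × Lp ℝ 2 (intervalMeasure 0 L)

/-- `ŵ = (w_x(L), w(L), w)`.  The space `V = {ŵ : w ∈ H̃₀²(0, L)}` is identified with
`H̃₀²(0, L)` through this map. -/
def TildeH.hat {L : ℝ} (w : TildeH L 2) : PivotH L := (w.tipSlope, w.tip, w.1.1 0)

/-- The inner product of `H`:
`J φ¹ ν¹ + M φ² ν² + ∫ μ φ³ ν³ dx`. -/
def Beam.innerH {n : ℕ} (S : Beam n) (φ ν : PivotH S.L) : ℝ :=
  S.J * φ.1 * ν.1 + S.M * φ.2.1 * ν.2.1 + ∫ x in Ioo 0 S.L, S.μ x * φ.2.2 x * ν.2.2 x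

/-- The bilinear form `a`:
`∫ Λ (w₁)_xx (w₂)_xx dx + k₁ (w₁)_x(L) (w₂)_x(L) + k₂ w₁(L) w₂(L)`. -/
def Beam.formA {n : ℕ} (S : Beam n) (w₁ w₂ : TildeH S.L 2) : ℝ :=
  (∫ x in Ioo 0 S.L, S.Λ x * w₁.D 2 x * w₂.D 2 x) +
    S.ctrl₁.k * w₁.tipSlope * w₂.tipSlope + S.ctrl₂.k * w₁.tip * w₂.tip

/-- The bilinear form `b`: `d₁ φ¹ ν¹ + d₂ φ² ν²`. -/
def Beam.formB {n : ℕ} (S : Beam n) (φ ν : PivotH S.L) : ℝ :=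
  S.ctrl₁.d * φ.1 * ν.1 + S.ctrl₂.d * φ.2.1 * ν.2.1

/-- `e₁(ζ₁, ŵ) + e₂(ζ₂, ŵ) = (c₁ · ζ₁) w_x(L) + (c₂ · ζ₂) w(L)`. -/
def Beam.formE {n : ℕ} (S : Beam n) (ζ₁ ζ₂ : CtrlState n) (w : TildeH S.L 2) : ℝ :=
  (S.ctrl₁.c ⬝ᵥ ζ₁.ofLp) * w.tipSlope + (S.ctrl₂.c ⬝ᵥ ζ₂.ofLp) * w.tip

/-- `(u, ζ₁, ζ₂)` is the weak solution on `(0, T)` of the controlled beam with initial data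
`u₀ ∈ H̃₀²(0, L)`, `v₀ = ((v₀)_x(L), v₀(L), v₀) ∈ H` and `ζ₁₀, ζ₂₀ ∈ ℝⁿ`:
`û ∈ L²(0, T; V) ∩ H¹(0, T; H) ∩ H²(0, T; V')`, `ζ₁, ζ₂ ∈ H¹(0, T; ℝⁿ)`, and
`⟨û_tt, ŵ⟩ + a(û, ŵ) + b(û_t, ŵ) + e₁(ζ₁, ŵ) + e₂(ζ₂, ŵ) = 0` for almost every `t` and all `w`,
coupled to the ordinary differential equations for `ζ₁`, `ζ₂`. Here `U = û` and its weak derivative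
`U.D 1 = û_t` are `H`-valued and `F = û_tt` is `V'`-valued.  The pairing between `V'` and
`V` extends the inner product of `H`, so that `F = û_tt` means that `⟨F, ŵ⟩` is the weak derivative
of `(û_t, ŵ)_H` for every `w`, and `û_t(0) = v₀` in `V'` means `(û_t, ŵ)_H (0) = (v₀, ŵ)_H` for
every `w`. -/
def Beam.IsWeakSolution {n : ℕ} (S : Beam n) (T : ℝ)
    (u₀ : TildeH S.L 2) (v₀ : PivotH S.L) (ζ₁₀ ζ₂₀ : CtrlState n)
    (u : ℝ → TildeH S.L 2) (ζ₁ ζ₂ : ℝ → CtrlState n) : Prop :=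
  MemLp u 2 (intervalMeasure 0 T) ∧
  ∃ (U : Sobolev 0 T (PivotH S.L) 1)
    (F : Lp (StrongDual ℝ (TildeH S.L 2)) 2 (intervalMeasure 0 T))
    (Z₁ Z₂ : Sobolev 0 T (CtrlState n) 1),
    (U.D 0 =ᵐ[intervalMeasure 0 T] fun t => (u t).hat) ∧
    (Z₁.D 0 =ᵐ[intervalMeasure 0 T] ζ₁) ∧
    (Z₂.D 0 =ᵐ[intervalMeasure 0 T] ζ₂) ∧
    (∀ w : TildeH S.L 2,
      HasWeakDeriv 0 T (fun t => S.innerH (U.D 1 t) w.hat) (fun t => F t w)) ∧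
    (∀ᵐ t ∂(intervalMeasure 0 T), ∀ w : TildeH S.L 2,
      F t w + S.formA (u t) w + S.formB (U.D 1 t) w.hat + S.formE (ζ₁ t) (ζ₂ t) w = 0) ∧
    (∀ᵐ t ∂(intervalMeasure 0 T),
      (Z₁.D 1 t).ofLp = S.ctrl₁.A *ᵥ (ζ₁ t).ofLp + (U.D 1 t).1 • S.ctrl₁.b) ∧
    (∀ᵐ t ∂(intervalMeasure 0 T),
      (Z₂.D 1 t).ofLp = S.ctrl₂.A *ᵥ (ζ₂ t).ofLp + (U.D 1 t).2.1 • S.ctrl₂.b) ∧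
    pointValue 0 T (U.D 0) 0 = u₀.hat ∧
    (∀ w : TildeH S.L 2,
      pointValue 0 T (fun t => S.innerH (U.D 1 t) w.hat) 0 = S.innerH v₀ w.hat) ∧
    pointValue 0 T (Z₁.D 0) 0 = ζ₁₀ ∧
    pointValue 0 T (Z₂.D 0) 0 = ζ₂₀

/-! ### The fully discrete scheme -/

/-- The space `W_h ⊆ H̃₀²(0, L)` of Hermite cubics on the uniform mesh `x_m = m h`, `h = L / N`:
the functions in `H̃₀²(0, L)` (hence `C¹` on `[0, L]`, with `w(0) = w_x(0) = 0`) which are a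
polynomial of degree at most three on each of the `N` mesh cells. -/
def hermiteSpace (L : ℝ) (N : ℕ) : Submodule ℝ (TildeH L 2) where
  carrier := {w | ∀ m < N, ∃ p : Polynomial ℝ, p.natDegree ≤ 3 ∧
    ∀ᵐ x ∂(intervalMeasure 0 L), x ∈ Ioo (m * (L / N)) ((m + 1) * (L / N)) →
      w.D 0 x = p.eval x}
  zero_mem' := by
    intro m _
    refine ⟨0, by simp, ?_⟩
    have h : (⇑(0 : Lp ℝ 2 (intervalMeasure 0 L))) =ᵐ[intervalMeasure 0 L] 0 :=
      Lp.coeFn_zero ℝ 2 _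
    filter_upwards [h] with x hx _
    rw [Polynomial.eval_zero]
    exact hx
  add_mem' := by
    intro v w hv hw m hm
    obtain ⟨p, hp, hvp⟩ := hv m hm
    obtain ⟨r, hr, hwr⟩ := hw m hm
    refine ⟨p + r, (Polynomial.natDegree_add_le _ _).trans (max_le hp hr), ?_⟩
    have h := Lp.coeFn_add (v.1.1 0) (w.1.1 0)
    filter_upwards [hvp, hwr, h] with x h1 h2 h3 hx
    rw [Polynomial.eval_add, ← h1 hx, ← h2 hx]
    exact h3
  smul_mem' := by
    intro c w hw m hm
    obtain ⟨p, hp, hwp⟩ := hw m hm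
    refine ⟨c • p, (Polynomial.natDegree_smul_le _ _).trans hp, ?_⟩
    have h := Lp.coeFn_smul c (w.1.1 0)
    filter_upwards [hwp, h] with x h1 h2 hx
    rw [Polynomial.eval_smul, ← h1 hx]
    exact h2

/-- The function with coefficients `V` in the basis `w` of `W_h`. -/
def reconstruct {L : ℝ} {N m : ℕ} (w : Module.Basis (Fin m) ℝ (hermiteSpace L N))
    (V : Fin m → ℝ) : TildeH L 2 :=
  ∑ i, V i • (w i : TildeH L 2)

/-- The mass matrix `𝔸_{ij} = ∫ μ w_i w_j dx + M w_i(L) w_j(L) + J (w_i)_x(L) (w_j)_x(L)`. -/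
def Beam.massMatrix {n : ℕ} (S : Beam n) {N m : ℕ}
    (w : Module.Basis (Fin m) ℝ (hermiteSpace S.L N)) : Matrix (Fin m) (Fin m) ℝ :=
  Matrix.of fun i j => S.innerH (w i).1.hat (w j).1.hat

/-- The damping matrix `𝔹_{ij} = d₁ (w_i)_x(L) (w_j)_x(L) + d₂ w_i(L) w_j(L)`. -/
def Beam.dampingMatrix {n : ℕ} (S : Beam n) {N m : ℕ}
    (w : Module.Basis (Fin m) ℝ (hermiteSpace S.L N)) : Matrix (Fin m) (Fin m) ℝ :=
  Matrix.of fun i j => S.formB (w i).1.hat (w j).1.hat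

/-- The stiffness matrix
`𝕂_{ij} = ∫ Λ (w_i)_xx (w_j)_xx dx + k₁ (w_i)_x(L) (w_j)_x(L) + k₂ w_i(L) w_j(L)`. -/
def Beam.stiffnessMatrix {n : ℕ} (S : Beam n) {N m : ℕ}
    (w : Module.Basis (Fin m) ℝ (hermiteSpace S.L N)) : Matrix (Fin m) (Fin m) ℝ :=
  Matrix.of fun i j => S.formA (w i).1 (w j).1

/-- The vector `ℂ_j = (c₁ · ζ₁) (w_j)_x(L) + (c₂ · ζ₂) w_j(L)`. -/
def Beam.controlVector {n : ℕ} (S : Beam n) {N m : ℕ}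
    (w : Module.Basis (Fin m) ℝ (hermiteSpace S.L N)) (ζ₁ ζ₂ : CtrlState n) : Fin m → ℝ :=
  fun j => S.formE ζ₁ ζ₂ (w j).1

/-- The Crank-Nicolson scheme with time step `τ`, for the steps `k = 0, …, R - 1`. -/
def Beam.IsCrankNicolson {n : ℕ} (S : Beam n) {N m : ℕ}
    (w : Module.Basis (Fin m) ℝ (hermiteSpace S.L N)) (τ : ℝ) (R : ℕ)
    (U V : ℕ → Fin m → ℝ) (ζ₁ ζ₂ : ℕ → CtrlState n) : Prop :=
  ∀ k < R,
    τ⁻¹ • (U (k + 1) - U k) = (1 / 2 : ℝ) • (V (k + 1) + V k) ∧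
    τ⁻¹ • (S.massMatrix w *ᵥ V (k + 1) - S.massMatrix w *ᵥ V k) =
      - (1 / 2 : ℝ) • (S.stiffnessMatrix w *ᵥ U (k + 1) + S.stiffnessMatrix w *ᵥ U k)
      - (1 / 2 : ℝ) • (S.dampingMatrix w *ᵥ V (k + 1) + S.dampingMatrix w *ᵥ V k)
      - (1 / 2 : ℝ) • (S.controlVector w (ζ₁ (k + 1)) (ζ₂ (k + 1))
          + S.controlVector w (ζ₁ k) (ζ₂ k)) ∧
    τ⁻¹ • ((ζ₁ (k + 1)).ofLp - (ζ₁ k).ofLp) =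
      S.ctrl₁.A *ᵥ ((1 / 2 : ℝ) • ((ζ₁ (k + 1)).ofLp + (ζ₁ k).ofLp)) +
      (((reconstruct w (V (k + 1))).tipSlope + (reconstruct w (V k)).tipSlope) / 2) • S.ctrl₁.b ∧
    τ⁻¹ • ((ζ₂ (k + 1)).ofLp - (ζ₂ k).ofLp) =
      S.ctrl₂.A *ᵥ ((1 / 2 : ℝ) • ((ζ₂ (k + 1)).ofLp + (ζ₂ k).ofLp)) +
      (((reconstruct w (V (k + 1))).tip + (reconstruct w (V k)).tip) / 2) • S.ctrl₂.b

/-! ### Norm and projection -/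

/-- The states `z = (u, v, ζ₁, ζ₂)`. -/
abbrev Beam.State {n : ℕ} (S : Beam n) : Type :=
  TildeH S.L 2 × TildeH S.L 2 × CtrlState n × CtrlState n

/-- The energy norm `‖z‖`, with
`‖z‖² = ½ ∫ Λ u_xx² dx + ½ ∫ μ v² dx + (M/2) v(L)² + (J/2) v_x(L)² + (k₁/2) u_x(L)²
+ (k₂/2) u(L)² + ½ ζ₁ᵀ P₁ ζ₁ + ½ ζ₂ᵀ P₂ ζ₂`. -/
def Beam.energyNorm {n : ℕ} (S : Beam n) (P₁ P₂ : Matrix (Fin n) (Fin n) ℝ) (z : S.State) : ℝ :=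
  Real.sqrt (
    1 / 2 * (∫ x in Ioo 0 S.L, S.Λ x * z.1.D 2 x ^ 2) +
    1 / 2 * (∫ x in Ioo 0 S.L, S.μ x * z.2.1.D 0 x ^ 2) +
    S.M / 2 * z.2.1.tip ^ 2 + S.J / 2 * z.2.1.tipSlope ^ 2 +
    S.ctrl₁.k / 2 * z.1.tipSlope ^ 2 + S.ctrl₂.k / 2 * z.1.tip ^ 2 +
    1 / 2 * (z.2.2.1.ofLp ⬝ᵥ (P₁ *ᵥ z.2.2.1.ofLp)) +
    1 / 2 * (z.2.2.2.ofLp ⬝ᵥ (P₂ *ᵥ z.2.2.2.ofLp)))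

open Classical in
/-- The projection `w̆ ∈ W_h` of `w ∈ H̃₀²(0, L)`, determined by `a(w̆, w_h) = a(w, w_h)` for all
`w_h ∈ W_h`. -/
def Beam.proj {n : ℕ} (S : Beam n) (N : ℕ) (w : TildeH S.L 2) : TildeH S.L 2 :=
  if h : ∃ p ∈ hermiteSpace S.L N, ∀ r ∈ hermiteSpace S.L N, S.formA p r = S.formA w r
  then h.choose else 0

end

/-!
The discrete solution is compared with the Galerkin projection `P u` of the exact solution onto the
Hermite cubics, orthogonal for the stiffness form `a`.  The difference solves the Crank-Nicolson
equations up to residuals, and these are of two kinds: errors of the trapezoidal rule for `u`, `u_t`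
and `ζ_j`, and projection errors of `u_t` and of its increments.

*Stability.*  Testing the perturbed scheme with the mean velocity gives a discrete energy identity in
which the stiffness terms cancel, and the boundary damping together with the controllers contributes
a nonpositive amount.  The latter is the dissipation inequality `Controller.IsStorage.dissipation`,
obtained from the Lyapunov equations for `P_j` by completing a square.  The remaining terms are
residuals paired with the sum of two consecutive states.  As a difference of squares of energy norms
carries the same factor, it cancels, and `stateNorm_step_le` bounds the growth of the norm in one
step by the residuals alone.  Hence the errors are summed, without a Gronwall argument.  The damping
term of the projection error is controlled by the mass seminorm, because `M` and `J` are positive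
(`Beam.exists_dampL_bound`).

*Consistency.*  In one step of length `τ` the trapezoidal rule has an error of at most `τ²` times the
integral of the norm of the third derivative (`norm_trapezoid_sub_le`).  The projection is
quasi-optimal, with constants not depending on the mesh (`exists_galerkin_projection`), as `a` is
coercive on `H̃₀²` (`Beam.exists_coercive_stiffL`).  A competitor at distance `O(h²)` arises without
Hermite interpolation: a function of `H̃₀²` whose second derivative is affine on each cell, with
jumps allowed, is a Hermite cubic.  So the double primitive of the cellwise Taylor polynomial of
`w_xx` will do (`exists_hermite_approx`).

These ingredients are put together for abstract forms and an abstract subspace in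
`crankNicolson_error`.  To apply the estimate to the beam, the weak formulation is turned into
equations at every time of the closed interval: weak time derivatives are unique, so `u_tt` in the
sense of `V'` is represented by the second derivative of the smooth solution, and both sides are
continuous in time (`Beam.IsWeakSolution.pointwise`).
-/

noncomputable section

/-! ### Weak derivatives of vector valued functions -/

theorem IsTestFunction.smul_integrable {X : Type*} [NormedAddCommGroup X] [NormedSpace ℝ X]
    {a b : ℝ} {φ : ℝ → ℝ} (hφ : IsTestFunction a b φ) {f : ℝ → X}
    (hf : Integrable f (intervalMeasure a b)) :
    Integrable (fun t => φ t • f t) (intervalMeasure a b) := by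
  obtain ⟨K, hK⟩ := hφ.1.continuous.bounded_above_of_compact_support hφ.2.1
  exact hf.bdd_smul K hφ.1.continuous.aestronglyMeasurable (Eventually.of_forall hK)

theorem IsTestFunction.deriv {a b : ℝ} {φ : ℝ → ℝ} (hφ : IsTestFunction a b φ) :
    IsTestFunction a b (deriv φ) :=
  ⟨(contDiff_infty_iff_deriv.1 hφ.1).2, hφ.2.1.deriv,
    tsupport_deriv_subset.trans hφ.2.2⟩

/-- Bounded linear maps commute with weak differentiation. -/
theorem HasWeakDeriv.clm_comp {X Y : Type*} [NormedAddCommGroup X] [NormedSpace ℝ X]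
    [CompleteSpace X] [NormedAddCommGroup Y] [NormedSpace ℝ Y] [CompleteSpace Y]
    {a b : ℝ} {f g : ℝ → X} (hf : Integrable f (intervalMeasure a b))
    (hg : Integrable g (intervalMeasure a b)) (h : HasWeakDeriv a b f g) (ℓ : X →L[ℝ] Y) :
    HasWeakDeriv a b (fun t => ℓ (f t)) (fun t => ℓ (g t)) := by
  intro φ hφ
  have h1 := congrArg ℓ (h φ hφ)
  rw [map_neg, ← ℓ.integral_comp_comm (hφ.deriv.smul_integrable hf),
    ← ℓ.integral_comp_comm (hφ.smul_integrable hg)] at h1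
  simpa only [map_smul] using h1

theorem HasWeakDeriv.congr {X : Type*} [NormedAddCommGroup X] [NormedSpace ℝ X]
    {a b : ℝ} {f f' g g' : ℝ → X} (h : HasWeakDeriv a b f g)
    (hf : f =ᵐ[intervalMeasure a b] f') (hg : g =ᵐ[intervalMeasure a b] g') :
    HasWeakDeriv a b f' g' := by
  intro φ hφ
  have h1 : ∫ t in Ioo a b, deriv φ t • f' t = ∫ t in Ioo a b, deriv φ t • f t := by
    refine integral_congr_ae ?_
    filter_upwards [hf] with t ht
    rw [ht]
  have h2 : ∫ t in Ioo a b, φ t • g' t = ∫ t in Ioo a b, φ t • g t := by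
    refine integral_congr_ae ?_
    filter_upwards [hg] with t ht
    rw [ht]
  rw [h1, h2, h φ hφ]

/-- A function which integrates to zero against every test function vanishes. -/
theorem ae_eq_zero_of_integral_testFunction {X : Type*} [NormedAddCommGroup X] [NormedSpace ℝ X]
    [CompleteSpace X] {a b : ℝ} {f : ℝ → X} (hf : Integrable f (intervalMeasure a b))
    (h : ∀ φ, IsTestFunction a b φ → ∫ t in Ioo a b, φ t • f t = 0) :
    f =ᵐ[intervalMeasure a b] 0 := by
  have hloc : LocallyIntegrableOn f (Ioo a b) volume := IntegrableOn.locallyIntegrableOn hf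
  refine (ae_restrict_iff' measurableSet_Ioo).2
    (isOpen_Ioo.ae_eq_zero_of_integral_contDiff_smul_eq_zero hloc fun φ h1 h2 h3 => ?_)
  rw [← h φ ⟨h1, h2, h3⟩, setIntegral_eq_integral_of_forall_compl_eq_zero]
  intro x hx
  rw [image_eq_zero_of_notMem_tsupport (f := φ) fun hm => hx (h3 hm), zero_smul]

/-- Weak derivatives are unique. -/
theorem HasWeakDeriv.ae_unique {X : Type*} [NormedAddCommGroup X] [NormedSpace ℝ X]
    [CompleteSpace X] {a b : ℝ} {f g g' : ℝ → X} (h : HasWeakDeriv a b f g)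
    (h' : HasWeakDeriv a b f g') (hg : Integrable g (intervalMeasure a b))
    (hg' : Integrable g' (intervalMeasure a b)) : g =ᵐ[intervalMeasure a b] g' := by
  have h0 : g - g' =ᵐ[intervalMeasure a b] 0 := by
    refine ae_eq_zero_of_integral_testFunction (hg.sub hg') fun φ hφ => ?_
    simp only [Pi.sub_apply, smul_sub]
    rw [integral_sub (hφ.smul_integrable hg) (hφ.smul_integrable hg'), sub_eq_zero]
    exact neg_injective ((h φ hφ).symm.trans (h' φ hφ))
  filter_upwards [h0] with t ht
  exact sub_eq_zero.1 ht

theorem intervalMeasure.intervalIntegrable {X : Type*} [NormedAddCommGroup X] {a b : ℝ} {g : ℝ → X}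
    (hg : Integrable g (intervalMeasure a b)) {s t : ℝ} (hs : s ∈ Icc a b) (ht : t ∈ Icc a b) :
    IntervalIntegrable g volume s t := by
  have hab : a ≤ b := hs.1.trans hs.2
  have h : IntervalIntegrable g volume a b :=
    (intervalIntegrable_iff_integrableOn_Ioo_of_le hab).2 hg
  exact h.mono_set (uIcc_subset_uIcc (by rwa [uIcc_of_le hab]) (by rwa [uIcc_of_le hab]))

theorem continuousOn_primitive_of_integrable {X : Type*} [NormedAddCommGroup X] [NormedSpace ℝ X]
    {a b : ℝ} (hab : a ≤ b) {g : ℝ → X} (hg : Integrable g (intervalMeasure a b)) :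
    ContinuousOn (fun x => ∫ y in a..x, g y) (Icc a b) := by
  have h1 : IntegrableOn g (uIcc a b) := by
    rw [uIcc_of_le hab, integrableOn_Icc_iff_integrableOn_Ioo]
    exact hg
  have := intervalIntegral.continuousOn_primitive_interval h1
  rwa [uIcc_of_le hab] at this

/-- A vector valued function with integrable weak derivative `g` is a primitive of `g`.  The scalar
statement, applied to the functionals of `f`, shows that the difference is weakly constant, hence
equal to its mean value. -/
theorem HasWeakDeriv.exists_primitive_vector {X : Type*} [NormedAddCommGroup X] [NormedSpace ℝ X]
    [CompleteSpace X] {a b : ℝ} (hab : a < b) {f g : ℝ → X}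
    (hf : Integrable f (intervalMeasure a b)) (hg : Integrable g (intervalMeasure a b))
    (h : HasWeakDeriv a b f g) :
    ∃ c : X, f =ᵐ[intervalMeasure a b] fun x => c + ∫ y in a..x, g y := by
  have hGi : Integrable (fun x => ∫ y in a..x, g y) (intervalMeasure a b) :=
    ((continuousOn_primitive_of_integrable hab.le hg).integrableOn_Icc).mono_set
      Ioo_subset_Icc_self
  set F : ℝ → X := fun x => f x - ∫ y in a..x, g y with hF
  have hFi : Integrable F (intervalMeasure a b) := hf.sub hGi
  set c : X := (b - a)⁻¹ • ∫ x in Ioo a b, F x with hc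
  have hℓ : ∀ ℓ : StrongDual ℝ X, ∀ᵐ x ∂(intervalMeasure a b), ℓ (F x) = ℓ c := by
    intro ℓ
    obtain ⟨k, hk⟩ := (h.clm_comp hf hg ℓ).exists_primitive hab (ℓ.integrable_comp hf)
      (ℓ.integrable_comp hg)
    have h1 : ∀ᵐ x ∂(intervalMeasure a b), ℓ (F x) = k := by
      filter_upwards [hk, ae_restrict_mem measurableSet_Ioo] with x hx hxI
      have h2 : ∫ y in a..x, ℓ (g y) = ℓ (∫ y in a..x, g y) :=
        ℓ.intervalIntegral_comp_comm (intervalMeasure.intervalIntegrable hg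
          (left_mem_Icc.2 hab.le) (Ioo_subset_Icc_self hxI))
      simp only [hF, map_sub]
      rw [hx, h2]
      ring
    have h3 : ℓ c = k := by
      rw [hc, map_smul, ← ℓ.integral_comp_comm hFi, integral_congr_ae h1]
      simp only [integral_const, measureReal_restrict_apply_univ, Real.volume_real_Ioo_of_le hab.le,
        smul_eq_mul]
      rw [← mul_assoc, inv_mul_cancel₀ (by linarith), one_mul]
    rw [h3]
    exact h1
  have h0 : (fun x => F x - c) =ᵐ[intervalMeasure a b] 0 := by
    refine ae_eq_zero_of_integral_testFunction (hFi.sub (integrable_const c)) fun φ hφ => ?_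
    refine (SeparatingDual.eq_zero_iff_forall_dual_eq_zero (R := ℝ) _).2 fun ℓ => ?_
    have hi : Integrable (fun x => F x - c) (intervalMeasure a b) := hFi.sub (integrable_const c)
    rw [← ℓ.integral_comp_comm (hφ.smul_integrable hi)]
    rw [integral_congr_ae (g := fun _ => (0 : ℝ)), integral_zero]
    filter_upwards [hℓ ℓ] with x hx
    simp [hx]
  refine ⟨c, ?_⟩
  filter_upwards [h0] with x hx
  have h1 : f x - (∫ y in a..x, g y) - c = 0 := hx
  rw [sub_sub, sub_eq_zero] at h1
  rw [h1, add_comm]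

theorem HasWeakDeriv.isContRep_pointValue {X : Type*} [NormedAddCommGroup X] [NormedSpace ℝ X]
    [CompleteSpace X] {a b : ℝ} (hab : a < b) {f g : ℝ → X}
    (hf : Integrable f (intervalMeasure a b)) (hg : Integrable g (intervalMeasure a b))
    (h : HasWeakDeriv a b f g) : IsContRep a b f (pointValue a b f) := by
  obtain ⟨c, hc⟩ := h.exists_primitive_vector hab hf hg
  have hrep : IsContRep a b f (fun x => c + ∫ y in a..x, g y) :=
    ⟨continuousOn_const.add (continuousOn_primitive_of_integrable hab.le hg), hc⟩
  refine ⟨hrep.1.congr fun x hx => pointValue_eq hab hrep hx, ?_⟩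
  filter_upwards [hc, ae_restrict_mem measurableSet_Ioo] with x hx hxI
  rw [pointValue_eq hab hrep (Ioo_subset_Icc_self hxI), hx]

theorem HasWeakDeriv.pointValue_sub {X : Type*} [NormedAddCommGroup X] [NormedSpace ℝ X]
    [CompleteSpace X] {a b : ℝ} (hab : a < b) {f g : ℝ → X}
    (hf : Integrable f (intervalMeasure a b)) (hg : Integrable g (intervalMeasure a b))
    (h : HasWeakDeriv a b f g) {s t : ℝ} (hs : s ∈ Icc a b) (ht : t ∈ Icc a b) :
    pointValue a b f t - pointValue a b f s = ∫ x in s..t, g x := by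
  obtain ⟨c, hc⟩ := h.exists_primitive_vector hab hf hg
  have hrep : IsContRep a b f (fun x => c + ∫ y in a..x, g y) :=
    ⟨continuousOn_const.add (continuousOn_primitive_of_integrable hab.le hg), hc⟩
  have ha : a ∈ Icc a b := left_mem_Icc.2 hab.le
  rw [pointValue_eq hab hrep hs, pointValue_eq hab hrep ht, add_sub_add_left_eq_sub,
    intervalIntegral.integral_interval_sub_left (intervalMeasure.intervalIntegrable hg ha ht)
    (intervalMeasure.intervalIntegrable hg ha hs)]

/-- Continuous functions which agree almost everywhere on `(a, b)` agree on `[a, b]`. -/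
theorem eqOn_Icc_of_ae_intervalMeasure {X : Type*} [NormedAddCommGroup X] {a b : ℝ} (hab : a < b)
    {f g : ℝ → X} (h : f =ᵐ[intervalMeasure a b] g) (hf : ContinuousOn f (Icc a b))
    (hg : ContinuousOn g (Icc a b)) : EqOn f g (Icc a b) := by
  have h2 : f =ᵐ[volume.restrict (Ioo a b)] g := h
  rw [Measure.restrict_congr_set (Ioo_ae_eq_Icc (μ := volume) (a := a) (b := b))] at h2
  exact Measure.eqOn_Icc_of_ae_eq volume hab.ne h2 hf hg

/-- The fundamental theorem of calculus at every point of the closed interval, for a continuous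
integrand. -/
theorem hasDerivWithinAt_of_sub_eq_integral {X : Type*} [NormedAddCommGroup X] [NormedSpace ℝ X]
    [CompleteSpace X] {a b : ℝ} (hab : a < b) {f g : ℝ → X} (hg : ContinuousOn g (Icc a b))
    (h : ∀ s ∈ Icc a b, ∀ t ∈ Icc a b, f t - f s = ∫ x in s..t, g x) {t : ℝ} (ht : t ∈ Icc a b) :
    HasDerivWithinAt f (g t) (Icc a b) t := by
  have ha : a ∈ Icc a b := left_mem_Icc.2 hab.le
  have : Fact (t ∈ Icc a b) := ⟨ht⟩
  have h1 : HasDerivWithinAt (fun u => ∫ x in a..u, g x) (g t) (Icc a b) t := by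
    refine intervalIntegral.integral_hasDerivWithinAt_right ?_ ?_ (hg t ht)
    · refine ContinuousOn.intervalIntegrable (hg.mono ?_)
      rw [uIcc_of_le ht.1]
      exact Icc_subset_Icc_right ht.2
    · exact hg.stronglyMeasurableAtFilter_nhdsWithin measurableSet_Icc t
  refine (h1.add_const (f a)).congr (fun x hx => ?_) ?_
  · rw [← h a ha x hx, sub_add_cancel]
  · rw [← h a ha t ht, sub_add_cancel]

/-- The error of the trapezoidal rule: if `f' = p`, `p' = q` and `q' = g`, then the mean of the end
point values of `p` differs from the difference quotient of `f` by a term of second order. -/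
theorem norm_trapezoid_sub_le {X : Type*} [NormedAddCommGroup X] [NormedSpace ℝ X]
    [CompleteSpace X] {s t : ℝ} (hst : s < t) {f p q g : ℝ → X}
    (hg : IntervalIntegrable g volume s t) (hp : ContinuousOn p (Icc s t))
    (hq : ContinuousOn q (Icc s t))
    (hfp : ∀ x ∈ Icc s t, ∀ y ∈ Icc s t, f y - f x = ∫ r in x..y, p r)
    (hpq : ∀ x ∈ Icc s t, ∀ y ∈ Icc s t, p y - p x = ∫ r in x..y, q r)
    (hqg : ∀ x ∈ Icc s t, ∀ y ∈ Icc s t, q y - q x = ∫ r in x..y, g r) :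
    ‖((t - s) / 2) • (p t + p s) - (f t - f s)‖ ≤ (t - s) ^ 2 * ∫ r in s..t, ‖g r‖ := by
  set I : ℝ := ∫ r in s..t, ‖g r‖ with hI
  have hI0 : 0 ≤ I := intervalIntegral.integral_nonneg hst.le fun _ _ => norm_nonneg _
  have hs : s ∈ Icc s t := left_mem_Icc.2 hst.le
  have hosc : ∀ x ∈ Icc s t, ∀ y ∈ Icc s t, x ≤ y → ‖q y - q x‖ ≤ I := by
    intro x hx y hy hxy
    rw [hqg x hx y hy]
    refine (intervalIntegral.norm_integral_le_integral_norm hxy).trans ?_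
    exact intervalIntegral.integral_mono_interval hx.1 hxy hy.2
      (Eventually.of_forall fun _ => norm_nonneg _) hg.norm
  -- the error as a function of the right end point, and its derivative
  set H : ℝ → X := fun r => ((r - s) / 2) • (p r + p s) - (f r - f s) with hH
  set H' : ℝ → X := fun r => (1 / 2 : ℝ) • ((r - s) • q r - (p r - p s)) with hH'
  have hd : ∀ r ∈ Icc s t, HasDerivWithinAt H (H' r) (Icc s t) r := by
    intro r hr
    have d1 := hasDerivWithinAt_of_sub_eq_integral hst hq hpq hr
    have d2 := hasDerivWithinAt_of_sub_eq_integral hst hp hfp hr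
    have d3 : HasDerivWithinAt (fun r : ℝ => (r - s) / 2) (1 / 2) (Icc s t) r :=
      ((hasDerivWithinAt_id r _).sub_const s).div_const 2
    have d4 := (d3.smul (d1.add_const (p s))).sub (d2.sub_const (f s))
    refine d4.congr_deriv ?_
    simp only [hH']
    module
  have hb : ∀ r ∈ Ico s t, ‖H' r‖ ≤ (t - s) * I := by
    intro r hr
    have hr' : r ∈ Icc s t := Ico_subset_Icc_self hr
    have hqi : IntervalIntegrable q volume s r := by
      refine ContinuousOn.intervalIntegrable (hq.mono ?_)
      rw [uIcc_of_le hr.1]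
      exact Icc_subset_Icc_right hr'.2
    have e1 : (r - s) • q r - (p r - p s) = ∫ x in s..r, (q r - q x) := by
      rw [intervalIntegral.integral_sub intervalIntegrable_const hqi,
        intervalIntegral.integral_const, hpq s hs r hr']
    have e2 : ‖∫ x in s..r, (q r - q x)‖ ≤ I * |r - s| := by
      refine intervalIntegral.norm_integral_le_of_norm_le_const fun x hx => ?_
      rw [uIoc_of_le hr.1] at hx
      exact hosc x ⟨hx.1.le, hx.2.trans hr'.2⟩ r hr' hx.2
    rw [abs_of_nonneg (sub_nonneg.2 hr.1)] at e2
    simp only [hH']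
    rw [norm_smul, e1]
    have e3 : I * (r - s) ≤ I * (t - s) :=
      mul_le_mul_of_nonneg_left (by linarith [hr.2]) hI0
    have e4 : 0 ≤ ‖∫ x in s..r, (q r - q x)‖ := norm_nonneg _
    norm_num
    linarith
  have h1 := norm_image_sub_le_of_norm_deriv_le_segment' hd hb t (right_mem_Icc.2 hst.le)
  have h2 : H s = 0 := by simp [hH]
  rw [h2, sub_zero] at h1
  refine h1.trans (le_of_eq ?_)
  ring

/-- A sup bound for a function with integrable derivative. -/
theorem norm_le_of_sub_eq_integral {X : Type*} [NormedAddCommGroup X] [NormedSpace ℝ X]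
    {a b : ℝ} (hab : a < b) {f g : ℝ → X} (hf : ContinuousOn f (Icc a b))
    (hg : Integrable g (intervalMeasure a b))
    (h : ∀ s ∈ Icc a b, ∀ t ∈ Icc a b, f t - f s = ∫ x in s..t, g x) {t : ℝ} (ht : t ∈ Icc a b) :
    ‖f t‖ ≤ (b - a)⁻¹ * (∫ x in Ioo a b, ‖f x‖) + ∫ x in Ioo a b, ‖g x‖ := by
  set I : ℝ := ∫ x in Ioo a b, ‖g x‖ with hI
  have hfi : Integrable f (intervalMeasure a b) :=
    hf.integrableOn_Icc.mono_set Ioo_subset_Icc_self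
  have h1 : ∀ s ∈ Ioo a b, ‖f t‖ ≤ ‖f s‖ + I := by
    intro s hs
    have hs' := Ioo_subset_Icc_self hs
    have e1 : ‖f t - f s‖ ≤ I := by
      rw [h s hs' t ht, hI, ← integral_Ioc_eq_integral_Ioo]
      refine intervalIntegral.norm_integral_le_integral_norm_uIoc.trans ?_
      refine setIntegral_mono_set ?_ (Eventually.of_forall fun _ => norm_nonneg _) ?_
      · have h0 : IntegrableOn g (Ioc a b) := by
          rw [integrableOn_Ioc_iff_integrableOn_Ioo]
          exact hg
        exact h0.norm
      · refine (Ioc_subset_Ioc (le_min hs'.1 ht.1) (max_le hs'.2 ht.2)).eventuallyLE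
    have e2 := norm_sub_norm_le (f t) (f s)
    linarith
  have h2 : ∫ s in Ioo a b, ‖f t‖ ≤ ∫ s in Ioo a b, (‖f s‖ + I) :=
    setIntegral_mono_on (integrable_const _) (hfi.norm.add (integrable_const _))
      measurableSet_Ioo h1
  rw [integral_add hfi.norm (integrable_const _)] at h2
  simp only [integral_const, measureReal_restrict_apply_univ, Real.volume_real_Ioo_of_le hab.le,
    smul_eq_mul] at h2
  have h3 : 0 < b - a := sub_pos.2 hab
  rw [inv_mul_eq_div]
  have h4 : ‖f t‖ ≤ ((∫ x in Ioo a b, ‖f x‖) + (b - a) * I) / (b - a) := by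
    rw [le_div_iff₀ h3]
    linarith
  rwa [add_div, mul_div_cancel_left₀ _ h3.ne'] at h4

theorem integral_norm_Lp_le {X : Type*} [NormedAddCommGroup X] {a b : ℝ} (hab : a ≤ b)
    (f : Lp X 2 (intervalMeasure a b)) : ∫ x in Ioo a b, ‖f x‖ ≤ Real.sqrt (b - a) * ‖f‖ := by
  have hf1 : Integrable f (intervalMeasure a b) := (Lp.memLp f).integrable one_le_two
  rw [integral_norm_eq_lintegral_enorm hf1.1, ← eLpNorm_one_eq_lintegral_enorm, Lp.norm_def,
    mul_comm]
  have hfin : (intervalMeasure a b univ) ^ (1 / (1 : ENNReal).toReal - 1 / (2 : ENNReal).toReal) ≠ ⊤ :=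
    ENNReal.rpow_ne_top_of_nonneg (by norm_num) (measure_ne_top _ _)
  have h := ENNReal.toReal_mono (ENNReal.mul_ne_top (Lp.eLpNorm_ne_top f) hfin)
    (eLpNorm_le_eLpNorm_mul_rpow_measure_univ one_le_two hf1.1)
  refine h.trans (le_of_eq ?_)
  rw [ENNReal.toReal_mul]
  congr 1
  rw [Measure.restrict_apply_univ, Real.volume_Ioo, ← ENNReal.toReal_rpow,
    ENNReal.toReal_ofReal (sub_nonneg.2 hab), Real.sqrt_eq_rpow]
  norm_num

/-! ### Normed structures on the Sobolev spaces -/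

/-- Names the norm inherited from the ambient `L²` product, so that instance search need not
unfold the submodule coercions; the next five instances serve the same purpose.  They are local
because the norms in the final statement are the inferred ones, to which these unfold. -/
local instance Sobolev.instNormedAddCommGroup {X : Type*} [NormedAddCommGroup X] [NormedSpace ℝ X]
    (a b : ℝ) (m : ℕ) : NormedAddCommGroup (Sobolev a b X m) :=
  Submodule.normedAddCommGroup _

local instance Sobolev.instSeminormedAddCommGroup {X : Type*} [NormedAddCommGroup X]
    [NormedSpace ℝ X] (a b : ℝ) (m : ℕ) : SeminormedAddCommGroup (Sobolev a b X m) :=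
  NormedAddCommGroup.toSeminormedAddCommGroup

local instance Sobolev.instNormedSpace {X : Type*} [NormedAddCommGroup X] [NormedSpace ℝ X]
    (a b : ℝ) (m : ℕ) : NormedSpace ℝ (Sobolev a b X m) :=
  Submodule.normedSpace _

local instance TildeH.instNormedAddCommGroup (L : ℝ) (k : ℕ) : NormedAddCommGroup (TildeH L k) :=
  Submodule.normedAddCommGroup _

local instance TildeH.instSeminormedAddCommGroup (L : ℝ) (k : ℕ) :
    SeminormedAddCommGroup (TildeH L k) :=
  NormedAddCommGroup.toSeminormedAddCommGroup

local instance TildeH.instNormedSpace (L : ℝ) (k : ℕ) : NormedSpace ℝ (TildeH L k) :=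
  Submodule.normedSpace _

/-! ### Elements of Sobolev spaces -/

theorem Sobolev.integrable_D {X : Type*} [NormedAddCommGroup X] [NormedSpace ℝ X] {a b : ℝ} {m : ℕ}
    (u : Sobolev a b X m) (i : Fin (m + 1)) : Integrable (u.D i) (intervalMeasure a b) :=
  (Lp.memLp (u.1 i)).integrable one_le_two

theorem Sobolev.hasWeakDeriv_D {X : Type*} [NormedAddCommGroup X] [NormedSpace ℝ X] {a b : ℝ}
    {m : ℕ} (u : Sobolev a b X m) (i : Fin m) : HasWeakDeriv a b (u.D i.castSucc) (u.D i.succ) :=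
  u.2 i

theorem Sobolev.norm_coe_le {X : Type*} [NormedAddCommGroup X] [NormedSpace ℝ X] {a b : ℝ} {m : ℕ}
    (u : Sobolev a b X m) (i : Fin (m + 1)) : ‖u.1 i‖ ≤ ‖u‖ :=
  PiLp.norm_apply_le u.1 i

theorem Sobolev.integral_norm_D_le {X : Type*} [NormedAddCommGroup X] [NormedSpace ℝ X] {a b : ℝ}
    (hab : a ≤ b) {m : ℕ} (u : Sobolev a b X m) (i : Fin (m + 1)) :
    ∫ x in Ioo a b, ‖u.D i x‖ ≤ Real.sqrt (b - a) * ‖u‖ :=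
  (integral_norm_Lp_le hab (u.1 i)).trans
    (mul_le_mul_of_nonneg_left (u.norm_coe_le i) (Real.sqrt_nonneg _))

theorem Sobolev.isContRep_pointValue {X : Type*} [NormedAddCommGroup X] [NormedSpace ℝ X]
    [CompleteSpace X] {a b : ℝ} (hab : a < b) {m : ℕ} (u : Sobolev a b X m) (i : Fin m) :
    IsContRep a b (u.D i.castSucc) (pointValue a b (u.D i.castSucc)) :=
  (u.hasWeakDeriv_D i).isContRep_pointValue hab (u.integrable_D _) (u.integrable_D _)

theorem Sobolev.pointValue_sub {X : Type*} [NormedAddCommGroup X] [NormedSpace ℝ X]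
    [CompleteSpace X] {a b : ℝ} (hab : a < b) {m : ℕ} (u : Sobolev a b X m) (i : Fin m)
    {s t : ℝ} (hs : s ∈ Icc a b) (ht : t ∈ Icc a b) :
    pointValue a b (u.D i.castSucc) t - pointValue a b (u.D i.castSucc) s
      = ∫ x in s..t, u.D i.succ x :=
  (u.hasWeakDeriv_D i).pointValue_sub hab (u.integrable_D _) (u.integrable_D _) hs ht

theorem intervalIntegral_congr_ae_Ioo {X : Type*} [NormedAddCommGroup X] [NormedSpace ℝ X]
    {a b : ℝ} {f g : ℝ → X} (h : f =ᵐ[intervalMeasure a b] g) {s t : ℝ}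
    (hs : s ∈ Icc a b) (ht : t ∈ Icc a b) : ∫ x in s..t, f x = ∫ x in s..t, g x := by
  have h2 : f =ᵐ[volume.restrict (Ioo a b)] g := h
  rw [Measure.restrict_congr_set (Ioo_ae_eq_Icc (μ := volume) (a := a) (b := b))] at h2
  refine intervalIntegral.integral_congr_ae ?_
  filter_upwards [(ae_restrict_iff' measurableSet_Icc).1 h2] with x hx hxI
  exact hx ⟨(le_min hs.1 ht.1).trans hxI.1.le, hxI.2.trans (max_le hs.2 ht.2)⟩

/-- If the derivative has a continuous representative too, the integrand may be replaced by it. -/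
theorem Sobolev.pointValue_sub' {X : Type*} [NormedAddCommGroup X] [NormedSpace ℝ X]
    [CompleteSpace X] {a b : ℝ} (hab : a < b) {m : ℕ} (u : Sobolev a b X m) (i j : Fin m)
    (hij : i.succ = j.castSucc) {s t : ℝ} (hs : s ∈ Icc a b) (ht : t ∈ Icc a b) :
    pointValue a b (u.D i.castSucc) t - pointValue a b (u.D i.castSucc) s
      = ∫ x in s..t, pointValue a b (u.D j.castSucc) x := by
  rw [u.pointValue_sub hab i hs ht, hij]
  exact intervalIntegral_congr_ae_Ioo (u.isContRep_pointValue hab j).2 hs ht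

theorem Sobolev.norm_pointValue_le {X : Type*} [NormedAddCommGroup X] [NormedSpace ℝ X]
    [CompleteSpace X] {a b : ℝ} (hab : a < b) {m : ℕ} (u : Sobolev a b X m) (i : Fin m)
    {t : ℝ} (ht : t ∈ Icc a b) :
    ‖pointValue a b (u.D i.castSucc) t‖ ≤
      (((b - a)⁻¹ + 1) * Real.sqrt (b - a)) * ‖u‖ := by
  have hr := u.isContRep_pointValue hab i
  have h1 := norm_le_of_sub_eq_integral hab hr.1 (u.integrable_D i.succ)
    (fun s hs t ht => u.pointValue_sub hab i hs ht) ht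
  have h2 : ∫ x in Ioo a b, ‖pointValue a b (u.D i.castSucc) x‖
      = ∫ x in Ioo a b, ‖u.D i.castSucc x‖ := by
    refine integral_congr_ae ?_
    filter_upwards [hr.2] with x hx
    rw [hx]
  rw [h2] at h1
  have h3 := u.integral_norm_D_le hab.le i.castSucc
  have h4 := u.integral_norm_D_le hab.le i.succ
  have h5 : 0 ≤ (b - a)⁻¹ := inv_nonneg.2 (sub_nonneg.2 hab.le)
  nlinarith [mul_le_mul_of_nonneg_left h3 h5]

/-- The trapezoidal rule for three consecutive time derivatives. -/
theorem Sobolev.norm_trapezoid_le {X : Type*} [NormedAddCommGroup X] [NormedSpace ℝ X]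
    [CompleteSpace X] {a b : ℝ} (hab : a < b) {m : ℕ} (u : Sobolev a b X m) (i j k : Fin m)
    (hij : i.succ = j.castSucc) (hjk : j.succ = k.castSucc) {s t : ℝ} (hs : a ≤ s) (hst : s < t)
    (ht : t ≤ b) :
    ‖((t - s) / 2) • (pointValue a b (u.D j.castSucc) t + pointValue a b (u.D j.castSucc) s)
        - (pointValue a b (u.D i.castSucc) t - pointValue a b (u.D i.castSucc) s)‖
      ≤ (t - s) ^ 2 * ∫ r in s..t, ‖u.D k.succ r‖ := by
  have hsub : Icc s t ⊆ Icc a b := Icc_subset_Icc hs ht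
  have hs' : s ∈ Icc a b := hsub (left_mem_Icc.2 hst.le)
  have ht' : t ∈ Icc a b := hsub (right_mem_Icc.2 hst.le)
  exact norm_trapezoid_sub_le hst
    (intervalMeasure.intervalIntegrable (u.integrable_D _) hs' ht')
    ((u.isContRep_pointValue hab j).1.mono hsub) ((u.isContRep_pointValue hab k).1.mono hsub)
    (fun x hx y hy => u.pointValue_sub' hab i j hij (hsub hx) (hsub hy))
    (fun x hx y hy => u.pointValue_sub' hab j k hjk (hsub hx) (hsub hy))
    (fun x hx y hy => u.pointValue_sub hab k (hsub hx) (hsub hy))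

/-! ### The spaces `H̃₀ᵏ(0, L)` -/

theorem VanishesAtLeft.pointValue_eq_zero {X : Type*} [NormedAddCommGroup X] {a b : ℝ} (hab : a < b)
    {f : ℝ → X} (h : VanishesAtLeft a b f) : pointValue a b f a = 0 := by
  obtain ⟨g, hg, hg0⟩ := h
  rw [pointValue_eq hab hg (left_mem_Icc.2 hab.le), hg0]

theorem TildeH.tipSlope_eq {L : ℝ} (hL : 0 < L) (w : TildeH L 2) :
    w.tipSlope = ∫ x in (0 : ℝ)..L, w.D 2 x := by
  have h := Sobolev.pointValue_sub hL w.1 (1 : Fin 2) (left_mem_Icc.2 hL.le) (right_mem_Icc.2 hL.le)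
  have h0 : pointValue 0 L (w.1.D 1) 0 = 0 := (w.2 1 (by simp)).pointValue_eq_zero hL
  have h1 : w.tipSlope - pointValue 0 L (w.1.D 1) 0 = ∫ x in (0 : ℝ)..L, w.D 2 x := h
  rwa [h0, sub_zero] at h1

theorem TildeH.tip_eq {L : ℝ} (hL : 0 < L) (w : TildeH L 2) :
    w.tip = ∫ x in (0 : ℝ)..L, w.D 1 x := by
  have h := Sobolev.pointValue_sub hL w.1 (0 : Fin 2) (left_mem_Icc.2 hL.le) (right_mem_Icc.2 hL.le)
  have h0 : pointValue 0 L (w.1.D 0) 0 = 0 := (w.2 0 (by simp)).pointValue_eq_zero hL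
  have h1 : w.tip - pointValue 0 L (w.1.D 0) 0 = ∫ x in (0 : ℝ)..L, w.D 1 x := h
  rwa [h0, sub_zero] at h1

theorem norm_Lp_le_of_ae_bound {X : Type*} [NormedAddCommGroup X] {a b : ℝ} (hab : a ≤ b)
    (f : Lp X 2 (intervalMeasure a b)) {C : ℝ} (hC : 0 ≤ C)
    (h : ∀ᵐ x ∂(intervalMeasure a b), ‖f x‖ ≤ C) : ‖f‖ ≤ Real.sqrt (b - a) * C := by
  refine (Lp.norm_le_of_ae_bound hC h).trans (le_of_eq ?_)
  have h1 : (measureUnivNNReal (intervalMeasure a b) : ℝ) = b - a := by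
    change (intervalMeasure a b).real univ = b - a
    rw [measureReal_restrict_apply_univ, Real.volume_real_Ioo_of_le hab]
  rw [h1, Real.sqrt_eq_rpow]
  norm_num

/-- The Poincaré inequality for a function vanishing at the left end point. -/
theorem Sobolev.norm_le_of_vanishesAtLeft {L : ℝ} (hL : 0 < L) {k : ℕ} (w : Sobolev 0 L ℝ k)
    (i : Fin k) (h : VanishesAtLeft 0 L (w.D i.castSucc)) :
    ‖w.1 i.castSucc‖ ≤ L * ‖w.1 i.succ‖ := by
  have h0 := h.pointValue_eq_zero hL
  have h1 : ∀ x ∈ Ioo (0 : ℝ) L, ‖pointValue 0 L (w.D i.castSucc) x‖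
      ≤ Real.sqrt L * ‖w.1 i.succ‖ := by
    intro x hx
    have e1 := w.pointValue_sub hL i (left_mem_Icc.2 hL.le) (Ioo_subset_Icc_self hx)
    rw [h0, sub_zero] at e1
    rw [e1]
    have e2 := integral_norm_Lp_le hL.le (w.1 i.succ)
    rw [sub_zero] at e2
    refine le_trans ?_ e2
    refine (intervalIntegral.norm_integral_le_integral_norm hx.1.le).trans ?_
    rw [intervalIntegral.integral_of_le hx.1.le]
    refine setIntegral_mono_set (w.integrable_D i.succ).norm
      (Eventually.of_forall fun _ => norm_nonneg _) ?_
    exact (Ioc_subset_Ioo_right hx.2).eventuallyLE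
  have h2 := norm_Lp_le_of_ae_bound hL.le (w.1 i.castSucc) (C := Real.sqrt L * ‖w.1 i.succ‖)
    (by positivity) (by
      filter_upwards [(w.isContRep_pointValue hL i).2, ae_restrict_mem measurableSet_Ioo]
        with x hx hxI
      have := h1 x hxI
      rw [← hx] at this
      exact this)
  rwa [sub_zero, ← mul_assoc, Real.mul_self_sqrt hL.le] at h2

theorem TildeH.norm_D1_le {L : ℝ} (hL : 0 < L) (w : TildeH L 2) :
    ‖w.1.1 1‖ ≤ L * ‖w.1.1 2‖ :=
  Sobolev.norm_le_of_vanishesAtLeft hL w.1 (1 : Fin 2) (w.2 1 (by simp))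

theorem TildeH.norm_D0_le {L : ℝ} (hL : 0 < L) (w : TildeH L 2) :
    ‖w.1.1 0‖ ≤ L * ‖w.1.1 1‖ :=
  Sobolev.norm_le_of_vanishesAtLeft hL w.1 (0 : Fin 2) (w.2 0 (by simp))

theorem TildeH.norm_sq_eq {L : ℝ} (w : TildeH L 2) :
    ‖w‖ ^ 2 = ‖w.1.1 0‖ ^ 2 + ‖w.1.1 1‖ ^ 2 + ‖w.1.1 2‖ ^ 2 := by
  have h := PiLp.norm_sq_eq_of_L2 (fun _ : Fin 3 => Lp ℝ 2 (intervalMeasure 0 L)) w.1.1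
  rw [Fin.sum_univ_three] at h
  exact h

/-- The `H²` norm on `H̃₀²(0, L)` is controlled by the second derivative. -/
theorem TildeH.norm_le {L : ℝ} (hL : 0 < L) (w : TildeH L 2) :
    ‖w‖ ≤ (1 + L + L ^ 2) * ‖w.1.1 2‖ := by
  have h0 := w.norm_D0_le hL
  have h1 := w.norm_D1_le hL
  have h2 := w.norm_sq_eq
  have h3 : ‖w.1.1 0‖ ≤ L ^ 2 * ‖w.1.1 2‖ := by
    rw [sq, mul_assoc]
    exact h0.trans (mul_le_mul_of_nonneg_left h1 hL.le)
  have n0 := norm_nonneg (w.1.1 0)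
  have n1 := norm_nonneg (w.1.1 1)
  have n2 := norm_nonneg (w.1.1 2)
  refine (abs_le_of_sq_le_sq' (a := ‖w‖) (b := ‖w.1.1 0‖ + ‖w.1.1 1‖ + ‖w.1.1 2‖) ?_
    (by positivity)).2.trans ?_
  · rw [h2]
    nlinarith [mul_nonneg n0 n1, mul_nonneg n0 n2, mul_nonneg n1 n2]
  · linarith

theorem TildeH.norm_coe_le {L : ℝ} {k : ℕ} (w : TildeH L k) (i : Fin (k + 1)) :
    ‖w.1.1 i‖ ≤ ‖w‖ :=
  Sobolev.norm_coe_le w.1 i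

theorem norm_integral_Lp_le {L : ℝ} (hL : 0 < L) (f : Lp ℝ 2 (intervalMeasure 0 L)) :
    |∫ x in (0 : ℝ)..L, f x| ≤ Real.sqrt L * ‖f‖ := by
  have h := integral_norm_Lp_le hL.le f
  rw [sub_zero] at h
  rw [intervalIntegral.integral_of_le hL.le, integral_Ioc_eq_integral_Ioo]
  exact (norm_integral_le_integral_norm _).trans h

theorem TildeH.D_add {L : ℝ} {k : ℕ} (v w : TildeH L k) (i : Fin (k + 1)) :
    (v + w).D i =ᵐ[intervalMeasure 0 L] fun x => v.D i x + w.D i x :=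
  Lp.coeFn_add (v.1.1 i) (w.1.1 i)

theorem TildeH.D_smul {L : ℝ} {k : ℕ} (c : ℝ) (w : TildeH L k) (i : Fin (k + 1)) :
    (c • w).D i =ᵐ[intervalMeasure 0 L] fun x => c * w.D i x :=
  Lp.coeFn_smul c (w.1.1 i)

theorem TildeH.D_sub {L : ℝ} {k : ℕ} (v w : TildeH L k) (i : Fin (k + 1)) :
    (v - w).D i =ᵐ[intervalMeasure 0 L] fun x => v.D i x - w.D i x :=
  Lp.coeFn_sub (v.1.1 i) (w.1.1 i)

theorem TildeH.integrable_D {L : ℝ} {k : ℕ} (w : TildeH L k) (i : Fin (k + 1)) :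
    Integrable (w.D i) (intervalMeasure 0 L) :=
  Sobolev.integrable_D w.1 i

/-- Integration of the `i`-th derivative over `(0, L)`, as a bounded functional. -/
def TildeH.integralD {L : ℝ} (hL : 0 < L) (i : Fin 3) : TildeH L 2 →L[ℝ] ℝ :=
  LinearMap.mkContinuous
    { toFun := fun w => ∫ x in (0 : ℝ)..L, w.D i x
      map_add' := fun v w => by
        have m0 : (0 : ℝ) ∈ Icc 0 L := left_mem_Icc.2 hL.le
        have m1 : L ∈ Icc 0 L := right_mem_Icc.2 hL.le
        rw [intervalIntegral_congr_ae_Ioo (TildeH.D_add v w i) m0 m1]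
        exact intervalIntegral.integral_add
          (intervalMeasure.intervalIntegrable (v.integrable_D i) m0 m1)
          (intervalMeasure.intervalIntegrable (w.integrable_D i) m0 m1)
      map_smul' := fun c w => by
        rw [intervalIntegral_congr_ae_Ioo (TildeH.D_smul c w i) (left_mem_Icc.2 hL.le)
          (right_mem_Icc.2 hL.le)]
        exact intervalIntegral.integral_const_mul _ _ }
    (Real.sqrt L) fun w => (norm_integral_Lp_le hL (w.1.1 i)).trans
      (mul_le_mul_of_nonneg_left (w.norm_coe_le i) (Real.sqrt_nonneg _))

/-- The tip slope as a bounded functional. -/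
def TildeH.tipSlopeL {L : ℝ} (hL : 0 < L) : TildeH L 2 →L[ℝ] ℝ := TildeH.integralD hL 2

/-- The tip value as a bounded functional. -/
def TildeH.tipL {L : ℝ} (hL : 0 < L) : TildeH L 2 →L[ℝ] ℝ := TildeH.integralD hL 1

theorem TildeH.tipSlopeL_apply {L : ℝ} (hL : 0 < L) (w : TildeH L 2) :
    TildeH.tipSlopeL hL w = w.tipSlope := (w.tipSlope_eq hL).symm

theorem TildeH.tipL_apply {L : ℝ} (hL : 0 < L) (w : TildeH L 2) :
    TildeH.tipL hL w = w.tip := (w.tip_eq hL).symm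

/-- The `i`-th derivative as a bounded map into `L²(0, L)`. -/
def TildeH.DL (L : ℝ) {k : ℕ} (i : Fin (k + 1)) : TildeH L k →L[ℝ] Lp ℝ 2 (intervalMeasure 0 L) :=
  LinearMap.mkContinuous
    { toFun := fun w => w.1.1 i
      map_add' := fun _ _ => rfl
      map_smul' := fun _ _ => rfl }
    1 fun w => by rw [one_mul]; exact w.norm_coe_le i

/-- The map `w ↦ (w_x(L), w(L), w)` as a bounded map. -/
def TildeH.hatL {L : ℝ} (hL : 0 < L) : TildeH L 2 →L[ℝ] PivotH L :=
  (TildeH.tipSlopeL hL).prod ((TildeH.tipL hL).prod (TildeH.DL L 0))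

theorem TildeH.hatL_apply {L : ℝ} (hL : 0 < L) (w : TildeH L 2) :
    TildeH.hatL hL w = w.hat :=
  Prod.ext (TildeH.tipSlopeL_apply hL w) (Prod.ext (TildeH.tipL_apply hL w) rfl)

/-- An element of `H̃₀²(0, L)` is determined by its values almost everywhere. -/
theorem TildeH.ext_of_ae {L : ℝ} {v w : TildeH L 2}
    (h : v.D 0 =ᵐ[intervalMeasure 0 L] w.D 0) : v = w := by
  have h1 : v.D 1 =ᵐ[intervalMeasure 0 L] w.D 1 :=
    HasWeakDeriv.ae_unique ((v.1.2 0).congr h (EventuallyEq.refl _ _)) (w.1.2 0)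
      (v.integrable_D 1) (w.integrable_D 1)
  have h2 : v.D 2 =ᵐ[intervalMeasure 0 L] w.D 2 :=
    HasWeakDeriv.ae_unique ((v.1.2 1).congr h1 (EventuallyEq.refl _ _)) (w.1.2 1)
      (v.integrable_D 2) (w.integrable_D 2)
  refine Subtype.ext (Subtype.ext (PiLp.ext fun i => Lp.ext ?_))
  fin_cases i
  · exact h
  · exact h1
  · exact h2

/-- An element of `H̃₀⁴(0, L)`, as an element of `H̃₀²(0, L)`. -/
def TildeH.toTwo {L : ℝ} (w : TildeH L 4) : TildeH L 2 :=
  ⟨⟨WithLp.toLp 2 fun i : Fin 3 => w.1.1 (Fin.castLE (by omega) i),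
    fun i => w.1.2 (Fin.castLE (by omega) i)⟩, fun i hi => w.2 (Fin.castLE (by omega) i) hi⟩

/-- The embedding of `H̃₀⁴(0, L)` into `H̃₀²(0, L)`. -/
def TildeH.incl (L : ℝ) : TildeH L 4 →L[ℝ] TildeH L 2 :=
  LinearMap.mkContinuous
    { toFun := TildeH.toTwo
      map_add' := fun _ _ => rfl
      map_smul' := fun _ _ => rfl }
    1 fun w => by
      have h4 := PiLp.norm_sq_eq_of_L2 (fun _ : Fin 5 => Lp ℝ 2 (intervalMeasure 0 L)) w.1.1
      rw [Fin.sum_univ_five] at h4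
      have h2 := TildeH.norm_sq_eq w.toTwo
      have h5 : ∀ A B C D E : ℝ, A ^ 2 + B ^ 2 + C ^ 2 ≤ A ^ 2 + B ^ 2 + C ^ 2 + D ^ 2 + E ^ 2 := by
        intro A B C D E
        nlinarith [sq_nonneg D, sq_nonneg E]
      have h6 : ‖w.toTwo‖ ^ 2 ≤ ‖w‖ ^ 2 := (h2.trans_le (h5 _ _ _ _ _)).trans h4.ge
      rw [one_mul]
      exact (abs_le_of_sq_le_sq' h6 (norm_nonneg _)).2

/-! ### Approximation by Hermite cubics -/

theorem memLp_of_continuousOn_Icc {a b : ℝ} {f : ℝ → ℝ} (hf : ContinuousOn f (Icc a b)) :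
    MemLp f 2 (intervalMeasure a b) := by
  obtain ⟨C, hC⟩ := isCompact_Icc.exists_bound_of_continuousOn hf
  refine MemLp.of_bound ((hf.mono Ioo_subset_Icc_self).aestronglyMeasurable measurableSet_Ioo) C ?_
  filter_upwards [ae_restrict_mem measurableSet_Ioo] with x hx
  exact hC x (Ioo_subset_Icc_self hx)

theorem hasWeakDeriv_primitive {a b : ℝ} (hab : a ≤ b) {g : ℝ → ℝ}
    (hg : Integrable g (intervalMeasure a b)) :
    HasWeakDeriv a b (fun x => ∫ y in a..x, g y) g := fun _ hφ =>
  integral_deriv_mul_primitive hab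
    (intervalMeasure.intervalIntegrable hg (left_mem_Icc.2 hab) (right_mem_Icc.2 hab)) hφ.1
    (image_eq_zero_of_notMem_tsupport fun hm => lt_irrefl _ (hφ.2.2 hm).2)

/-- Every `f ∈ L²(0, L)` is the second derivative of an element of `H̃₀²(0, L)`. -/
theorem TildeH.exists_secondDeriv_eq {L : ℝ} (hL : 0 < L) (f : Lp ℝ 2 (intervalMeasure 0 L)) :
    ∃ w : TildeH L 2, w.1.1 2 = f := by
  have hf : Integrable f (intervalMeasure 0 L) := (Lp.memLp f).integrable one_le_two
  have hc1 := continuousOn_primitive_of_integrable hL.le hf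
  have hm1 := memLp_of_continuousOn_Icc hc1
  have hi1 : Integrable (fun x => ∫ y in (0 : ℝ)..x, f y) (intervalMeasure 0 L) :=
    hm1.integrable one_le_two
  have hc0 := continuousOn_primitive_of_integrable hL.le hi1
  have hm0 := memLp_of_continuousOn_Icc hc0
  refine ⟨⟨⟨WithLp.toLp 2 ![hm0.toLp, hm1.toLp, f], fun i => ?_⟩, fun i hi => ?_⟩, rfl⟩
  · fin_cases i
    · exact (hasWeakDeriv_primitive hL.le hi1).congr hm0.coeFn_toLp.symm hm1.coeFn_toLp.symm
    · exact (hasWeakDeriv_primitive hL.le hf).congr hm1.coeFn_toLp.symm (EventuallyEq.refl _ _)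
  · fin_cases i
    · exact ⟨_, ⟨hc0, hm0.coeFn_toLp⟩, by simp⟩
    · exact ⟨_, ⟨hc1, hm1.coeFn_toLp⟩, by simp⟩
    · simp at hi

theorem node_mem_Icc {L : ℝ} (hL : 0 < L) {N m : ℕ} (hN : 0 < N) (hm : m ≤ N) :
    (m : ℝ) * (L / N) ∈ Icc 0 L := by
  have hN' : (0 : ℝ) < N := Nat.cast_pos.2 hN
  have hm' : (m : ℝ) ≤ N := Nat.cast_le.2 hm
  refine ⟨by positivity, ?_⟩
  rw [mul_div_assoc', div_le_iff₀ hN', mul_comm L]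
  exact mul_le_mul_of_nonneg_right hm' hL.le

/-- A function in `H̃₀²(0, L)` is a Hermite cubic as soon as its second derivative is affine on every
mesh cell; no continuity across the nodes is needed. -/
theorem mem_hermiteSpace_of_affine {L : ℝ} (hL : 0 < L) {N : ℕ} (hN : 0 < N) (w : TildeH L 2)
    (h : ∀ m < N, ∃ α β : ℝ, ∀ᵐ x ∂(intervalMeasure 0 L),
      x ∈ Ioo (m * (L / N)) ((m + 1) * (L / N)) → w.D 2 x = α + β * (x - m * (L / N))) :
    w ∈ hermiteSpace L N := by
  intro m hm
  obtain ⟨α, β, hαβ⟩ := h m hm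
  set s : ℝ := m * (L / N) with hs
  set t : ℝ := (m + 1) * (L / N) with ht
  have hs' : s ∈ Icc 0 L := node_mem_Icc hL hN hm.le
  have ht' : t ∈ Icc 0 L := by
    have := node_mem_Icc hL hN (Nat.succ_le_of_lt hm)
    rwa [Nat.cast_succ] at this
  have hsub : Icc s t ⊆ Icc 0 L := Icc_subset_Icc hs'.1 ht'.2
  set F1 : ℝ → ℝ := pointValue 0 L (w.D 1) with hF1
  set F0 : ℝ → ℝ := pointValue 0 L (w.D 0) with hF0
  have h1 : ∀ x ∈ Icc s t, F1 x = F1 s + α * (x - s) + β / 2 * (x - s) ^ 2 := by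
    intro x hx
    have e1 : F1 x - F1 s = ∫ y in s..x, w.D 2 y :=
      Sobolev.pointValue_sub hL w.1 (1 : Fin 2) hs' (hsub hx)
    have e2 : ∫ y in s..x, w.D 2 y = ∫ y in s..x, (α + β * (y - s)) := by
      refine intervalIntegral.integral_congr_ae ?_
      have e3 : ∀ᵐ y ∂volume, y ≠ x := Measure.ae_ne volume x
      filter_upwards [(ae_restrict_iff' measurableSet_Ioo).1 hαβ, e3] with y hy hyx hyI
      rw [uIoc_of_le hx.1] at hyI
      have h3 : y < x := lt_of_le_of_ne hyI.2 hyx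
      exact hy ⟨hs'.1.trans_lt hyI.1, h3.trans_le (hx.2.trans ht'.2)⟩
        ⟨hyI.1, h3.trans_le hx.2⟩
    have e3 : ∫ y in s..x, (α + β * (y - s))
        = (α * (x - s) + β / 2 * (x - s) ^ 2) - (α * (s - s) + β / 2 * (s - s) ^ 2) := by
      refine intervalIntegral.integral_eq_sub_of_hasDerivAt
        (f := fun y => α * (y - s) + β / 2 * (y - s) ^ 2) (fun y _ => ?_)
        (Continuous.intervalIntegrable (by fun_prop) _ _)
      have d := (((hasDerivAt_id y).sub_const s).const_mul α).add
        ((((hasDerivAt_id y).sub_const s).pow 2).const_mul (β / 2))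
      refine d.congr_deriv ?_
      simp
      ring
    rw [e2, e3] at e1
    linear_combination e1
  have h0 : ∀ x ∈ Icc s t,
      F0 x = F0 s + F1 s * (x - s) + α / 2 * (x - s) ^ 2 + β / 6 * (x - s) ^ 3 := by
    intro x hx
    have e1 : F0 x - F0 s = ∫ y in s..x, F1 y :=
      Sobolev.pointValue_sub' hL w.1 (0 : Fin 2) (1 : Fin 2) rfl hs' (hsub hx)
    have e2 : ∫ y in s..x, F1 y = ∫ y in s..x, (F1 s + α * (y - s) + β / 2 * (y - s) ^ 2) := by
      refine intervalIntegral.integral_congr fun y hy => ?_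
      rw [uIcc_of_le hx.1] at hy
      exact h1 y ⟨hy.1, hy.2.trans hx.2⟩
    have e3 : ∫ y in s..x, (F1 s + α * (y - s) + β / 2 * (y - s) ^ 2)
        = (F1 s * (x - s) + α / 2 * (x - s) ^ 2 + β / 6 * (x - s) ^ 3)
          - (F1 s * (s - s) + α / 2 * (s - s) ^ 2 + β / 6 * (s - s) ^ 3) := by
      refine intervalIntegral.integral_eq_sub_of_hasDerivAt
        (f := fun y => F1 s * (y - s) + α / 2 * (y - s) ^ 2 + β / 6 * (y - s) ^ 3) (fun y _ => ?_)
        (Continuous.intervalIntegrable (by fun_prop) _ _)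
      have d := ((((hasDerivAt_id y).sub_const s).const_mul (F1 s)).add
        ((((hasDerivAt_id y).sub_const s).pow 2).const_mul (α / 2))).add
        ((((hasDerivAt_id y).sub_const s).pow 3).const_mul (β / 6))
      refine d.congr_deriv ?_
      simp
      ring
    rw [e2, e3] at e1
    linear_combination e1
  refine ⟨(Polynomial.C (F0 s) + Polynomial.C (F1 s) * Polynomial.X
    + Polynomial.C (α / 2) * Polynomial.X ^ 2 + Polynomial.C (β / 6) * Polynomial.X ^ 3).comp
      (Polynomial.X - Polynomial.C s), ?_, ?_⟩
  · rw [Polynomial.natDegree_comp, Polynomial.natDegree_X_sub_C, mul_one]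
    compute_degree
  · have hrep : w.D 0 =ᵐ[intervalMeasure 0 L] F0 :=
      (Sobolev.isContRep_pointValue hL w.1 (0 : Fin 2)).2
    filter_upwards [hrep] with x hx hxI
    rw [hx, h0 x (Ioo_subset_Icc_self hxI)]
    simp

theorem sq_intervalIntegral_le {s t : ℝ} (hst : s < t) {g : ℝ → ℝ}
    (hg : IntervalIntegrable g volume s t)
    (hg2 : IntervalIntegrable (fun x => g x ^ 2) volume s t) :
    (∫ x in s..t, g x) ^ 2 ≤ (t - s) * ∫ x in s..t, g x ^ 2 := by
  set I := ∫ x in s..t, g x with hI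
  have h0 : 0 < t - s := sub_pos.2 hst
  have h1 : 0 ≤ ∫ x in s..t, (g x - I / (t - s)) ^ 2 :=
    intervalIntegral.integral_nonneg hst.le fun _ _ => sq_nonneg _
  have h2 : ∫ x in s..t, (g x - I / (t - s)) ^ 2
      = (∫ x in s..t, g x ^ 2) - 2 * (I / (t - s)) * I + (t - s) * (I / (t - s)) ^ 2 := by
    have e : ∀ x, (g x - I / (t - s)) ^ 2
        = g x ^ 2 - 2 * (I / (t - s)) * g x + (I / (t - s)) ^ 2 := fun x => by ring
    simp only [e]
    rw [intervalIntegral.integral_add (hg2.sub (hg.const_mul _)) intervalIntegrable_const,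
      intervalIntegral.integral_sub hg2 (hg.const_mul _), intervalIntegral.integral_const_mul,
      intervalIntegral.integral_const, smul_eq_mul]
  rw [h2] at h1
  have h3 : (t - s) * ((∫ x in s..t, g x ^ 2) - 2 * (I / (t - s)) * I
      + (t - s) * (I / (t - s)) ^ 2) = (t - s) * (∫ x in s..t, g x ^ 2) - I ^ 2 := by
    field_simp
    ring
  have h4 := mul_nonneg h0.le h1
  rw [h3] at h4
  linarith

theorem Lp_integrable_sq {L : ℝ} (f : Lp ℝ 2 (intervalMeasure 0 L)) :
    Integrable (fun x => f x ^ 2) (intervalMeasure 0 L) :=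
  (memLp_two_iff_integrable_sq (Lp.aestronglyMeasurable f)).1 (Lp.memLp f)

theorem Lp_norm_sq_eq {L : ℝ} (hL : 0 < L) (f : Lp ℝ 2 (intervalMeasure 0 L)) :
    ‖f‖ ^ 2 = ∫ x in (0 : ℝ)..L, f x ^ 2 := by
  rw [intervalIntegral.integral_of_le hL.le, integral_Ioc_eq_integral_Ioo,
    ← real_inner_self_eq_norm_sq, L2.inner_def]
  refine integral_congr_ae (Eventually.of_forall fun x => ?_)
  simp

theorem sum_integral_cells {L : ℝ} (hL : 0 < L) {N : ℕ} (hN : 0 < N) {g : ℝ → ℝ}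
    (hg : Integrable g (intervalMeasure 0 L)) :
    ∑ m ∈ Finset.range N, ∫ x in (m * (L / N))..((m + 1) * (L / N)), g x
      = ∫ x in (0 : ℝ)..L, g x := by
  have h := intervalIntegral.sum_integral_adjacent_intervals (f := g) (μ := volume)
    (a := fun m : ℕ => (m : ℝ) * (L / N)) (n := N) fun k hk =>
      intervalMeasure.intervalIntegrable hg (node_mem_Icc hL hN hk.le)
        (node_mem_Icc hL hN (Nat.succ_le_of_lt hk))
  have hN' : (N : ℝ) ≠ 0 := Nat.cast_ne_zero.2 hN.ne'
  simp only [Nat.cast_zero, zero_mul, Nat.cast_add, Nat.cast_one, mul_div_cancel₀ L hN'] at h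
  exact h

/-- The Hermite space approximates `H̃₀⁴(0, L)` to second order in `H²`.  The approximant is the
double primitive of the piecewise first order Taylor polynomial of the second derivative. -/
theorem exists_hermite_approx {L : ℝ} (hL : 0 < L) {N : ℕ} (hN : 0 < N) (w : TildeH L 4) :
    ∃ p ∈ hermiteSpace L N, ‖(TildeH.incl L w - p).1.1 2‖ ≤ (L / N) ^ 2 * ‖w‖ := by
  set h : ℝ := L / N with hh
  have hN' : (0 : ℝ) < N := Nat.cast_pos.2 hN
  have h0 : 0 < h := div_pos hL hN'
  set F : ℝ → ℝ := pointValue 0 L (w.D 2) with hF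
  set G : ℝ → ℝ := pointValue 0 L (w.D 3) with hG
  have hFc : IsContRep 0 L (w.D 2) F := Sobolev.isContRep_pointValue hL w.1 (2 : Fin 4)
  have hGc : IsContRep 0 L (w.D 3) G := Sobolev.isContRep_pointValue hL w.1 (3 : Fin 4)
  have hFG : ∀ s ∈ Icc 0 L, ∀ t ∈ Icc 0 L, F t - F s = ∫ x in s..t, G x := fun s hs t ht =>
    Sobolev.pointValue_sub' hL w.1 (2 : Fin 4) (3 : Fin 4) rfl hs ht
  have hGg : ∀ s ∈ Icc 0 L, ∀ t ∈ Icc 0 L, G t - G s = ∫ x in s..t, w.D 4 x := fun s hs t ht =>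
    Sobolev.pointValue_sub hL w.1 (3 : Fin 4) hs ht
  have hgi := w.integrable_D 4
  -- the left node of the cell of `x`, and the piecewise Taylor polynomial
  set P : ℝ → ℝ := fun x => F (⌊x / h⌋ * h) + G (⌊x / h⌋ * h) * (x - ⌊x / h⌋ * h) with hP
  have hPm : Measurable P := by
    have hfl : Measurable fun x : ℝ => ⌊x / h⌋ := Int.measurable_floor.comp (measurable_id.div_const h)
    have m1 : ∀ φ : ℤ → ℝ, Measurable fun x : ℝ => φ ⌊x / h⌋ := fun φ =>
      (Measurable.of_discrete (f := φ)).comp hfl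
    exact (m1 fun k => F (k * h)).add ((m1 fun k => G (k * h)).mul
      (measurable_id.sub (m1 fun k => (k : ℝ) * h)))
  have hcell : ∀ m : ℕ, ∀ x ∈ Ico (m * h) ((m + 1) * h),
      P x = F (m * h) + G (m * h) * (x - m * h) := by
    intro m x hx
    have : ⌊x / h⌋ = (m : ℤ) := by
      rw [Int.floor_eq_iff]
      refine ⟨?_, ?_⟩
      · rw [le_div_iff₀ h0]
        exact_mod_cast hx.1
      · rw [div_lt_iff₀ h0]
        exact_mod_cast hx.2
    simp only [hP, this, Int.cast_natCast]
  -- the error of the Taylor polynomial in one cell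
  have herr : ∀ m < N, ∀ x ∈ Ico (m * h) ((m + 1) * h),
      |F x - P x| ≤ h * ∫ y in (m * h)..((m + 1) * h), |w.D 4 y| := by
    intro m hm x hx
    have hs : (m : ℝ) * h ∈ Icc 0 L := node_mem_Icc hL hN hm.le
    have ht : ((m : ℝ) + 1) * h ∈ Icc 0 L := by
      have := node_mem_Icc hL hN (Nat.succ_le_of_lt hm)
      rwa [Nat.cast_succ] at this
    have hsub : Icc ((m : ℝ) * h) ((m + 1) * h) ⊆ Icc 0 L := Icc_subset_Icc hs.1 ht.2
    have hxL := hsub (Ico_subset_Icc_self hx)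
    have hGi : IntervalIntegrable G volume (m * h) x := by
      refine ContinuousOn.intervalIntegrable (hGc.1.mono ?_)
      rw [uIcc_of_le hx.1]
      exact Icc_subset_Icc hs.1 hxL.2
    have e1 : F x - P x = ∫ y in (m * h)..x, (G y - G (m * h)) := by
      rw [intervalIntegral.integral_sub hGi intervalIntegrable_const, ← hFG _ hs _ hxL,
        intervalIntegral.integral_const, hcell m x hx, smul_eq_mul]
      ring
    rw [e1]
    have e2 : ∀ y ∈ uIoc ((m : ℝ) * h) x,
        ‖G y - G (m * h)‖ ≤ ∫ y in (m * h)..((m + 1) * h), |w.D 4 y| := by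
      intro y hy
      rw [uIoc_of_le hx.1] at hy
      have hyc : y ∈ Icc ((m : ℝ) * h) ((m + 1) * h) := ⟨hy.1.le, hy.2.trans hx.2.le⟩
      rw [hGg _ hs _ (hsub hyc)]
      refine (intervalIntegral.norm_integral_le_integral_norm hy.1.le).trans ?_
      exact intervalIntegral.integral_mono_interval le_rfl hy.1.le hyc.2
        (Eventually.of_forall fun _ => abs_nonneg _)
        (intervalMeasure.intervalIntegrable hgi hs ht).norm
    refine (intervalIntegral.norm_integral_le_of_norm_le_const e2).trans ?_
    rw [abs_of_nonneg (sub_nonneg.2 hx.1), mul_comm]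
    refine mul_le_mul_of_nonneg_right (by linarith [hx.2]) ?_
    exact intervalIntegral.integral_nonneg (by linarith) fun _ _ => abs_nonneg _
  have hmemcell : ∀ x ∈ Ioo 0 L, ∃ m < N, x ∈ Ico ((m : ℝ) * h) ((m + 1) * h) := by
    intro x hx
    have hx0 : 0 ≤ x / h := div_nonneg hx.1.le h0.le
    refine ⟨⌊x / h⌋₊, ?_, ?_, ?_⟩
    · rw [Nat.floor_lt hx0, div_lt_iff₀ h0, hh, mul_div_cancel₀ L hN'.ne']
      exact hx.2
    · exact (le_div_iff₀ h0).1 (Nat.floor_le hx0)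
    · exact (div_lt_iff₀ h0).1 (Nat.lt_floor_add_one _)
  have hPL : MemLp P 2 (intervalMeasure 0 L) := by
    have hFL := memLp_of_continuousOn_Icc hFc.1
    have hE : MemLp (fun x => F x - P x) 2 (intervalMeasure 0 L) := by
      refine MemLp.of_bound (hFL.1.sub hPm.aestronglyMeasurable)
        (h * ∫ y in (0 : ℝ)..L, |w.D 4 y|) ?_
      filter_upwards [ae_restrict_mem measurableSet_Ioo] with x hx
      obtain ⟨m, hm, hxm⟩ := hmemcell x hx
      refine (herr m hm x hxm).trans (mul_le_mul_of_nonneg_left ?_ h0.le)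
      have hs : (m : ℝ) * h ∈ Icc 0 L := node_mem_Icc hL hN hm.le
      have ht : ((m : ℝ) + 1) * h ∈ Icc 0 L := by
        have := node_mem_Icc hL hN (Nat.succ_le_of_lt hm)
        rwa [Nat.cast_succ] at this
      exact intervalIntegral.integral_mono_interval hs.1 (by linarith) ht.2
        (Eventually.of_forall fun _ => abs_nonneg _)
        (intervalMeasure.intervalIntegrable hgi (left_mem_Icc.2 hL.le) (right_mem_Icc.2 hL.le)).norm
    have : P = fun x => F x - (F x - P x) := by
      funext x
      ring
    rw [this]
    exact hFL.sub hE
  obtain ⟨p, hp⟩ := TildeH.exists_secondDeriv_eq hL hPL.toLp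
  have hpP : p.D 2 =ᵐ[intervalMeasure 0 L] P := by
    have : p.D 2 = hPL.toLp := congrArg (fun f : Lp ℝ 2 (intervalMeasure 0 L) => (f : ℝ → ℝ)) hp
    rw [this]
    exact hPL.coeFn_toLp
  refine ⟨p, mem_hermiteSpace_of_affine hL hN p fun m _ => ⟨F (m * h), G (m * h), ?_⟩, ?_⟩
  · filter_upwards [hpP] with x hx hxI
    rw [hx, hcell m x (Ioo_subset_Ico_self hxI)]
  -- summation of the cell errors
  set e := (TildeH.incl L w - p).1.1 2 with he
  have hee : e =ᵐ[intervalMeasure 0 L] fun x => F x - P x := by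
    have e1 : e =ᵐ[intervalMeasure 0 L] fun x => (TildeH.incl L w).D 2 x - p.D 2 x :=
      TildeH.D_sub (TildeH.incl L w) p 2
    filter_upwards [e1, hpP, hFc.2] with x h1 h2 h3
    rw [h1, h2, ← h3]
    rfl
  have hsq : ‖e‖ ^ 2 ≤ h ^ 4 * ‖w.1.1 4‖ ^ 2 := by
    rw [Lp_norm_sq_eq hL, Lp_norm_sq_eq hL, ← sum_integral_cells hL hN (Lp_integrable_sq e),
      ← sum_integral_cells hL hN (Lp_integrable_sq (w.1.1 4)), Finset.mul_sum]
    refine Finset.sum_le_sum fun m hm => ?_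
    have hm' := Finset.mem_range.1 hm
    have hs : (m : ℝ) * h ∈ Icc 0 L := node_mem_Icc hL hN hm'.le
    have ht : ((m : ℝ) + 1) * h ∈ Icc 0 L := by
      have := node_mem_Icc hL hN (Nat.succ_le_of_lt hm')
      rwa [Nat.cast_succ] at this
    have hlt : (m : ℝ) * h < (m + 1) * h := by linarith
    set I := ∫ y in (m * h)..((m + 1) * h), |w.D 4 y| with hI
    have c1 : I ^ 2 ≤ h * ∫ y in (m * h)..((m + 1) * h), (w.1.1 4) y ^ 2 := by
      have := sq_intervalIntegral_le hlt (g := fun y => |w.D 4 y|)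
        (intervalMeasure.intervalIntegrable hgi hs ht).norm
        (by
          simp only [sq_abs]
          exact intervalMeasure.intervalIntegrable (Lp_integrable_sq (w.1.1 4)) hs ht)
      simp only [sq_abs] at this
      have h2 : ((m : ℝ) + 1) * h - m * h = h := by ring
      rw [h2] at this
      exact this
    have c2 : ∫ x in (m * h)..((m + 1) * h), e x ^ 2
        ≤ ∫ x in (m * h)..((m + 1) * h), (h * I) ^ 2 := by
      refine intervalIntegral.integral_mono_ae_restrict hlt.le
        (intervalMeasure.intervalIntegrable (Lp_integrable_sq e) hs ht) intervalIntegrable_const ?_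
      rw [← Measure.restrict_congr_set (Ioo_ae_eq_Icc (μ := volume))]
      have c3 := ae_mono (Measure.restrict_mono_set volume
        (Ioo_subset_Ioo hs.1 ht.2 : Ioo ((m : ℝ) * h) ((m + 1) * h) ⊆ Ioo 0 L)) hee
      filter_upwards [c3, ae_restrict_mem measurableSet_Ioo] with x hx hxI
      have := herr m hm' x (Ioo_subset_Ico_self hxI)
      rw [← hx] at this
      exact sq_le_sq' (abs_le.1 this).1 (abs_le.1 this).2
    have c4 : ∫ x in (m * h)..((m + 1) * h), (h * I) ^ 2 = h * (h * I) ^ 2 := by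
      rw [intervalIntegral.integral_const, smul_eq_mul]
      ring
    rw [c4] at c2
    refine c2.trans ?_
    have c5 := mul_le_mul_of_nonneg_left c1 (by positivity : 0 ≤ h ^ 3)
    calc h * (h * I) ^ 2 = h ^ 3 * I ^ 2 := by ring
      _ ≤ _ := c5
      _ = _ := by ring
  have hsq' : ‖e‖ ^ 2 ≤ (h ^ 2 * ‖w.1.1 4‖) ^ 2 := hsq.trans (le_of_eq (by ring))
  refine (abs_le_of_sq_le_sq' hsq' (by positivity)).2.trans ?_
  exact mul_le_mul_of_nonneg_left (w.norm_coe_le 4) (by positivity)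

/-! ### Seminorms of positive semidefinite forms -/

/-- The seminorm `x ↦ √(B(x, x))` of a positive semidefinite bounded bilinear form. -/
def formNorm {X : Type*} [NormedAddCommGroup X] [NormedSpace ℝ X] (B : X →L[ℝ] X →L[ℝ] ℝ) (x : X) :
    ℝ :=
  Real.sqrt (B x x)

/-- A bounded bilinear form which is symmetric and positive semidefinite. -/
structure IsEnergyForm {X : Type*} [NormedAddCommGroup X] [NormedSpace ℝ X]
    (B : X →L[ℝ] X →L[ℝ] ℝ) : Prop where
  symm : ∀ x y, B x y = B y x
  nonneg : ∀ x, 0 ≤ B x x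

theorem formNorm_nonneg {X : Type*} [NormedAddCommGroup X] [NormedSpace ℝ X]
    (B : X →L[ℝ] X →L[ℝ] ℝ) (x : X) : 0 ≤ formNorm B x := Real.sqrt_nonneg _

theorem formNorm_le {X : Type*} [NormedAddCommGroup X] [NormedSpace ℝ X]
    (B : X →L[ℝ] X →L[ℝ] ℝ) (x : X) : formNorm B x ≤ Real.sqrt ‖B‖ * ‖x‖ := by
  rw [formNorm, ← Real.sqrt_sq (norm_nonneg x), ← Real.sqrt_mul (norm_nonneg B), sq, ← mul_assoc]
  exact Real.sqrt_le_sqrt ((le_abs_self _).trans (B.le_opNorm₂ x x))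

namespace IsEnergyForm

variable {X : Type*} [NormedAddCommGroup X] [NormedSpace ℝ X] {B : X →L[ℝ] X →L[ℝ] ℝ}

theorem formNorm_sq (hB : IsEnergyForm B) (x : X) : formNorm B x ^ 2 = B x x :=
  Real.sq_sqrt (hB.nonneg x)

/-- The Cauchy-Schwarz inequality. -/
theorem abs_apply_le (hB : IsEnergyForm B) (x y : X) :
    |B x y| ≤ formNorm B x * formNorm B y := by
  have h1 : ∀ r : ℝ, 0 ≤ B x x * (r * r) + 2 * B x y * r + B y y := by
    intro r
    have := hB.nonneg (r • x + y)
    simp only [map_add, map_smul, add_apply, smul_apply,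
      smul_eq_mul, hB.symm y x] at this
    linarith
  have h2 := discrim_le_zero h1
  rw [discrim] at h2
  have h3 : B x y ^ 2 ≤ (formNorm B x * formNorm B y) ^ 2 := by
    rw [mul_pow, hB.formNorm_sq, hB.formNorm_sq]
    linarith
  exact abs_le.2 (abs_le_of_sq_le_sq' h3 (mul_nonneg (formNorm_nonneg B x) (formNorm_nonneg B y)))

theorem formNorm_add_le (hB : IsEnergyForm B) (x y : X) :
    formNorm B (x + y) ≤ formNorm B x + formNorm B y := by
  have h0 := (le_abs_self _).trans (hB.abs_apply_le x y)
  have h1 : formNorm B (x + y) ^ 2 ≤ (formNorm B x + formNorm B y) ^ 2 := by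
    rw [hB.formNorm_sq, add_sq, hB.formNorm_sq, hB.formNorm_sq]
    simp only [map_add, add_apply, hB.symm y x]
    linarith
  exact (abs_le_of_sq_le_sq' h1 (add_nonneg (formNorm_nonneg B x) (formNorm_nonneg B y))).2

end IsEnergyForm

/-! ### The energy of a state -/

/-- The energy norm of an abstract state `(u, v, ζ)`: the forms `a`, `m` and `p` carry the potential
energy, the kinetic energy and the energy of the controllers. -/
def stateNorm {X Z : Type*} [NormedAddCommGroup X] [NormedSpace ℝ X] [NormedAddCommGroup Z]
    [NormedSpace ℝ Z] (a m : X →L[ℝ] X →L[ℝ] ℝ) (p : Z →L[ℝ] Z →L[ℝ] ℝ) (u v : X) (ζ : Z) : ℝ :=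
  Real.sqrt (1 / 2 * (a u u + m v v + p ζ ζ))

section StateNorm

variable {X Z : Type*} [NormedAddCommGroup X] [NormedSpace ℝ X] [NormedAddCommGroup Z]
  [NormedSpace ℝ Z] {a m : X →L[ℝ] X →L[ℝ] ℝ} {p : Z →L[ℝ] Z →L[ℝ] ℝ}

theorem stateNorm_nonneg (u v : X) (ζ : Z) : 0 ≤ stateNorm a m p u v ζ := Real.sqrt_nonneg _

theorem stateNorm_sq (ha : IsEnergyForm a) (hm : IsEnergyForm m) (hp : IsEnergyForm p)
    (u v : X) (ζ : Z) : stateNorm a m p u v ζ ^ 2 = 1 / 2 * (a u u + m v v + p ζ ζ) :=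
  Real.sq_sqrt (by linarith [ha.nonneg u, hm.nonneg v, hp.nonneg ζ])

theorem formNorm_le_stateNorm (ha : IsEnergyForm a) (hm : IsEnergyForm m) (hp : IsEnergyForm p)
    (u v : X) (ζ : Z) : formNorm a u ≤ 2 * stateNorm a m p u v ζ ∧
      formNorm m v ≤ 2 * stateNorm a m p u v ζ ∧ formNorm p ζ ≤ 2 * stateNorm a m p u v ζ := by
  have h := stateNorm_sq ha hm hp u v ζ
  have h0 : 0 ≤ 2 * stateNorm a m p u v ζ := mul_nonneg zero_le_two (stateNorm_nonneg u v ζ)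
  have h1 := ha.nonneg u
  have h2 := hm.nonneg v
  have h3 := hp.nonneg ζ
  have h4 := sq_nonneg (stateNorm a m p u v ζ)
  refine ⟨(abs_le_of_sq_le_sq' ?_ h0).2, (abs_le_of_sq_le_sq' ?_ h0).2,
    (abs_le_of_sq_le_sq' ?_ h0).2⟩
  · rw [ha.formNorm_sq]
    linarith
  · rw [hm.formNorm_sq]
    linarith
  · rw [hp.formNorm_sq]
    linarith

/-- Perturbation of the two beam components of a state. -/
theorem stateNorm_add_le (ha : IsEnergyForm a) (hm : IsEnergyForm m) (hp : IsEnergyForm p)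
    (u v x y : X) (ζ : Z) :
    stateNorm a m p (u + x) (v + y) ζ ≤ stateNorm a m p u v ζ + 2 * (formNorm a x + formNorm m y) := by
  set n := stateNorm a m p u v ζ with hn
  have h1 := stateNorm_sq ha hm hp u v ζ
  have h2 := stateNorm_sq ha hm hp (u + x) (v + y) ζ
  obtain ⟨hu, hv, -⟩ := formNorm_le_stateNorm ha hm hp u v ζ
  have n0 : 0 ≤ n := stateNorm_nonneg u v ζ
  have x0 := formNorm_nonneg a x
  have y0 := formNorm_nonneg m y
  have c1 := ((le_abs_self _).trans (ha.abs_apply_le u x)).trans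
    (mul_le_mul_of_nonneg_right hu x0)
  have c2 := ((le_abs_self _).trans (hm.abs_apply_le v y)).trans
    (mul_le_mul_of_nonneg_right hv y0)
  refine (abs_le_of_sq_le_sq' ?_ (by positivity)).2
  rw [h2]
  simp only [map_add, add_apply, ha.symm x u, hm.symm y v]
  rw [← ha.formNorm_sq x, ← hm.formNorm_sq y]
  rw [← hn] at h1 c1 c2
  nlinarith [mul_nonneg x0 y0, mul_nonneg n0 x0, mul_nonneg n0 y0]

/-- One step of the energy method for a perturbed Crank-Nicolson scheme: testing the second equation
with the mean velocity, all terms of the unperturbed scheme add up to something nonpositive, and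
only the residuals remain.  Since the energy grows quadratically in the state, the factor
`stateNorm z₁ + stateNorm z₀` cancels and no Gronwall argument is needed. -/
theorem stateNorm_step_le (ha : IsEnergyForm a) (hm : IsEnergyForm m) (hp : IsEnergyForm p)
    {b : X →L[ℝ] X →L[ℝ] ℝ} {e : Z →L[ℝ] X →L[ℝ] ℝ} {A : Z →L[ℝ] Z} {B : X →L[ℝ] Z}
    (hdiss : ∀ ζ v, p ζ (A ζ + B v) ≤ e ζ v + b v v)
    {W : Submodule ℝ X} {τ γ : ℝ} (hτ : 0 ≤ τ) (hγ : 0 ≤ γ)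
    {u₀ u₁ v₀ v₁ ρ : X} {ζ₀ ζ₁ σ : Z} {G : X → ℝ} (hv₀ : v₀ ∈ W) (hv₁ : v₁ ∈ W)
    (hu : u₁ - u₀ = (τ / 2) • (v₁ + v₀) + ρ)
    (hv : ∀ w ∈ W, m (v₁ - v₀) w =
      -((τ / 2) * (a (u₁ + u₀) w + b (v₁ + v₀) w + e (ζ₁ + ζ₀) w)) + G w)
    (hG : ∀ w, |G w| ≤ γ * formNorm m w)
    (hζ : ζ₁ - ζ₀ = (τ / 2) • (A (ζ₁ + ζ₀) + B (v₁ + v₀)) + σ) :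
    stateNorm a m p u₁ v₁ ζ₁ ≤
      stateNorm a m p u₀ v₀ ζ₀ + 2 * (formNorm a ρ + γ + formNorm p σ) := by
  have s1 := stateNorm_sq ha hm hp u₁ v₁ ζ₁
  have s0 := stateNorm_sq ha hm hp u₀ v₀ ζ₀
  obtain ⟨a1, b1, c1⟩ := formNorm_le_stateNorm ha hm hp u₁ v₁ ζ₁
  obtain ⟨a0, b0, c0⟩ := formNorm_le_stateNorm ha hm hp u₀ v₀ ζ₀
  have n1 := stateNorm_nonneg (a := a) (m := m) (p := p) u₁ v₁ ζ₁
  have n0 := stateNorm_nonneg (a := a) (m := m) (p := p) u₀ v₀ ζ₀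
  set n₁ := stateNorm a m p u₁ v₁ ζ₁
  set n₀ := stateNorm a m p u₀ v₀ ζ₀
  have au := (ha.formNorm_add_le u₁ u₀).trans (add_le_add a1 a0)
  have bv := (hm.formNorm_add_le v₁ v₀).trans (add_le_add b1 b0)
  have cz := (hp.formNorm_add_le ζ₁ ζ₀).trans (add_le_add c1 c0)
  have ρ0 := formNorm_nonneg a ρ
  have σ0 := formNorm_nonneg p σ
  -- the differences of squares
  have da : a u₁ u₁ - a u₀ u₀ = a (u₁ - u₀) (u₁ + u₀) := by
    simp only [map_add, map_sub, sub_apply, ha.symm u₀ u₁]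
    ring
  have dm : m v₁ v₁ - m v₀ v₀ = m (v₁ - v₀) (v₁ + v₀) := by
    simp only [map_add, map_sub, sub_apply, hm.symm v₀ v₁]
    ring
  have dp : p ζ₁ ζ₁ - p ζ₀ ζ₀ = p (ζ₁ - ζ₀) (ζ₁ + ζ₀) := by
    simp only [map_add, map_sub, sub_apply, hp.symm ζ₀ ζ₁]
    ring
  rw [hu, ha.symm _ (u₁ + u₀), (a (u₁ + u₀)).map_add, (a (u₁ + u₀)).map_smul, smul_eq_mul,
    ha.symm _ ρ] at da
  rw [hv _ (W.add_mem hv₁ hv₀)] at dm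
  rw [hζ, hp.symm _ (ζ₁ + ζ₀), (p (ζ₁ + ζ₀)).map_add, (p (ζ₁ + ζ₀)).map_smul, smul_eq_mul,
    hp.symm _ σ] at dp
  have hd := mul_le_mul_of_nonneg_left (hdiss (ζ₁ + ζ₀) (v₁ + v₀)) (div_nonneg hτ zero_le_two)
  have r1 := ((le_abs_self _).trans (ha.abs_apply_le ρ (u₁ + u₀))).trans
    (mul_le_mul_of_nonneg_left au ρ0)
  have r2 := ((le_abs_self _).trans (hG (v₁ + v₀))).trans (mul_le_mul_of_nonneg_left bv hγ)
  have r3 := ((le_abs_self _).trans (hp.abs_apply_le σ (ζ₁ + ζ₀))).trans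
    (mul_le_mul_of_nonneg_left cz σ0)
  have hmain : n₁ ^ 2 - n₀ ^ 2 ≤ (formNorm a ρ + γ + formNorm p σ) * (n₁ + n₀) := by
    rw [s1, s0]
    linarith
  -- were the claim false, the common factor `n₁ + n₀` could be cancelled to contradict `hmain`
  by_contra hcon
  push Not at hcon
  nlinarith [mul_nonneg (add_nonneg (add_nonneg ρ0 hγ) σ0) n0,
    mul_nonneg (add_nonneg (add_nonneg ρ0 hγ) σ0) n1]

/-- The error of one Crank-Nicolson step.  Here `y₀, y₁, y₂` are the exact solution and its first two
derivatives, `θ` is the exact controller state with derivative `θ'`, at the two ends of the step;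
`R₀, R₁, R₂` bound the trapezoidal errors, `R₃` and `R₄` the projection errors. -/
theorem crankNicolson_step_error (ha : IsEnergyForm a) (hm : IsEnergyForm m) (hp : IsEnergyForm p)
    {b : X →L[ℝ] X →L[ℝ] ℝ} {e : Z →L[ℝ] X →L[ℝ] ℝ} {A : Z →L[ℝ] Z} {B : X →L[ℝ] Z}
    (hdiss : ∀ ζ v, p ζ (A ζ + B v) ≤ e ζ v + b v v)
    {β : ℝ} (hβ : 0 ≤ β) (hb : ∀ x w, |b x w| ≤ β * ‖x‖ * formNorm m w)
    {W : Submodule ℝ X} {P : X →L[ℝ] X} (hPW : ∀ x, P x ∈ W)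
    (hPa : ∀ x, ∀ w ∈ W, a (P x) w = a x w) {κ : ℝ} (hκ : 0 ≤ κ) (hPκ : ∀ x, ‖P x‖ ≤ κ * ‖x‖)
    {s t : ℝ} (hst : s ≤ t) {y₀ y₁ y₂ : ℝ → X} {θ θ' : ℝ → Z}
    (heq : ∀ r ∈ ({s, t} : Set ℝ), ∀ w ∈ W,
      m (y₂ r) w + a (y₀ r) w + b (y₁ r) w + e (θ r) w = 0)
    (hode : ∀ r ∈ ({s, t} : Set ℝ), θ' r = A (θ r) + B (y₁ r))
    {u₀ u₁ v₀ v₁ : X} {ζ₀ ζ₁ : Z} (hv₀ : v₀ ∈ W) (hv₁ : v₁ ∈ W)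
    (hu : u₁ - u₀ = ((t - s) / 2) • (v₁ + v₀))
    (hv : ∀ w ∈ W, m (v₁ - v₀) w =
      -(((t - s) / 2) * (a (u₁ + u₀) w + b (v₁ + v₀) w + e (ζ₁ + ζ₀) w)))
    (hζ : ζ₁ - ζ₀ = ((t - s) / 2) • (A (ζ₁ + ζ₀) + B (v₁ + v₀)))
    {R₀ R₁ R₂ R₃ R₄ : ℝ}
    (h0 : ‖((t - s) / 2) • (y₁ t + y₁ s) - (y₀ t - y₀ s)‖ ≤ R₀)
    (h1 : ‖((t - s) / 2) • (y₂ t + y₂ s) - (y₁ t - y₁ s)‖ ≤ R₁)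
    (h2 : ‖((t - s) / 2) • (θ' t + θ' s) - (θ t - θ s)‖ ≤ R₂)
    (h3 : ∀ r ∈ ({s, t} : Set ℝ), ‖y₁ r - P (y₁ r)‖ ≤ R₃)
    (h4 : ‖(y₁ t - P (y₁ t)) - (y₁ s - P (y₁ s))‖ ≤ R₄) :
    stateNorm a m p (u₁ - P (y₀ t)) (v₁ - P (y₁ t)) (ζ₁ - θ t) ≤
      stateNorm a m p (u₀ - P (y₀ s)) (v₀ - P (y₁ s)) (ζ₀ - θ s) +
        2 * (Real.sqrt ‖a‖ * κ + Real.sqrt ‖m‖ + β + Real.sqrt ‖p‖ * (1 + ‖B‖)) *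
          (R₀ + R₁ + R₂ + (t - s) * R₃ + R₄) := by
  have hs : s ∈ ({s, t} : Set ℝ) := by simp
  have ht : t ∈ ({s, t} : Set ℝ) := by simp
  have hτ : 0 ≤ t - s := sub_nonneg.2 hst
  have R0 := (norm_nonneg _).trans h0
  have R1 := (norm_nonneg _).trans h1
  have R2 := (norm_nonneg _).trans h2
  have R3 := (norm_nonneg _).trans (h3 s hs)
  have R4 := (norm_nonneg _).trans h4
  set ρ : X := P (((t - s) / 2) • (y₁ t + y₁ s) - (y₀ t - y₀ s)) with hρ
  set χ : X := (((t - s) / 2) • (y₂ t + y₂ s) - (y₁ t - y₁ s))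
    + ((y₁ t - P (y₁ t)) - (y₁ s - P (y₁ s))) with hχ
  set g : X := ((t - s) / 2) • ((y₁ t - P (y₁ t)) + (y₁ s - P (y₁ s))) with hg
  set σ : Z := (((t - s) / 2) • (θ' t + θ' s) - (θ t - θ s)) - B g with hσ
  have ng : ‖g‖ ≤ (t - s) * R₃ := by
    rw [hg, norm_smul, Real.norm_of_nonneg (div_nonneg hτ zero_le_two)]
    have := norm_add_le_of_le (h3 t ht) (h3 s hs)
    calc _ ≤ (t - s) / 2 * (R₃ + R₃) := mul_le_mul_of_nonneg_left this (div_nonneg hτ zero_le_two)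
      _ = _ := by ring
  have nχ : ‖χ‖ ≤ R₁ + R₄ := norm_add_le_of_le h1 h4
  have nσ : ‖σ‖ ≤ R₂ + ‖B‖ * ((t - s) * R₃) :=
    norm_sub_le_of_le h2 ((B.le_opNorm g).trans (mul_le_mul_of_nonneg_left ng (norm_nonneg B)))
  have nρ : ‖ρ‖ ≤ κ * R₀ := (hPκ _).trans (mul_le_mul_of_nonneg_left h0 hκ)
  set γ : ℝ := Real.sqrt ‖m‖ * (R₁ + R₄) + β * ((t - s) * R₃) with hγ
  have step := stateNorm_step_le (a := a) (m := m) (p := p) ha hm hp hdiss (W := W) hτ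
    (γ := γ) (by positivity) (u₀ := u₀ - P (y₀ s)) (u₁ := u₁ - P (y₀ t))
    (v₀ := v₀ - P (y₁ s)) (v₁ := v₁ - P (y₁ t)) (ρ := ρ) (ζ₀ := ζ₀ - θ s) (ζ₁ := ζ₁ - θ t)
    (σ := σ) (G := fun w => m χ w + b g w) (W.sub_mem hv₀ (hPW _)) (W.sub_mem hv₁ (hPW _))
    (by
      have e1 : u₁ = u₀ + ((t - s) / 2) • (v₁ + v₀) := by rw [← hu]; abel
      rw [hρ, e1]
      simp only [map_sub, map_smul, map_add]
      module)
    (by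
      intro w hw
      have q1 := heq s hs w hw
      have q2 := heq t ht w hw
      have q3 := hv w hw
      have q4 := hPa (y₀ s) w hw
      have q5 := hPa (y₀ t) w hw
      simp only [hχ, hg, map_sub, map_smul, map_add, sub_apply,
        add_apply, smul_apply, smul_eq_mul] at q3 ⊢
      rw [q4, q5]
      linear_combination q3 + ((t - s) / 2) * (-q1 - q2))
    (by
      intro w
      refine (abs_add_le _ _).trans ?_
      have i1 := hm.abs_apply_le χ w
      have i2 := hb g w
      have w0 := formNorm_nonneg m w
      have i3 : formNorm m χ ≤ Real.sqrt ‖m‖ * (R₁ + R₄) :=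
        (formNorm_le m χ).trans (mul_le_mul_of_nonneg_left nχ (Real.sqrt_nonneg _))
      have i4 := mul_le_mul_of_nonneg_right i3 w0
      have i5 := mul_le_mul_of_nonneg_right (mul_le_mul_of_nonneg_left ng hβ) w0
      rw [hγ, add_mul]
      exact add_le_add (i1.trans i4) (i2.trans i5))
    (by
      have e1 : ζ₁ = ζ₀ + ((t - s) / 2) • (A (ζ₁ + ζ₀) + B (v₁ + v₀)) := by rw [← hζ]; abel
      have e2 : ζ₁ - θ t - (ζ₀ - θ s) = (ζ₁ - ζ₀) - (θ t - θ s) := by abel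
      rw [e2, hζ, hσ, hg, hode s hs, hode t ht]
      simp only [map_sub, map_smul, map_add]
      module)
  refine step.trans (add_le_add_right ?_ _)
  rw [mul_assoc]
  refine mul_le_mul_of_nonneg_left ?_ zero_le_two
  have j1 : formNorm a ρ ≤ Real.sqrt ‖a‖ * (κ * R₀) :=
    (formNorm_le a ρ).trans (mul_le_mul_of_nonneg_left nρ (Real.sqrt_nonneg _))
  have j2 : formNorm p σ ≤ Real.sqrt ‖p‖ * (R₂ + ‖B‖ * ((t - s) * R₃)) :=
    (formNorm_le p σ).trans (mul_le_mul_of_nonneg_left nσ (Real.sqrt_nonneg _))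
  have hT3 : 0 ≤ (t - s) * R₃ := mul_nonneg hτ R3
  generalize (t - s) * R₃ = Q at *
  set R := R₀ + R₁ + R₂ + Q + R₄ with hR
  have k1 : Real.sqrt ‖a‖ * (κ * R₀) ≤ Real.sqrt ‖a‖ * κ * R := by
    rw [mul_assoc]
    gcongr
    linarith
  have k2 : Real.sqrt ‖m‖ * (R₁ + R₄) ≤ Real.sqrt ‖m‖ * R := by
    gcongr
    linarith
  have k3 : β * Q ≤ β * R := by
    gcongr
    linarith
  have k4 : Real.sqrt ‖p‖ * (R₂ + ‖B‖ * Q) ≤ Real.sqrt ‖p‖ * (1 + ‖B‖) * R := by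
    rw [mul_assoc, add_mul, one_mul]
    have : ‖B‖ * Q ≤ ‖B‖ * R := by
      gcongr
      linarith
    gcongr
    linarith
  calc formNorm a ρ + γ + formNorm p σ
      ≤ Real.sqrt ‖a‖ * κ * R + (Real.sqrt ‖m‖ * R + β * R)
        + Real.sqrt ‖p‖ * (1 + ‖B‖) * R := by
          rw [hγ]
          linarith
    _ = _ := by ring

end StateNorm

/-! ### The projection onto a finite dimensional subspace -/

/-- A coercive form defines a projection onto every finite dimensional subspace.  Its norm and its
quasi-optimality constant do not depend on the subspace. -/
theorem exists_galerkin_projection {X : Type*} [NormedAddCommGroup X] [NormedSpace ℝ X]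
    {a : X →L[ℝ] X →L[ℝ] ℝ} {c : ℝ} (hc : 0 < c) (ha : ∀ x, c * ‖x‖ ^ 2 ≤ a x x)
    (W : Submodule ℝ X) [FiniteDimensional ℝ W] :
    ∃ P : X →L[ℝ] X, (∀ x, P x ∈ W) ∧ (∀ x, ∀ w ∈ W, a (P x) w = a x w) ∧
      (∀ x, ‖P x‖ ≤ ‖a‖ / c * ‖x‖) ∧ ∀ x, ∀ w ∈ W, ‖x - P x‖ ≤ ‖a‖ / c * ‖x - w‖ := by
  let R : X →ₗ[ℝ] Module.Dual ℝ W :=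
    { toFun := fun x => (a x).toLinearMap ∘ₗ W.subtype
      map_add' := fun x y => by
        ext w
        simp
      map_smul' := fun r x => by
        ext w
        simp }
  have hinj : Function.Injective (R ∘ₗ W.subtype) := by
    rw [← LinearMap.ker_eq_bot, LinearMap.ker_eq_bot']
    intro w hw
    have h1 : a w w = 0 := LinearMap.congr_fun hw w
    have h2 := ha w
    rw [h1] at h2
    have h3 : ‖(w : X)‖ ^ 2 ≤ 0 := nonpos_of_mul_nonpos_right h2 hc
    have h4 : ‖(w : X)‖ = 0 := pow_eq_zero_iff two_ne_zero |>.1 (le_antisymm h3 (sq_nonneg _))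
    exact Subtype.ext (norm_eq_zero.1 h4)
  let E := LinearMap.linearEquivOfInjective (R ∘ₗ W.subtype) hinj
    Subspace.dual_finrank_eq.symm
  let P₀ : X →ₗ[ℝ] X := W.subtype ∘ₗ E.symm.toLinearMap ∘ₗ R
  have hPW : ∀ x, P₀ x ∈ W := fun x => (E.symm (R x)).2
  have hPa : ∀ x, ∀ w ∈ W, a (P₀ x) w = a x w := by
    intro x w hw
    have h1 : E (E.symm (R x)) = R x := E.apply_symm_apply _
    exact LinearMap.congr_fun h1 ⟨w, hw⟩
  -- cancels one factor of the norm in the coercivity estimate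
  have hcancel : ∀ x y : X, a x x = a x y → ‖x‖ ≤ ‖a‖ / c * ‖y‖ := by
    intro x y hxy
    have h1 := ha x
    have h2 := (le_abs_self _).trans (a.le_opNorm₂ x y)
    rw [hxy] at h1
    rw [div_mul_eq_mul_div, le_div_iff₀ hc]
    rcases (norm_nonneg x).eq_or_lt' with h0 | h0
    · rw [h0, zero_mul]
      positivity
    · have h3 : ‖x‖ * (‖x‖ * c) ≤ ‖x‖ * (‖a‖ * ‖y‖) := by linarith
      exact le_of_mul_le_mul_left h3 h0
  have hbound : ∀ x, ‖P₀ x‖ ≤ ‖a‖ / c * ‖x‖ := by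
    intro x
    rcases (norm_nonneg (P₀ x)).eq_or_lt' with h0 | h0
    · rw [h0]
      positivity
    · have h1 := ha (P₀ x)
      rw [hPa x _ (hPW x)] at h1
      have h2 := (le_abs_self _).trans (a.le_opNorm₂ x (P₀ x))
      rw [div_mul_eq_mul_div, le_div_iff₀ hc]
      have h3 : ‖P₀ x‖ * (‖P₀ x‖ * c) ≤ ‖P₀ x‖ * (‖a‖ * ‖x‖) := by linarith
      exact le_of_mul_le_mul_left h3 h0
  refine ⟨P₀.mkContinuous _ hbound, hPW, hPa, hbound, fun x w hw => hcancel _ _ ?_⟩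
  have h1 : x - P₀ x = (x - w) + (w - P₀ x) := by abel
  have h2 : a (x - P₀ x) (w - P₀ x) = 0 := by
    rw [a.map_sub, sub_apply, hPa x _ (W.sub_mem hw (hPW x)), sub_self]
  have h3 : a (x - P₀ x) (x - P₀ x) = a (x - P₀ x) ((x - w) + (w - P₀ x)) := by rw [← h1]
  rw [(a (x - P₀ x)).map_add, h2, add_zero] at h3
  exact h3

/-! ### The bilinear forms of the beam -/

theorem integrable_weight_mul_mul {L : ℝ} {ρ : ℝ → ℝ} (hρ : ContinuousOn ρ (Icc 0 L))
    (f g : Lp ℝ 2 (intervalMeasure 0 L)) :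
    Integrable (fun x => ρ x * f x * g x) (intervalMeasure 0 L) := by
  obtain ⟨K, hK⟩ := isCompact_Icc.exists_bound_of_continuousOn hρ
  have h1 : Integrable (fun x => f x * g x) (intervalMeasure 0 L) :=
    (Lp.memLp f).integrable_mul (Lp.memLp g)
  have h2 := h1.bdd_mul (c := K)
    ((hρ.mono Ioo_subset_Icc_self).aestronglyMeasurable measurableSet_Ioo) (by
      filter_upwards [ae_restrict_mem measurableSet_Ioo] with x hx
      exact hK x (Ioo_subset_Icc_self hx))
  simpa only [mul_assoc] using h2

theorem abs_integral_weight_mul_mul_le {L : ℝ} {ρ : ℝ → ℝ} {K : ℝ}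
    (hρ : ContinuousOn ρ (Icc 0 L)) (hK : ∀ x ∈ Icc 0 L, ‖ρ x‖ ≤ K)
    (hK0 : 0 ≤ K) (f g : Lp ℝ 2 (intervalMeasure 0 L)) :
    |∫ x in Ioo 0 L, ρ x * f x * g x| ≤ K * ‖f‖ * ‖g‖ := by
  have h1 : Integrable (fun x => f x * g x) (intervalMeasure 0 L) :=
    (Lp.memLp f).integrable_mul (Lp.memLp g)
  have h2 : ∫ x in Ioo 0 L, ‖f x * g x‖ ≤ ‖f‖ * ‖g‖ := by
    have h3 : inner ℝ |f| |g| ≤ ‖|f|‖ * ‖|g|‖ := real_inner_le_norm _ _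
    rw [norm_abs_eq_norm, norm_abs_eq_norm, L2.inner_def] at h3
    refine le_trans (le_of_eq (integral_congr_ae ?_)) h3
    filter_upwards [Lp.coeFn_abs f, Lp.coeFn_abs g] with x hf hg
    simp [hf, hg, mul_comm]
  calc ‖∫ x in Ioo 0 L, ρ x * f x * g x‖ ≤ ∫ x in Ioo 0 L, ‖ρ x * f x * g x‖ :=
        norm_integral_le_integral_norm _
    _ ≤ ∫ x in Ioo 0 L, K * ‖f x * g x‖ := by
        refine setIntegral_mono_on (integrable_weight_mul_mul hρ f g).norm (h1.norm.const_mul K)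
          measurableSet_Ioo fun x hx => ?_
        rw [mul_assoc, norm_mul]
        exact mul_le_mul_of_nonneg_right (hK x (Ioo_subset_Icc_self hx)) (norm_nonneg _)
    _ = K * ∫ x in Ioo 0 L, ‖f x * g x‖ := integral_const_mul _ _
    _ ≤ K * (‖f‖ * ‖g‖) := mul_le_mul_of_nonneg_left h2 hK0
    _ = _ := by ring

/-- The weighted inner product `∫ ρ f g` on `L²(0, L)` as a bounded bilinear form. -/
def weightedForm {L : ℝ} {ρ : ℝ → ℝ} (hρ : ContinuousOn ρ (Icc 0 L)) :
    Lp ℝ 2 (intervalMeasure 0 L) →L[ℝ] Lp ℝ 2 (intervalMeasure 0 L) →L[ℝ] ℝ :=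
  LinearMap.mkContinuousOfExistsBound₂
    (LinearMap.mk₂ ℝ (fun f g : Lp ℝ 2 (intervalMeasure 0 L) => ∫ x in Ioo 0 L, ρ x * f x * g x)
      (fun f f' g => by
        rw [← integral_add (integrable_weight_mul_mul hρ f g) (integrable_weight_mul_mul hρ f' g)]
        refine integral_congr_ae ?_
        filter_upwards [Lp.coeFn_add f f'] with x hx
        rw [hx, Pi.add_apply]
        ring)
      (fun c f g => by
        rw [smul_eq_mul, ← integral_const_mul]
        refine integral_congr_ae ?_
        filter_upwards [Lp.coeFn_smul c f] with x hx
        rw [hx, Pi.smul_apply, smul_eq_mul]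
        ring)
      (fun f g g' => by
        rw [← integral_add (integrable_weight_mul_mul hρ f g) (integrable_weight_mul_mul hρ f g')]
        refine integral_congr_ae ?_
        filter_upwards [Lp.coeFn_add g g'] with x hx
        rw [hx, Pi.add_apply]
        ring)
      (fun c f g => by
        rw [smul_eq_mul, ← integral_const_mul]
        refine integral_congr_ae ?_
        filter_upwards [Lp.coeFn_smul c g] with x hx
        rw [hx, Pi.smul_apply, smul_eq_mul]
        ring))
    (by
      obtain ⟨K, hK⟩ := isCompact_Icc.exists_bound_of_continuousOn hρ
      exact ⟨max K 0, fun f g => abs_integral_weight_mul_mul_le hρ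
        (fun x hx => (hK x hx).trans (le_max_left _ _)) (le_max_right _ _) f g⟩)

theorem weightedForm_apply {L : ℝ} {ρ : ℝ → ℝ} (hρ : ContinuousOn ρ (Icc 0 L))
    (f g : Lp ℝ 2 (intervalMeasure 0 L)) :
    weightedForm hρ f g = ∫ x in Ioo 0 L, ρ x * f x * g x := rfl

theorem weightedForm_symm {L : ℝ} {ρ : ℝ → ℝ} (hρ : ContinuousOn ρ (Icc 0 L))
    (f g : Lp ℝ 2 (intervalMeasure 0 L)) : weightedForm hρ f g = weightedForm hρ g f := by
  rw [weightedForm_apply, weightedForm_apply]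
  refine integral_congr_ae (Eventually.of_forall fun x => ?_)
  simp only
  ring

theorem weightedForm_self_ge {L : ℝ} (hL : 0 < L) {ρ : ℝ → ℝ} (hρ : ContinuousOn ρ (Icc 0 L))
    {c : ℝ} (hc : ∀ x ∈ Icc 0 L, c ≤ ρ x) (f : Lp ℝ 2 (intervalMeasure 0 L)) :
    c * ‖f‖ ^ 2 ≤ weightedForm hρ f f := by
  rw [weightedForm_apply, Lp_norm_sq_eq hL, intervalIntegral.integral_of_le hL.le,
    integral_Ioc_eq_integral_Ioo, ← integral_const_mul]
  refine setIntegral_mono_on ((Lp_integrable_sq f).const_mul c) (integrable_weight_mul_mul hρ f f)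
    measurableSet_Ioo fun x hx => ?_
  rw [mul_assoc, ← sq]
  exact mul_le_mul_of_nonneg_right (hc x (Ioo_subset_Icc_self hx)) (sq_nonneg _)

/-- A form `g(D v, D w)` with two rank one terms added. -/
def addPointForms {X Y : Type*} [NormedAddCommGroup X] [NormedSpace ℝ X] [NormedAddCommGroup Y]
    [NormedSpace ℝ Y] (g : Y →L[ℝ] Y →L[ℝ] ℝ) (D : X →L[ℝ] Y) (s₁ s₂ : X →L[ℝ] ℝ) (k₁ k₂ : ℝ) :
    X →L[ℝ] X →L[ℝ] ℝ :=
  g.bilinearComp D D + k₁ • s₁.smulRight s₁ + k₂ • s₂.smulRight s₂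

theorem addPointForms_apply {X Y : Type*} [NormedAddCommGroup X] [NormedSpace ℝ X]
    [NormedAddCommGroup Y] [NormedSpace ℝ Y] (g : Y →L[ℝ] Y →L[ℝ] ℝ) (D : X →L[ℝ] Y)
    (s₁ s₂ : X →L[ℝ] ℝ) (k₁ k₂ : ℝ) (v w : X) :
    addPointForms g D s₁ s₂ k₁ k₂ v w = g (D v) (D w) + k₁ * (s₁ v * s₁ w) + k₂ * (s₂ v * s₂ w) :=
  rfl

/-- The stiffness form `a` as a bounded bilinear form. -/
def Beam.stiffL {n : ℕ} (S : Beam n) (hS : S.IsAdmissible) :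
    TildeH S.L 2 →L[ℝ] TildeH S.L 2 →L[ℝ] ℝ :=
  addPointForms (weightedForm hS.Λ_smooth.continuousOn) (TildeH.DL S.L 2)
    (TildeH.tipSlopeL hS.L_pos) (TildeH.tipL hS.L_pos) S.ctrl₁.k S.ctrl₂.k

theorem Beam.stiffL_eq {n : ℕ} (S : Beam n) (hS : S.IsAdmissible) (v w : TildeH S.L 2) :
    S.stiffL hS v w = weightedForm hS.Λ_smooth.continuousOn (v.1.1 2) (w.1.1 2)
      + S.ctrl₁.k * (TildeH.tipSlopeL hS.L_pos v * TildeH.tipSlopeL hS.L_pos w)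
      + S.ctrl₂.k * (TildeH.tipL hS.L_pos v * TildeH.tipL hS.L_pos w) :=
  addPointForms_apply _ _ _ _ _ _ v w

theorem Beam.stiffL_apply {n : ℕ} (S : Beam n) (hS : S.IsAdmissible) (v w : TildeH S.L 2) :
    S.stiffL hS v w = S.formA v w := by
  rw [S.stiffL_eq, TildeH.tipSlopeL_apply, TildeH.tipSlopeL_apply, TildeH.tipL_apply,
    TildeH.tipL_apply, ← mul_assoc, ← mul_assoc]
  rfl

/-- The inner product of `H`, pulled back to `H̃₀²(0, L)`, as a bounded bilinear form. -/
def Beam.massL {n : ℕ} (S : Beam n) (hS : S.IsAdmissible) :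
    TildeH S.L 2 →L[ℝ] TildeH S.L 2 →L[ℝ] ℝ :=
  addPointForms (weightedForm hS.μ_smooth.continuousOn) (TildeH.DL S.L 0)
    (TildeH.tipSlopeL hS.L_pos) (TildeH.tipL hS.L_pos) S.J S.M

theorem Beam.massL_eq {n : ℕ} (S : Beam n) (hS : S.IsAdmissible) (v w : TildeH S.L 2) :
    S.massL hS v w = weightedForm hS.μ_smooth.continuousOn (v.1.1 0) (w.1.1 0)
      + S.J * (TildeH.tipSlopeL hS.L_pos v * TildeH.tipSlopeL hS.L_pos w)
      + S.M * (TildeH.tipL hS.L_pos v * TildeH.tipL hS.L_pos w) :=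
  addPointForms_apply _ _ _ _ _ _ v w

theorem Beam.massL_apply {n : ℕ} (S : Beam n) (hS : S.IsAdmissible) (v w : TildeH S.L 2) :
    S.massL hS v w = S.innerH v.hat w.hat := by
  rw [S.massL_eq, TildeH.tipSlopeL_apply, TildeH.tipSlopeL_apply, TildeH.tipL_apply,
    TildeH.tipL_apply, ← mul_assoc, ← mul_assoc, add_assoc, add_comm]
  rfl

/-- The damping form `d₁ v_x(L) w_x(L) + d₂ v(L) w(L)` as a bounded bilinear form: the two rank one
terms are added to the zero form. -/
def Beam.dampL {n : ℕ} (S : Beam n) (hS : S.IsAdmissible) :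
    TildeH S.L 2 →L[ℝ] TildeH S.L 2 →L[ℝ] ℝ :=
  addPointForms (0 : ℝ →L[ℝ] ℝ →L[ℝ] ℝ) (TildeH.tipL hS.L_pos)
    (TildeH.tipSlopeL hS.L_pos) (TildeH.tipL hS.L_pos) S.ctrl₁.d S.ctrl₂.d

theorem Beam.dampL_eq {n : ℕ} (S : Beam n) (hS : S.IsAdmissible) (v w : TildeH S.L 2) :
    S.dampL hS v w = S.ctrl₁.d * (TildeH.tipSlopeL hS.L_pos v * TildeH.tipSlopeL hS.L_pos w)
      + S.ctrl₂.d * (TildeH.tipL hS.L_pos v * TildeH.tipL hS.L_pos w) := by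
  refine (addPointForms_apply _ _ _ _ _ _ v w).trans ?_
  rw [zero_apply, zero_apply, zero_add]

theorem Beam.dampL_apply {n : ℕ} (S : Beam n) (hS : S.IsAdmissible) (v w : TildeH S.L 2) :
    S.dampL hS v w = S.formB v.hat w.hat := by
  rw [S.dampL_eq, TildeH.tipSlopeL_apply, TildeH.tipSlopeL_apply, TildeH.tipL_apply,
    TildeH.tipL_apply, ← mul_assoc, ← mul_assoc]
  rfl

theorem exists_pos_lower_bound {L : ℝ} (hL : 0 < L) {ρ : ℝ → ℝ} (hρ : ContinuousOn ρ (Icc 0 L))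
    (hpos : ∀ x ∈ Icc 0 L, 0 < ρ x) : ∃ c, 0 < c ∧ ∀ x ∈ Icc 0 L, c ≤ ρ x := by
  obtain ⟨x₀, hx₀, hmin⟩ := isCompact_Icc.exists_isMinOn (nonempty_Icc.2 hL.le) hρ
  exact ⟨ρ x₀, hpos x₀ hx₀, fun x hx => hmin hx⟩

/-- Coercivity of the stiffness form on `H̃₀²(0, L)`. -/
theorem Beam.exists_coercive_stiffL {n : ℕ} (S : Beam n) (hS : S.IsAdmissible)
    (hk₁ : 0 < S.ctrl₁.k) (hk₂ : 0 < S.ctrl₂.k) :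
    ∃ c, 0 < c ∧ ∀ w : TildeH S.L 2, c * ‖w‖ ^ 2 ≤ S.stiffL hS w w := by
  have hL := hS.L_pos
  obtain ⟨c, hc, hcΛ⟩ := exists_pos_lower_bound hL hS.Λ_smooth.continuousOn hS.Λ_pos
  have hK : 0 < 1 + S.L + S.L ^ 2 := by positivity
  refine ⟨c / (1 + S.L + S.L ^ 2) ^ 2, by positivity, fun w => ?_⟩
  have h1 := weightedForm_self_ge hL hS.Λ_smooth.continuousOn hcΛ (w.1.1 2)
  have h2 : ‖w‖ ^ 2 ≤ (1 + S.L + S.L ^ 2) ^ 2 * ‖w.1.1 2‖ ^ 2 := by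
    rw [← mul_pow]
    exact pow_le_pow_left₀ (norm_nonneg w) (w.norm_le hL) 2
  have h3 : c / (1 + S.L + S.L ^ 2) ^ 2 * ‖w‖ ^ 2 ≤ c * ‖w.1.1 2‖ ^ 2 := by
    rw [div_mul_eq_mul_div, div_le_iff₀ (by positivity)]
    calc c * ‖w‖ ^ 2 ≤ c * ((1 + S.L + S.L ^ 2) ^ 2 * ‖w.1.1 2‖ ^ 2) :=
          mul_le_mul_of_nonneg_left h2 hc.le
      _ = _ := by ring
  rw [S.stiffL_eq]
  have h5 := mul_nonneg hk₁.le (mul_self_nonneg (TildeH.tipSlopeL hL w))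
  have h6 := mul_nonneg hk₂.le (mul_self_nonneg (TildeH.tipL hL w))
  linarith

theorem Beam.isEnergyForm_stiffL {n : ℕ} (S : Beam n) (hS : S.IsAdmissible)
    (hk₁ : 0 < S.ctrl₁.k) (hk₂ : 0 < S.ctrl₂.k) : IsEnergyForm (S.stiffL hS) where
  symm := fun v w => by
    rw [S.stiffL_eq, S.stiffL_eq, weightedForm_symm]
    ring
  nonneg := fun w => by
    obtain ⟨c, hc, h⟩ := S.exists_coercive_stiffL hS hk₁ hk₂
    exact (by positivity : (0 : ℝ) ≤ c * ‖w‖ ^ 2).trans (h w)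

theorem Beam.massL_self_ge {n : ℕ} (S : Beam n) (hS : S.IsAdmissible) (w : TildeH S.L 2) :
    S.J * TildeH.tipSlopeL hS.L_pos w ^ 2 + S.M * TildeH.tipL hS.L_pos w ^ 2 ≤ S.massL hS w w := by
  have h1 := weightedForm_self_ge hS.L_pos hS.μ_smooth.continuousOn (c := 0)
    (fun x hx => (hS.μ_pos x hx).le) (w.1.1 0)
  rw [S.massL_eq]
  nlinarith

theorem Beam.isEnergyForm_massL {n : ℕ} (S : Beam n) (hS : S.IsAdmissible) :
    IsEnergyForm (S.massL hS) where
  symm := fun v w => by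
    rw [S.massL_eq, S.massL_eq, weightedForm_symm]
    ring
  nonneg := fun w => by
    have h1 := mul_nonneg hS.J_pos.le (sq_nonneg (TildeH.tipSlopeL hS.L_pos w))
    have h2 := mul_nonneg hS.M_pos.le (sq_nonneg (TildeH.tipL hS.L_pos w))
    linarith [S.massL_self_ge hS w]

/-- Rank one forms are bounded by the seminorm of a form which dominates the squares of their
functionals. -/
theorem exists_pointForms_bound {X : Type*} [NormedAddCommGroup X] [NormedSpace ℝ X]
    {m : X →L[ℝ] X →L[ℝ] ℝ} {s₁ s₂ : X →L[ℝ] ℝ} {k₁ k₂ : ℝ} (hk₁ : 0 < k₁) (hk₂ : 0 < k₂)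
    (h : ∀ w, k₁ * s₁ w ^ 2 + k₂ * s₂ w ^ 2 ≤ m w w) (d₁ d₂ : ℝ) :
    ∃ β, 0 ≤ β ∧ ∀ v w : X,
      |d₁ * (s₁ v * s₁ w) + d₂ * (s₂ v * s₂ w)| ≤ β * ‖v‖ * formNorm m w := by
  have hJ := Real.sqrt_pos.2 hk₁
  have hM := Real.sqrt_pos.2 hk₂
  refine ⟨|d₁| * ‖s₁‖ / Real.sqrt k₁ + |d₂| * ‖s₂‖ / Real.sqrt k₂, by positivity, fun v w => ?_⟩
  have e1 : |s₁ w| * Real.sqrt k₁ ≤ formNorm m w := by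
    rw [formNorm, ← Real.sqrt_sq_eq_abs, ← Real.sqrt_mul (sq_nonneg _)]
    refine Real.sqrt_le_sqrt ?_
    have := mul_nonneg hk₂.le (sq_nonneg (s₂ w))
    linarith [h w]
  have e2 : |s₂ w| * Real.sqrt k₂ ≤ formNorm m w := by
    rw [formNorm, ← Real.sqrt_sq_eq_abs, ← Real.sqrt_mul (sq_nonneg _)]
    refine Real.sqrt_le_sqrt ?_
    have := mul_nonneg hk₁.le (sq_nonneg (s₁ w))
    linarith [h w]
  rw [← le_div_iff₀ hJ] at e1
  rw [← le_div_iff₀ hM] at e2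
  have f1 : |s₁ v| ≤ ‖s₁‖ * ‖v‖ := s₁.le_opNorm v
  have f2 : |s₂ v| ≤ ‖s₂‖ * ‖v‖ := s₂.le_opNorm v
  have g1 := mul_le_mul_of_nonneg_left (mul_le_mul f1 e1 (abs_nonneg _) (by positivity))
    (abs_nonneg d₁)
  have g2 := mul_le_mul_of_nonneg_left (mul_le_mul f2 e2 (abs_nonneg _) (by positivity))
    (abs_nonneg d₂)
  refine (abs_add_le _ _).trans ?_
  rw [abs_mul, abs_mul, abs_mul, abs_mul]
  refine (add_le_add g1 g2).trans (le_of_eq ?_)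
  ring

/-- The damping form is bounded by the mass seminorm of its second argument, because the tip mass and
the tip moment of inertia are positive. -/
theorem Beam.exists_dampL_bound {n : ℕ} (S : Beam n) (hS : S.IsAdmissible) :
    ∃ β, 0 ≤ β ∧ ∀ v w : TildeH S.L 2,
      |S.dampL hS v w| ≤ β * ‖v‖ * formNorm (S.massL hS) w := by
  simp only [S.dampL_eq]
  exact exists_pointForms_bound hS.J_pos hS.M_pos (S.massL_self_ge hS) _ _

/-! ### The controllers -/

/-- The form `ζᵀ P η` on `ℝⁿ`. -/
def matrixForm {n : ℕ} (P : Matrix (Fin n) (Fin n) ℝ) : CtrlState n →L[ℝ] CtrlState n →L[ℝ] ℝ :=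
  (LinearMap.mk₂ ℝ (fun ζ η : CtrlState n => ζ.ofLp ⬝ᵥ (P *ᵥ η.ofLp))
    (fun _ _ _ => by simp [add_dotProduct]) (fun _ _ _ => by simp [smul_dotProduct])
    (fun _ _ _ => by simp [Matrix.mulVec_add]) (fun _ _ _ => by simp [Matrix.mulVec_smul])
    ).toContinuousBilinearMap

theorem matrixForm_apply {n : ℕ} (P : Matrix (Fin n) (Fin n) ℝ) (ζ η : CtrlState n) :
    matrixForm P ζ η = ζ.ofLp ⬝ᵥ (P *ᵥ η.ofLp) := rfl

/-- The functional `ζ ↦ c · ζ` on `ℝⁿ`. -/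
def dotFunctional {n : ℕ} (c : Fin n → ℝ) : CtrlState n →L[ℝ] ℝ :=
  LinearMap.toContinuousLinearMap
    { toFun := fun ζ : CtrlState n => c ⬝ᵥ ζ.ofLp
      map_add' := fun _ _ => by simp
      map_smul' := fun _ _ => by simp }

theorem dotFunctional_apply {n : ℕ} (c : Fin n → ℝ) (ζ : CtrlState n) :
    dotFunctional c ζ = c ⬝ᵥ ζ.ofLp := rfl

/-- Multiplication by a matrix on `ℝⁿ`. -/
def matrixMap {n : ℕ} (A : Matrix (Fin n) (Fin n) ℝ) : CtrlState n →L[ℝ] CtrlState n :=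
  LinearMap.toContinuousLinearMap
    { toFun := fun ζ : CtrlState n => WithLp.toLp 2 (A *ᵥ ζ.ofLp)
      map_add' := fun _ _ => by simp [Matrix.mulVec_add]
      map_smul' := fun _ _ => by simp [Matrix.mulVec_smul] }

theorem matrixMap_apply {n : ℕ} (A : Matrix (Fin n) (Fin n) ℝ) (ζ : CtrlState n) :
    matrixMap A ζ = WithLp.toLp 2 (A *ᵥ ζ.ofLp) := rfl

theorem isEnergyForm_matrixForm {n : ℕ} {P : Matrix (Fin n) (Fin n) ℝ} (hP : P.PosDef) :
    IsEnergyForm (matrixForm P) where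
  symm := fun ζ η => by
    have hT : Pᵀ = P := by
      have h := hP.isHermitian.eq
      rwa [Matrix.conjTranspose_eq_transpose_of_trivial] at h
    rw [matrixForm_apply, matrixForm_apply, Matrix.dotProduct_mulVec, ← Matrix.mulVec_transpose, hT,
      dotProduct_comm]
  nonneg := fun ζ => by
    have h := hP.posSemidef.dotProduct_mulVec_nonneg ζ.ofLp
    rwa [star_trivial] at h

/-- The dissipation inequality of a controller: the power fed into the storage function is at most
`(c · ζ) y + d y²`.  The defect is `½ (q · ζ + √(2(d - δ)) y)² + (ε / 2) ζᵀ P ζ + δ y²`. -/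
theorem Controller.IsStorage.dissipation {n : ℕ} {K : Controller n} {δ ε : ℝ}
    {P : Matrix (Fin n) (Fin n) ℝ} {q : Fin n → ℝ} (hK : K.IsAdmissible δ)
    (hP : K.IsStorage δ P q ε) (ζ : CtrlState n) (y : ℝ) :
    matrixForm P ζ (matrixMap K.A ζ + y • WithLp.toLp 2 K.b)
      ≤ dotFunctional K.c ζ * y + K.d * y ^ 2 := by
  have hE := isEnergyForm_matrixForm hP.posDef
  have h0 := hE.nonneg ζ
  set z := ζ.ofLp with hz
  have hT : Pᵀ = P := by
    have h := hP.posDef.isHermitian.eq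
    rwa [Matrix.conjTranspose_eq_transpose_of_trivial] at h
  have h1 : 2 * (z ⬝ᵥ (P *ᵥ (K.A *ᵥ z))) = - (q ⬝ᵥ z) ^ 2 - ε * (z ⬝ᵥ (P *ᵥ z)) := by
    have e1 := congrArg (fun M : Matrix (Fin n) (Fin n) ℝ => z ⬝ᵥ (M *ᵥ z)) hP.lyapunov
    simp only [Matrix.add_mulVec, Matrix.sub_mulVec, Matrix.neg_mulVec, Matrix.smul_mulVec,
      dotProduct_add, dotProduct_sub, dotProduct_neg, dotProduct_smul, smul_eq_mul,
      ← Matrix.mulVec_mulVec] at e1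
    have e2 : z ⬝ᵥ (K.Aᵀ *ᵥ (P *ᵥ z)) = z ⬝ᵥ (P *ᵥ (K.A *ᵥ z)) := by
      rw [Matrix.mulVec_transpose, dotProduct_comm, ← Matrix.dotProduct_mulVec,
        Matrix.dotProduct_mulVec z P, ← Matrix.mulVec_transpose, hT]
    have e3 : z ⬝ᵥ (Matrix.vecMulVec q q *ᵥ z) = (q ⬝ᵥ z) ^ 2 := by
      rw [Matrix.vecMulVec_mulVec, dotProduct_smul, dotProduct_comm z q]
      simp [sq]
    rw [e2, e3] at e1
    linarith
  have h2 : z ⬝ᵥ (P *ᵥ K.b) = K.c ⬝ᵥ z - Real.sqrt (2 * (K.d - δ)) * (q ⬝ᵥ z) := by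
    rw [hP.output, dotProduct_sub, dotProduct_smul, smul_eq_mul, dotProduct_comm z K.c,
      dotProduct_comm z q]
  have h3 : Real.sqrt (2 * (K.d - δ)) ^ 2 = 2 * (K.d - δ) :=
    Real.sq_sqrt (by linarith [hK.δ_le])
  have h4 : matrixForm P ζ (matrixMap K.A ζ + y • WithLp.toLp 2 K.b)
      = z ⬝ᵥ (P *ᵥ (K.A *ᵥ z)) + y * (z ⬝ᵥ (P *ᵥ K.b)) := by
    rw [map_add, map_smul, smul_eq_mul]
    rfl
  rw [h4, h2, dotFunctional_apply, ← hz]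
  have h5 : 0 ≤ ε * (z ⬝ᵥ (P *ᵥ z)) := mul_nonneg hP.ε_pos.le h0
  have h6 := sq_nonneg (q ⬝ᵥ z + Real.sqrt (2 * (K.d - δ)) * y)
  have h7 := mul_nonneg hK.δ_pos.le (sq_nonneg y)
  nlinarith

/-! ### The accumulated error of the scheme -/

/-- If a derivative of `u` is the image of a derivative of `v` under a bounded linear map, then so are
the next ones. -/
theorem Sobolev.ae_eq_clm_succ {X Y : Type*} [NormedAddCommGroup X] [NormedSpace ℝ X]
    [CompleteSpace X] [NormedAddCommGroup Y] [NormedSpace ℝ Y] [CompleteSpace Y] {a b : ℝ}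
    {m m' : ℕ} (u : Sobolev a b X m) (v : Sobolev a b Y m') (ℓ : Y →L[ℝ] X) (i : Fin m) (j : Fin m')
    (h : u.D i.castSucc =ᵐ[intervalMeasure a b] fun t => ℓ (v.D j.castSucc t)) :
    u.D i.succ =ᵐ[intervalMeasure a b] fun t => ℓ (v.D j.succ t) :=
  HasWeakDeriv.ae_unique ((u.hasWeakDeriv_D i).congr h (EventuallyEq.refl _ _))
    ((v.hasWeakDeriv_D j).clm_comp (v.integrable_D _) (v.integrable_D _) ℓ)
    (u.integrable_D _) (ℓ.integrable_comp (v.integrable_D _))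

theorem Sobolev.pointValue_eq_clm {X Y : Type*} [NormedAddCommGroup X] [NormedSpace ℝ X]
    [CompleteSpace X] [NormedAddCommGroup Y] [NormedSpace ℝ Y] [CompleteSpace Y] {a b : ℝ}
    (hab : a < b) {m m' : ℕ} (u : Sobolev a b X m) (v : Sobolev a b Y m') (ℓ : Y →L[ℝ] X)
    (i : Fin m) (j : Fin m')
    (h : u.D i.castSucc =ᵐ[intervalMeasure a b] fun t => ℓ (v.D j.castSucc t)) {t : ℝ}
    (ht : t ∈ Icc a b) :
    pointValue a b (u.D i.castSucc) t = ℓ (pointValue a b (v.D j.castSucc) t) := by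
  have hv := v.isContRep_pointValue hab j
  refine pointValue_eq hab (g := fun t => ℓ (pointValue a b (v.D j.castSucc) t))
    ⟨ℓ.continuous.comp_continuousOn hv.1, h.trans ?_⟩ ht
  filter_upwards [hv.2] with t ht
  rw [ht]

theorem Sobolev.intervalIntegral_norm_le {X : Type*} [NormedAddCommGroup X] [NormedSpace ℝ X]
    {T : ℝ} {m : ℕ} (u : Sobolev 0 T X m) (i : Fin (m + 1)) {t : ℝ} (ht : t ∈ Icc 0 T) :
    ∫ r in (0 : ℝ)..t, ‖u.D i r‖ ≤ Real.sqrt T * ‖u.1 i‖ := by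
  have hT : (0 : ℝ) ≤ T := ht.1.trans ht.2
  have h1 := integral_norm_Lp_le hT (u.1 i)
  rw [sub_zero] at h1
  refine le_trans ?_ h1
  rw [← integral_Ioc_eq_integral_Ioo, ← intervalIntegral.integral_of_le hT]
  exact intervalIntegral.integral_mono_interval le_rfl ht.1 ht.2
    (Eventually.of_forall fun _ => norm_nonneg _)
    (intervalMeasure.intervalIntegrable (u.integrable_D i) (left_mem_Icc.2 hT)
      (right_mem_Icc.2 hT)).norm

/-- The constant in front of the sum of the residuals of one step. -/
def stepConst {X Z : Type*} [NormedAddCommGroup X] [NormedSpace ℝ X] [NormedAddCommGroup Z]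
    [NormedSpace ℝ Z] (a m : X →L[ℝ] X →L[ℝ] ℝ) (p : Z →L[ℝ] Z →L[ℝ] ℝ) (B : X →L[ℝ] Z)
    (κ β : ℝ) : ℝ :=
  2 * (Real.sqrt ‖a‖ * κ + Real.sqrt ‖m‖ + β + Real.sqrt ‖p‖ * (1 + ‖B‖))

/-- The constant of the embedding of `H¹(0, T)` into the bounded functions. -/
def supConst (T : ℝ) : ℝ := (T⁻¹ + 1) * Real.sqrt T

/-- The error estimate for the scheme in an abstract setting.  The bound `δ` for the projection error
and the step size enter explicitly, and the constant does not depend on the subspace `W`. -/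
theorem crankNicolson_error {X Y Z : Type*} [NormedAddCommGroup X] [NormedSpace ℝ X]
    [CompleteSpace X] [NormedAddCommGroup Y] [NormedSpace ℝ Y] [CompleteSpace Y]
    [NormedAddCommGroup Z] [NormedSpace ℝ Z] [CompleteSpace Z]
    {a m b : X →L[ℝ] X →L[ℝ] ℝ} {p : (Z × Z) →L[ℝ] (Z × Z) →L[ℝ] ℝ}
    (ha : IsEnergyForm a) (hm : IsEnergyForm m) (hp : IsEnergyForm p)
    {e : (Z × Z) →L[ℝ] X →L[ℝ] ℝ} {A : (Z × Z) →L[ℝ] (Z × Z)} {B : X →L[ℝ] (Z × Z)}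
    (hdiss : ∀ ζ v, p ζ (A ζ + B v) ≤ e ζ v + b v v)
    {β : ℝ} (hβ : 0 ≤ β) (hb : ∀ x w, |b x w| ≤ β * ‖x‖ * formNorm m w)
    {W : Submodule ℝ X} {P : X →L[ℝ] X} (hPW : ∀ x, P x ∈ W)
    (hPa : ∀ x, ∀ w ∈ W, a (P x) w = a x w) {κ : ℝ} (hκ : 0 ≤ κ) (hPκ : ∀ x, ‖P x‖ ≤ κ * ‖x‖)
    {ι : Y →L[ℝ] X} {δ : ℝ} (hδ : 0 ≤ δ) (hPι : ∀ y, ‖ι y - P (ι y)‖ ≤ δ * ‖y‖)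
    {T : ℝ} (hT : 0 < T) (u₂ : Sobolev 0 T X 4) (u₄ : Sobolev 0 T Y 2) (ζ₁ ζ₂ : Sobolev 0 T Z 3)
    (hu₂₄ : u₂.D 0 =ᵐ[intervalMeasure 0 T] fun t => ι (u₄.D 0 t))
    (heq : ∀ t ∈ Icc 0 T, ∀ w ∈ W, m (pointValue 0 T (u₂.D 2) t) w + a (pointValue 0 T (u₂.D 0) t) w
      + b (pointValue 0 T (u₂.D 1) t) w
      + e (pointValue 0 T (ζ₁.D 0) t, pointValue 0 T (ζ₂.D 0) t) w = 0)
    (hode : ∀ t ∈ Icc 0 T, (pointValue 0 T (ζ₁.D 1) t, pointValue 0 T (ζ₂.D 1) t)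
      = A (pointValue 0 T (ζ₁.D 0) t, pointValue 0 T (ζ₂.D 0) t) + B (pointValue 0 T (u₂.D 1) t))
    {R : ℕ} (hR : 0 < R) {u v : ℕ → X} {η : ℕ → Z × Z} (hvW : ∀ k, v k ∈ W)
    (hu : ∀ k < R, u (k + 1) - u k = ((T / R) / 2) • (v (k + 1) + v k))
    (hv : ∀ k < R, ∀ w ∈ W, m (v (k + 1) - v k) w =
      -(((T / R) / 2) * (a (u (k + 1) + u k) w + b (v (k + 1) + v k) w + e (η (k + 1) + η k) w)))
    (hη : ∀ k < R, η (k + 1) - η k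
      = ((T / R) / 2) • (A (η (k + 1) + η k) + B (v (k + 1) + v k)))
    {j : ℕ} (hj : j ≤ R) :
    stateNorm a m p (u j - pointValue 0 T (u₂.D 0) (j * (T / R)))
        (v j - pointValue 0 T (u₂.D 1) (j * (T / R)))
        (η j - (pointValue 0 T (ζ₁.D 0) (j * (T / R)), pointValue 0 T (ζ₂.D 0) (j * (T / R)))) ≤
      stateNorm a m p (u 0 - P (pointValue 0 T (u₂.D 0) 0)) (v 0 - P (pointValue 0 T (u₂.D 1) 0))
        (η 0 - (pointValue 0 T (ζ₁.D 0) 0, pointValue 0 T (ζ₂.D 0) 0)) +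
      (stepConst a m p B κ β * (2 * Real.sqrt T + T * supConst T)
        + 2 * (Real.sqrt ‖a‖ + Real.sqrt ‖m‖) * supConst T) *
      (δ * ‖u₄‖ + (T / R) ^ 2 * (‖u₂.diff.diff‖ + ‖ζ₁.diff.diff‖ + ‖ζ₂.diff.diff‖)) := by
  set τ : ℝ := T / R with hτ
  have hR' : (0 : ℝ) < R := Nat.cast_pos.2 hR
  have hτ0 : 0 < τ := div_pos hT hR'
  set K : ℝ := stepConst a m p B κ β with hK
  have hK0 : 0 ≤ K := by
    rw [hK, stepConst]
    positivity
  set G : ℝ := supConst T with hG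
  have hG0 : 0 ≤ G := by
    rw [hG, supConst]
    positivity
  set y₀ : ℝ → X := pointValue 0 T (u₂.D 0) with hy₀
  set y₁ : ℝ → X := pointValue 0 T (u₂.D 1) with hy₁
  set y₂ : ℝ → X := pointValue 0 T (u₂.D 2) with hy₂
  set θ : ℝ → Z × Z := fun t => (pointValue 0 T (ζ₁.D 0) t, pointValue 0 T (ζ₂.D 0) t) with hθ
  set θ' : ℝ → Z × Z := fun t => (pointValue 0 T (ζ₁.D 1) t, pointValue 0 T (ζ₂.D 1) t) with hθ'
  -- the exact solution and its projection error
  have hu₂₄' : u₂.D 1 =ᵐ[intervalMeasure 0 T] fun t => ι (u₄.D 1 t) :=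
    Sobolev.ae_eq_clm_succ u₂ u₄ ι (0 : Fin 4) (0 : Fin 2) hu₂₄
  have hy₀' : ∀ t ∈ Icc 0 T, y₀ t = ι (pointValue 0 T (u₄.D 0) t) := fun t ht =>
    Sobolev.pointValue_eq_clm hT u₂ u₄ ι (0 : Fin 4) (0 : Fin 2) hu₂₄ ht
  have hy₁' : ∀ t ∈ Icc 0 T, y₁ t = ι (pointValue 0 T (u₄.D 1) t) := fun t ht =>
    Sobolev.pointValue_eq_clm hT u₂ u₄ ι (1 : Fin 4) (1 : Fin 2) hu₂₄' ht
  have hsup : ∀ i : Fin 2, ∀ t ∈ Icc 0 T, ‖pointValue 0 T (u₄.D i.castSucc) t‖ ≤ G * ‖u₄‖ := by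
    intro i t ht
    have h := u₄.norm_pointValue_le hT i ht
    rwa [sub_zero] at h
  have hq₀ : ∀ t ∈ Icc 0 T, ‖y₀ t - P (y₀ t)‖ ≤ δ * (G * ‖u₄‖) := by
    intro t ht
    rw [hy₀' t ht]
    exact (hPι _).trans (mul_le_mul_of_nonneg_left (hsup 0 t ht) hδ)
  have hq₁ : ∀ t ∈ Icc 0 T, ‖y₁ t - P (y₁ t)‖ ≤ δ * (G * ‖u₄‖) := by
    intro t ht
    rw [hy₁' t ht]
    exact (hPι _).trans (mul_le_mul_of_nonneg_left (hsup 1 t ht) hδ)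
  -- the accumulated residuals
  set I : (ℝ → ℝ) → ℕ → ℝ := fun f k => ∫ r in (0 : ℝ)..(k * τ), f r with hI
  have hnode : ∀ k ≤ R, (k : ℝ) * τ ∈ Icc 0 T := fun k hk => node_mem_Icc hT hR hk
  have h0T : (0 : ℝ) ∈ Icc 0 T := left_mem_Icc.2 hT.le
  have hIadd : ∀ f : ℝ → ℝ, Integrable f (intervalMeasure 0 T) → ∀ k < R,
      I f (k + 1) = I f k + ∫ r in (k * τ)..((k + 1 : ℕ) * τ), f r := by
    intro f hf k hk
    exact (intervalIntegral.integral_add_adjacent_intervals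
      (intervalMeasure.intervalIntegrable hf h0T (hnode k hk.le))
      (intervalMeasure.intervalIntegrable hf (hnode k hk.le) (hnode (k + 1) hk))).symm
  set E : ℕ → ℝ := fun k => stateNorm a m p (u k - P (y₀ (k * τ))) (v k - P (y₁ (k * τ)))
    (η k - θ (k * τ)) with hE
  set Q : ℕ → ℝ := fun k => τ ^ 2 * I (fun r => ‖u₂.D 3 r‖) k + τ ^ 2 * I (fun r => ‖u₂.D 4 r‖) k
    + (τ ^ 2 * I (fun r => ‖ζ₁.D 3 r‖) k + τ ^ 2 * I (fun r => ‖ζ₂.D 3 r‖) k)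
    + k * τ * (δ * (G * ‖u₄‖)) + δ * I (fun r => ‖u₄.D 2 r‖) k with hQ
  -- `Q k` bounds the sum of the residuals of the first `k` steps, up to the factor `K`
  have hstep : ∀ k < R, E (k + 1) ≤ E k + K * (Q (k + 1) - Q k) := by
    intro k hk
    have hs := hnode k hk.le
    have ht := hnode (k + 1) hk
    have hts : ((k + 1 : ℕ) : ℝ) * τ - k * τ = τ := by
      push_cast
      ring
    have hlt : (k : ℝ) * τ < (k + 1 : ℕ) * τ := by linarith
    have hmem : ∀ r ∈ ({(k : ℝ) * τ, ((k + 1 : ℕ) : ℝ) * τ} : Set ℝ), r ∈ Icc 0 T := by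
      rintro r (rfl | rfl)
      · exact hs
      · exact ht
    have t0 := u₂.norm_trapezoid_le hT 0 1 2 rfl rfl hs.1 hlt ht.2
    have t1 := u₂.norm_trapezoid_le hT 1 2 3 rfl rfl hs.1 hlt ht.2
    have t2 := ζ₁.norm_trapezoid_le hT 0 1 2 rfl rfl hs.1 hlt ht.2
    have t3 := ζ₂.norm_trapezoid_le hT 0 1 2 rfl rfl hs.1 hlt ht.2
    have t4 : ‖(y₁ ((k + 1 : ℕ) * τ) - P (y₁ ((k + 1 : ℕ) * τ))) - (y₁ (k * τ) - P (y₁ (k * τ)))‖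
        ≤ δ * ∫ r in (k * τ)..((k + 1 : ℕ) * τ), ‖u₄.D 2 r‖ := by
      rw [hy₁' _ hs, hy₁' _ ht]
      have e1 := u₄.pointValue_sub hT (1 : Fin 2) hs ht
      have e2 : ∀ x y : Y, (ι x - P (ι x)) - (ι y - P (ι y)) = ι (x - y) - P (ι (x - y)) := by
        intro x y
        simp only [map_sub]
        abel
      rw [e2]
      refine (hPι _).trans (mul_le_mul_of_nonneg_left ?_ hδ)
      exact (le_of_eq (congrArg norm e1)).trans
        (intervalIntegral.norm_integral_le_integral_norm hlt.le)
    have key := crankNicolson_step_error ha hm hp hdiss hβ hb hPW hPa hκ hPκ hlt.le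
      (y₀ := y₀) (y₁ := y₁) (y₂ := y₂) (θ := θ) (θ' := θ')
      (fun r hr w hw => heq r (hmem r hr) w hw) (fun r hr => hode r (hmem r hr))
      (hvW k) (hvW (k + 1)) (by rw [hts]; exact hu k hk) (by rw [hts]; exact hv k hk)
      (by rw [hts]; exact hη k hk) t0 t1
      (R₂ := (((k + 1 : ℕ) : ℝ) * τ - k * τ) ^ 2 * (∫ r in (k * τ)..((k + 1 : ℕ) * τ), ‖ζ₁.D 3 r‖)
        + (((k + 1 : ℕ) : ℝ) * τ - k * τ) ^ 2 * ∫ r in (k * τ)..((k + 1 : ℕ) * τ), ‖ζ₂.D 3 r‖)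
      (max_le (t2.trans (le_add_of_nonneg_right ((norm_nonneg _).trans t3)))
        (t3.trans (le_add_of_nonneg_left ((norm_nonneg _).trans t2))))
      (fun r hr => hq₁ r (hmem r hr)) t4
    refine key.trans (le_of_eq ?_)
    congr 1
    rw [hK, stepConst]
    congr 1
    simp only [hQ]
    rw [hIadd _ (u₂.integrable_D 3).norm k hk, hIadd _ (u₂.integrable_D 4).norm k hk,
      hIadd _ (ζ₁.integrable_D 3).norm k hk, hIadd _ (ζ₂.integrable_D 3).norm k hk,
      hIadd _ (u₄.integrable_D 2).norm k hk, hts, Nat.cast_succ]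
    have f1 : (2 : Fin 4).succ = 3 := rfl
    have f2 : (3 : Fin 4).succ = 4 := rfl
    rw [f1, f2]
    ring
  have hEQ : ∀ k ≤ R, E k ≤ E 0 + K * Q k := by
    intro k
    induction k with
    | zero =>
      intro _
      have : Q 0 = 0 := by simp [hQ, hI]
      rw [this]
      linarith
    | succ k ih =>
      intro hk
      have h1 := ih (Nat.le_of_succ_le hk)
      have h2 := hstep k hk
      linarith
  have hQj : Q j ≤ (2 * Real.sqrt T + T * G) *
      (δ * ‖u₄‖ + τ ^ 2 * (‖u₂.diff.diff‖ + ‖ζ₁.diff.diff‖ + ‖ζ₂.diff.diff‖)) := by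
    have i1 : I (fun r => ‖u₂.D 3 r‖) j ≤ Real.sqrt T * ‖u₂.diff.diff‖ :=
      (u₂.intervalIntegral_norm_le 3 (hnode j hj)).trans
        (mul_le_mul_of_nonneg_left (u₂.diff.diff.norm_coe_le 1) (Real.sqrt_nonneg _))
    have i2 : I (fun r => ‖u₂.D 4 r‖) j ≤ Real.sqrt T * ‖u₂.diff.diff‖ :=
      (u₂.intervalIntegral_norm_le 4 (hnode j hj)).trans
        (mul_le_mul_of_nonneg_left (u₂.diff.diff.norm_coe_le 2) (Real.sqrt_nonneg _))
    have i3 : I (fun r => ‖ζ₁.D 3 r‖) j ≤ Real.sqrt T * ‖ζ₁.diff.diff‖ :=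
      (ζ₁.intervalIntegral_norm_le 3 (hnode j hj)).trans
        (mul_le_mul_of_nonneg_left (ζ₁.diff.diff.norm_coe_le 1) (Real.sqrt_nonneg _))
    have i4 : I (fun r => ‖ζ₂.D 3 r‖) j ≤ Real.sqrt T * ‖ζ₂.diff.diff‖ :=
      (ζ₂.intervalIntegral_norm_le 3 (hnode j hj)).trans
        (mul_le_mul_of_nonneg_left (ζ₂.diff.diff.norm_coe_le 1) (Real.sqrt_nonneg _))
    have i5 : I (fun r => ‖u₄.D 2 r‖) j ≤ Real.sqrt T * ‖u₄‖ :=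
      (u₄.intervalIntegral_norm_le 2 (hnode j hj)).trans
        (mul_le_mul_of_nonneg_left (u₄.norm_coe_le 2) (Real.sqrt_nonneg _))
    have i6 : (j : ℝ) * τ * (δ * (G * ‖u₄‖)) ≤ T * (δ * (G * ‖u₄‖)) :=
      mul_le_mul_of_nonneg_right (hnode j hj).2 (by positivity)
    have hτ2 : 0 ≤ τ ^ 2 := sq_nonneg τ
    have k1 := mul_le_mul_of_nonneg_left i1 hτ2
    have k2 := mul_le_mul_of_nonneg_left i2 hτ2
    have k3 := mul_le_mul_of_nonneg_left i3 hτ2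
    have k4 := mul_le_mul_of_nonneg_left i4 hτ2
    have k5 := mul_le_mul_of_nonneg_left i5 hδ
    have p0 : 0 ≤ Real.sqrt T := Real.sqrt_nonneg T
    have p1 : 0 ≤ Real.sqrt T * (δ * ‖u₄‖) := by positivity
    have p2 : 0 ≤ T * G * (τ ^ 2 * (‖u₂.diff.diff‖ + ‖ζ₁.diff.diff‖ + ‖ζ₂.diff.diff‖)) := by
      positivity
    have p3 : 0 ≤ Real.sqrt T * (τ ^ 2 * ‖ζ₁.diff.diff‖) := by positivity
    have p4 : 0 ≤ Real.sqrt T * (τ ^ 2 * ‖ζ₂.diff.diff‖) := by positivity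
    calc Q j ≤ τ ^ 2 * (Real.sqrt T * ‖u₂.diff.diff‖) + τ ^ 2 * (Real.sqrt T * ‖u₂.diff.diff‖)
          + (τ ^ 2 * (Real.sqrt T * ‖ζ₁.diff.diff‖) + τ ^ 2 * (Real.sqrt T * ‖ζ₂.diff.diff‖))
          + T * (δ * (G * ‖u₄‖)) + δ * (Real.sqrt T * ‖u₄‖) := by
            simp only [hQ]
            linarith
      _ ≤ _ := by linarith
  -- from the projection of the exact solution to the exact solution itself
  have hjT := hnode j hj
  have hfin := stateNorm_add_le ha hm hp (u j - P (y₀ (j * τ))) (v j - P (y₁ (j * τ)))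
    (-(y₀ (j * τ) - P (y₀ (j * τ)))) (-(y₁ (j * τ) - P (y₁ (j * τ)))) (η j - θ (j * τ))
  have r1 : u j - P (y₀ (j * τ)) + -(y₀ (j * τ) - P (y₀ (j * τ))) = u j - y₀ (j * τ) := by abel
  have r2 : v j - P (y₁ (j * τ)) + -(y₁ (j * τ) - P (y₁ (j * τ))) = v j - y₁ (j * τ) := by abel
  rw [r1, r2] at hfin
  have g1 := (formNorm_le a (-(y₀ (j * τ) - P (y₀ (j * τ))))).trans
    (mul_le_mul_of_nonneg_left ((norm_neg _).trans_le (hq₀ _ hjT)) (Real.sqrt_nonneg _))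
  have g2 := (formNorm_le m (-(y₁ (j * τ) - P (y₁ (j * τ))))).trans
    (mul_le_mul_of_nonneg_left ((norm_neg _).trans_le (hq₁ _ hjT)) (Real.sqrt_nonneg _))
  have hEj := hEQ j hj
  have hE0 : E 0 = stateNorm a m p (u 0 - P (y₀ 0)) (v 0 - P (y₁ 0)) (η 0 - θ 0) := by
    simp [hE]
  have hKQ := mul_le_mul_of_nonneg_left hQj hK0
  have p5 : 0 ≤ 2 * (Real.sqrt ‖a‖ + Real.sqrt ‖m‖) * G *
      (τ ^ 2 * (‖u₂.diff.diff‖ + ‖ζ₁.diff.diff‖ + ‖ζ₂.diff.diff‖)) := by positivity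
  have hEj' : stateNorm a m p (u j - P (y₀ (j * τ))) (v j - P (y₁ (j * τ))) (η j - θ (j * τ)) = E j :=
    rfl
  rw [← hE0]
  rw [hEj'] at hfin
  refine hfin.trans ?_
  linarith

/-! ### The pair of controllers -/

/-- The form `ζ₁ᵀ P₁ η₁ + ζ₂ᵀ P₂ η₂` on pairs of controller states. -/
def ctrlForm {n : ℕ} (P₁ P₂ : Matrix (Fin n) (Fin n) ℝ) :
    (CtrlState n × CtrlState n) →L[ℝ] (CtrlState n × CtrlState n) →L[ℝ] ℝ :=
  (matrixForm P₁).bilinearComp (ContinuousLinearMap.fst ℝ _ _) (ContinuousLinearMap.fst ℝ _ _)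
    + (matrixForm P₂).bilinearComp (ContinuousLinearMap.snd ℝ _ _) (ContinuousLinearMap.snd ℝ _ _)

theorem ctrlForm_apply {n : ℕ} (P₁ P₂ : Matrix (Fin n) (Fin n) ℝ)
    (ζ η : CtrlState n × CtrlState n) :
    ctrlForm P₁ P₂ ζ η = matrixForm P₁ ζ.1 η.1 + matrixForm P₂ ζ.2 η.2 := rfl

theorem isEnergyForm_ctrlForm {n : ℕ} {P₁ P₂ : Matrix (Fin n) (Fin n) ℝ} (h₁ : P₁.PosDef)
    (h₂ : P₂.PosDef) : IsEnergyForm (ctrlForm P₁ P₂) where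
  symm := fun ζ η => by
    rw [ctrlForm_apply, ctrlForm_apply, (isEnergyForm_matrixForm h₁).symm,
      (isEnergyForm_matrixForm h₂).symm]
  nonneg := fun ζ => by
    rw [ctrlForm_apply]
    exact add_nonneg ((isEnergyForm_matrixForm h₁).nonneg _) ((isEnergyForm_matrixForm h₂).nonneg _)

/-- The state map `(ζ₁, ζ₂) ↦ (A₁ ζ₁, A₂ ζ₂)`. -/
def ctrlMap {n : ℕ} (A₁ A₂ : Matrix (Fin n) (Fin n) ℝ) :
    (CtrlState n × CtrlState n) →L[ℝ] (CtrlState n × CtrlState n) :=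
  (matrixMap A₁).prodMap (matrixMap A₂)

theorem ctrlMap_apply {n : ℕ} (A₁ A₂ : Matrix (Fin n) (Fin n) ℝ) (ζ : CtrlState n × CtrlState n) :
    ctrlMap A₁ A₂ ζ = (matrixMap A₁ ζ.1, matrixMap A₂ ζ.2) := rfl

/-- The input map `v ↦ (s₁(v) b₁, s₂(v) b₂)`. -/
def ctrlInput {n : ℕ} {X : Type*} [NormedAddCommGroup X] [NormedSpace ℝ X] (s₁ s₂ : X →L[ℝ] ℝ)
    (b₁ b₂ : Fin n → ℝ) : X →L[ℝ] (CtrlState n × CtrlState n) :=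
  (s₁.smulRight (WithLp.toLp 2 b₁ : CtrlState n)).prod
    (s₂.smulRight (WithLp.toLp 2 b₂ : CtrlState n))

theorem ctrlInput_apply {n : ℕ} {X : Type*} [NormedAddCommGroup X] [NormedSpace ℝ X]
    (s₁ s₂ : X →L[ℝ] ℝ) (b₁ b₂ : Fin n → ℝ) (v : X) : ctrlInput s₁ s₂ b₁ b₂ v
      = (s₁ v • (WithLp.toLp 2 b₁ : CtrlState n), s₂ v • (WithLp.toLp 2 b₂ : CtrlState n)) := rfl

/-- The output form `((ζ₁, ζ₂), v) ↦ (c₁ · ζ₁) s₁(v) + (c₂ · ζ₂) s₂(v)`. -/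
def ctrlOutput {n : ℕ} {X : Type*} [NormedAddCommGroup X] [NormedSpace ℝ X] (s₁ s₂ : X →L[ℝ] ℝ)
    (c₁ c₂ : Fin n → ℝ) : (CtrlState n × CtrlState n) →L[ℝ] X →L[ℝ] ℝ :=
  ((dotFunctional c₁).comp (ContinuousLinearMap.fst ℝ _ _)).smulRight s₁
    + ((dotFunctional c₂).comp (ContinuousLinearMap.snd ℝ _ _)).smulRight s₂

theorem ctrlOutput_apply {n : ℕ} {X : Type*} [NormedAddCommGroup X] [NormedSpace ℝ X]
    (s₁ s₂ : X →L[ℝ] ℝ) (c₁ c₂ : Fin n → ℝ) (ζ : CtrlState n × CtrlState n) (v : X) :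
    ctrlOutput s₁ s₂ c₁ c₂ ζ v = dotFunctional c₁ ζ.1 * s₁ v + dotFunctional c₂ ζ.2 * s₂ v := rfl

/-- The output form of the beam. -/
def Beam.outputL {n : ℕ} (S : Beam n) (hS : S.IsAdmissible) :
    (CtrlState n × CtrlState n) →L[ℝ] TildeH S.L 2 →L[ℝ] ℝ :=
  ctrlOutput (TildeH.tipSlopeL hS.L_pos) (TildeH.tipL hS.L_pos) S.ctrl₁.c S.ctrl₂.c

theorem Beam.outputL_apply {n : ℕ} (S : Beam n) (hS : S.IsAdmissible)
    (ζ : CtrlState n × CtrlState n) (v : TildeH S.L 2) :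
    S.outputL hS ζ v = S.formE ζ.1 ζ.2 v := by
  refine (ctrlOutput_apply _ _ _ _ ζ v).trans ?_
  rw [TildeH.tipSlopeL_apply, TildeH.tipL_apply]
  rfl

/-- The input map of the beam. -/
def Beam.inputL {n : ℕ} (S : Beam n) (hS : S.IsAdmissible) :
    TildeH S.L 2 →L[ℝ] (CtrlState n × CtrlState n) :=
  ctrlInput (TildeH.tipSlopeL hS.L_pos) (TildeH.tipL hS.L_pos) S.ctrl₁.b S.ctrl₂.b

theorem Beam.inputL_apply {n : ℕ} (S : Beam n) (hS : S.IsAdmissible) (v : TildeH S.L 2) :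
    S.inputL hS v = (v.tipSlope • (WithLp.toLp 2 S.ctrl₁.b : CtrlState n),
      v.tip • (WithLp.toLp 2 S.ctrl₂.b : CtrlState n)) := by
  refine (ctrlInput_apply _ _ _ _ v).trans ?_
  rw [TildeH.tipSlopeL_apply, TildeH.tipL_apply]

/-- The dissipation inequality for the pair of controllers. -/
theorem Beam.ctrl_dissipation {n : ℕ} (S : Beam n) (hS : S.IsAdmissible) {δ₁ δ₂ ε₁ ε₂ : ℝ}
    (hK₁ : S.ctrl₁.IsAdmissible δ₁) (hK₂ : S.ctrl₂.IsAdmissible δ₂)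
    {P₁ P₂ : Matrix (Fin n) (Fin n) ℝ} {q₁ q₂ : Fin n → ℝ}
    (hP₁ : S.ctrl₁.IsStorage δ₁ P₁ q₁ ε₁) (hP₂ : S.ctrl₂.IsStorage δ₂ P₂ q₂ ε₂)
    (ζ : CtrlState n × CtrlState n) (v : TildeH S.L 2) :
    ctrlForm P₁ P₂ ζ (ctrlMap S.ctrl₁.A S.ctrl₂.A ζ + S.inputL hS v)
      ≤ S.outputL hS ζ v + S.dampL hS v v := by
  have h1 := hP₁.dissipation hK₁ ζ.1 (TildeH.tipSlopeL hS.L_pos v)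
  have h2 := hP₂.dissipation hK₂ ζ.2 (TildeH.tipL hS.L_pos v)
  have e1 : S.outputL hS ζ v = dotFunctional S.ctrl₁.c ζ.1 * TildeH.tipSlopeL hS.L_pos v
      + dotFunctional S.ctrl₂.c ζ.2 * TildeH.tipL hS.L_pos v := ctrlOutput_apply _ _ _ _ ζ v
  have e2 : S.inputL hS v = (TildeH.tipSlopeL hS.L_pos v • (WithLp.toLp 2 S.ctrl₁.b : CtrlState n),
      TildeH.tipL hS.L_pos v • (WithLp.toLp 2 S.ctrl₂.b : CtrlState n)) := ctrlInput_apply _ _ _ _ v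
  rw [ctrlForm_apply, e1, S.dampL_eq, e2, ctrlMap_apply, Prod.mk_add_mk, ← sq, ← sq]
  linarith

theorem Beam.energyNorm_eq {n : ℕ} (S : Beam n) (hS : S.IsAdmissible)
    (P₁ P₂ : Matrix (Fin n) (Fin n) ℝ) (u v : TildeH S.L 2) (ζ₁ ζ₂ : CtrlState n) :
    S.energyNorm P₁ P₂ (u, v, ζ₁, ζ₂)
      = stateNorm (S.stiffL hS) (S.massL hS) (ctrlForm P₁ P₂) u v (ζ₁, ζ₂) := by
  rw [Beam.energyNorm, stateNorm, S.stiffL_apply, S.massL_apply, ctrlForm_apply, matrixForm_apply,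
    matrixForm_apply, Beam.formA, Beam.innerH]
  have e1 : ∫ x in Ioo 0 S.L, S.Λ x * u.D 2 x * u.D 2 x = ∫ x in Ioo 0 S.L, S.Λ x * u.D 2 x ^ 2 :=
    integral_congr_ae (Eventually.of_forall fun x => by simp only; ring)
  have e2 : ∫ x in Ioo 0 S.L, S.μ x * v.hat.2.2 x * v.hat.2.2 x
      = ∫ x in Ioo 0 S.L, S.μ x * v.D 0 x ^ 2 :=
    integral_congr_ae (Eventually.of_forall fun x => by
      change S.μ x * v.D 0 x * v.D 0 x = S.μ x * v.D 0 x ^ 2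
      ring)
  rw [e1, e2]
  congr 1
  simp only [TildeH.hat]
  ring

/-! ### The scheme in variational form -/

theorem reconstruct_mem {L : ℝ} {N m : ℕ} (w : Module.Basis (Fin m) ℝ (hermiteSpace L N))
    (V : Fin m → ℝ) : reconstruct w V ∈ hermiteSpace L N :=
  Submodule.sum_mem _ fun i _ => Submodule.smul_mem _ _ (w i).2

theorem reconstruct_add {L : ℝ} {N m : ℕ} (w : Module.Basis (Fin m) ℝ (hermiteSpace L N))
    (V V' : Fin m → ℝ) : reconstruct w (V + V') = reconstruct w V + reconstruct w V' := by
  simp only [reconstruct, Pi.add_apply, add_smul, Finset.sum_add_distrib]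

theorem reconstruct_smul {L : ℝ} {N m : ℕ} (w : Module.Basis (Fin m) ℝ (hermiteSpace L N))
    (c : ℝ) (V : Fin m → ℝ) : reconstruct w (c • V) = c • reconstruct w V := by
  simp only [reconstruct, Pi.smul_apply, smul_eq_mul, mul_smul, Finset.smul_sum]

theorem mulVec_gram_apply {X : Type*} [NormedAddCommGroup X] [NormedSpace ℝ X]
    (g : X →L[ℝ] X →L[ℝ] ℝ) {m : ℕ} (w : Fin m → X) (V : Fin m → ℝ) (i : Fin m) :
    ((Matrix.of fun i j => g (w i) (w j)) *ᵥ V) i = g (w i) (∑ j, V j • w j) := by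
  simp [Matrix.mulVec, dotProduct, map_sum, mul_comm]

theorem Beam.massMatrix_mulVec {n : ℕ} (S : Beam n) (hS : S.IsAdmissible) {N m : ℕ}
    (w : Module.Basis (Fin m) ℝ (hermiteSpace S.L N)) (V : Fin m → ℝ) (i : Fin m) :
    (S.massMatrix w *ᵥ V) i = S.massL hS (w i) (reconstruct w V) := by
  have h := mulVec_gram_apply (S.massL hS) (fun i => (w i : TildeH S.L 2)) V i
  simp only [S.massL_apply] at h
  rw [S.massL_apply]
  exact h

theorem Beam.stiffnessMatrix_mulVec {n : ℕ} (S : Beam n) (hS : S.IsAdmissible) {N m : ℕ}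
    (w : Module.Basis (Fin m) ℝ (hermiteSpace S.L N)) (V : Fin m → ℝ) (i : Fin m) :
    (S.stiffnessMatrix w *ᵥ V) i = S.stiffL hS (w i) (reconstruct w V) := by
  have h := mulVec_gram_apply (S.stiffL hS) (fun i => (w i : TildeH S.L 2)) V i
  simp only [S.stiffL_apply] at h
  rw [S.stiffL_apply]
  exact h

theorem Beam.dampingMatrix_mulVec {n : ℕ} (S : Beam n) (hS : S.IsAdmissible) {N m : ℕ}
    (w : Module.Basis (Fin m) ℝ (hermiteSpace S.L N)) (V : Fin m → ℝ) (i : Fin m) :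
    (S.dampingMatrix w *ᵥ V) i = S.dampL hS (w i) (reconstruct w V) := by
  have h := mulVec_gram_apply (S.dampL hS) (fun i => (w i : TildeH S.L 2)) V i
  simp only [S.dampL_apply] at h
  rw [S.dampL_apply]
  exact h

theorem Beam.dampL_symm {n : ℕ} (S : Beam n) (hS : S.IsAdmissible) (v w : TildeH S.L 2) :
    S.dampL hS v w = S.dampL hS w v := by
  rw [S.dampL_eq, S.dampL_eq]
  ring

/-- A bounded functional which vanishes on a basis vanishes on the subspace. -/
theorem eq_zero_of_basis {X : Type*} [NormedAddCommGroup X] [NormedSpace ℝ X] {W : Submodule ℝ X}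
    {m : ℕ} (w : Module.Basis (Fin m) ℝ W) (ℓ : X →L[ℝ] ℝ) (h : ∀ i, ℓ (w i) = 0) :
    ∀ x ∈ W, ℓ x = 0 := by
  intro x hx
  have h1 : ℓ.toLinearMap ∘ₗ W.subtype = 0 := w.ext fun i => by simpa using h i
  exact LinearMap.congr_fun h1 ⟨x, hx⟩

/-- The discrete equation of motion, tested with a basis, holds for all test elements. -/
theorem variational_of_basis {X Y : Type*} [NormedAddCommGroup X] [NormedSpace ℝ X]
    [NormedAddCommGroup Y] [NormedSpace ℝ Y] {a m β : X →L[ℝ] X →L[ℝ] ℝ} {e : Y →L[ℝ] X →L[ℝ] ℝ}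
    (ha : ∀ x x', a x x' = a x' x) (hm : ∀ x x', m x x' = m x' x) (hβ : ∀ x x', β x x' = β x' x)
    {W : Submodule ℝ X} {d : ℕ} (w : Module.Basis (Fin d) ℝ W) {τ : ℝ} (hτ : τ ≠ 0)
    {u u' v v' : X} {y y' : Y}
    (h : ∀ i, τ⁻¹ * (m (w i) v' - m (w i) v) = -(1 / 2 * (a (w i) u' + a (w i) u))
      - 1 / 2 * (β (w i) v' + β (w i) v) - 1 / 2 * (e y' (w i) + e y (w i))) :
    ∀ x ∈ W, m (v' - v) x = -((τ / 2) * (a (u' + u) x + β (v' + v) x + e (y' + y) x)) := by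
  intro x hx
  have key := eq_zero_of_basis w
    (m (v' - v) + (τ / 2) • (a (u' + u) + β (v' + v) + e (y' + y))) (fun i => by
      have e1 := h i
      rw [hm (w i), hm (w i), ha (w i), ha (w i), hβ (w i), hβ (w i),
        inv_mul_eq_iff_eq_mul₀ hτ] at e1
      simp only [map_add, map_sub, add_apply, sub_apply, smul_apply, smul_eq_mul]
      linear_combination e1) x hx
  simp only [add_apply, smul_apply, smul_eq_mul] at key
  linear_combination key

/-- The three equations of one step of the scheme, tested with all elements of `W_h`. -/
theorem Beam.IsCrankNicolson.variational {n : ℕ} {S : Beam n} (hS : S.IsAdmissible)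
    (hk₁ : 0 < S.ctrl₁.k) (hk₂ : 0 < S.ctrl₂.k) {N m R : ℕ}
    {w : Module.Basis (Fin m) ℝ (hermiteSpace S.L N)} {τ : ℝ} (hτ : 0 < τ)
    {U V : ℕ → Fin m → ℝ} {ζ₁ ζ₂ : ℕ → CtrlState n} (h : S.IsCrankNicolson w τ R U V ζ₁ ζ₂)
    {k : ℕ} (hk : k < R) :
    (reconstruct w (U (k + 1)) - reconstruct w (U k)
      = (τ / 2) • (reconstruct w (V (k + 1)) + reconstruct w (V k))) ∧
    (∀ x ∈ hermiteSpace S.L N, S.massL hS (reconstruct w (V (k + 1)) - reconstruct w (V k)) x =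
      -((τ / 2) * (S.stiffL hS (reconstruct w (U (k + 1)) + reconstruct w (U k)) x
        + S.dampL hS (reconstruct w (V (k + 1)) + reconstruct w (V k)) x
        + S.outputL hS ((ζ₁ (k + 1), ζ₂ (k + 1)) + (ζ₁ k, ζ₂ k)) x))) ∧
    ((ζ₁ (k + 1), ζ₂ (k + 1)) - (ζ₁ k, ζ₂ k)
      = (τ / 2) • (ctrlMap S.ctrl₁.A S.ctrl₂.A ((ζ₁ (k + 1), ζ₂ (k + 1)) + (ζ₁ k, ζ₂ k))
        + S.inputL hS (reconstruct w (V (k + 1)) + reconstruct w (V k)))) := by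
  obtain ⟨h1, h2, h3, h4⟩ := h k hk
  have hτ' := hτ.ne'
  refine ⟨?_, ?_, ?_⟩
  · have e1 : U (k + 1) = U k + (τ / 2) • (V (k + 1) + V k) := by
      rw [inv_smul_eq_iff₀ hτ', sub_eq_iff_eq_add] at h1
      rw [h1, smul_smul, add_comm]
      congr 2
      ring
    rw [e1, reconstruct_add, reconstruct_smul, reconstruct_add, add_sub_cancel_left]
  · refine variational_of_basis (S.isEnergyForm_stiffL hS hk₁ hk₂).symm
      (S.isEnergyForm_massL hS).symm (S.dampL_symm hS) w hτ' fun i => ?_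
    have e := congrFun h2 i
    simp only [Pi.smul_apply, Pi.sub_apply, Pi.add_apply, smul_eq_mul, neg_smul, Pi.neg_apply,
      S.massMatrix_mulVec hS, S.stiffnessMatrix_mulVec hS, S.dampingMatrix_mulVec hS,
      Beam.controlVector] at e
    rw [S.outputL_apply hS (ζ₁ (k + 1), ζ₂ (k + 1)), S.outputL_apply hS (ζ₁ k, ζ₂ k)]
    exact e
  · have key : ∀ (A : Matrix (Fin n) (Fin n) ℝ) (b : Fin n → ℝ) (ζ ζ' : CtrlState n) (y y' : ℝ),
        τ⁻¹ • (ζ'.ofLp - ζ.ofLp) = A *ᵥ ((1 / 2 : ℝ) • (ζ'.ofLp + ζ.ofLp)) + ((y' + y) / 2) • b →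
        ζ' - ζ = (τ / 2) • (matrixMap A (ζ' + ζ) + (y' + y) • (WithLp.toLp 2 b : CtrlState n)) := by
      intro A b ζ ζ' y y' h
      rw [inv_smul_eq_iff₀ hτ', Matrix.mulVec_smul] at h
      have h' := congrArg (WithLp.toLp 2) h
      rw [WithLp.toLp_sub] at h'
      refine h'.trans ?_
      rw [matrixMap_apply]
      ext i
      simp
      ring
    have t : ∀ v v' : TildeH S.L 2, (v + v').tipSlope = v.tipSlope + v'.tipSlope ∧
        (v + v').tip = v.tip + v'.tip := by
      intro v v'
      simp only [← TildeH.tipSlopeL_apply hS.L_pos, ← TildeH.tipL_apply hS.L_pos, map_add, and_self]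
    rw [S.inputL_apply, (t _ _).1, (t _ _).2]
    exact Prod.ext (key _ _ _ _ _ _ h3) (key _ _ _ _ _ _ h4)

/-! ### The equations of the exact solution -/

theorem integrable_strongDual_apply {X : Type*} [NormedAddCommGroup X] [NormedSpace ℝ X] {a b : ℝ}
    (F : Lp (StrongDual ℝ X) 2 (intervalMeasure a b)) (w : X) :
    Integrable (fun t => F t w) (intervalMeasure a b) :=
  (ContinuousLinearMap.apply ℝ ℝ w).integrable_comp ((Lp.memLp F).integrable one_le_two)

/-- A smooth weak solution satisfies the variational equation and the controller equations at every
time of the closed interval. -/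
theorem Beam.IsWeakSolution.pointwise {n : ℕ} {S : Beam n} (hS : S.IsAdmissible) {T : ℝ}
    (hT : 0 < T) {u₀ : TildeH S.L 2} {v₀ : PivotH S.L} {ζ₁₀ ζ₂₀ : CtrlState n}
    {u : Sobolev 0 T (TildeH S.L 2) 4} {ζ₁ ζ₂ : Sobolev 0 T (CtrlState n) 3}
    (h : S.IsWeakSolution T u₀ v₀ ζ₁₀ ζ₂₀ (u.D 0) (ζ₁.D 0) (ζ₂.D 0)) {t : ℝ} (ht : t ∈ Icc 0 T) :
    (∀ w : TildeH S.L 2, S.massL hS (pointValue 0 T (u.D 2) t) w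
      + S.stiffL hS (pointValue 0 T (u.D 0) t) w + S.dampL hS (pointValue 0 T (u.D 1) t) w
      + S.outputL hS (pointValue 0 T (ζ₁.D 0) t, pointValue 0 T (ζ₂.D 0) t) w = 0) ∧
    (pointValue 0 T (ζ₁.D 1) t, pointValue 0 T (ζ₂.D 1) t)
      = ctrlMap S.ctrl₁.A S.ctrl₂.A (pointValue 0 T (ζ₁.D 0) t, pointValue 0 T (ζ₂.D 0) t)
        + S.inputL hS (pointValue 0 T (u.D 1) t) := by
  have : CompleteSpace (TildeH S.L 2) := TildeH.completeSpace hS.L_pos 0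
  obtain ⟨-, U, F, Z₁, Z₂, hU, hZ₁, hZ₂, hF, heq, ho₁, ho₂, -⟩ := h
  have c0 := u.isContRep_pointValue hT (0 : Fin 4)
  have c1 := u.isContRep_pointValue hT (1 : Fin 4)
  have c2 := u.isContRep_pointValue hT (2 : Fin 4)
  have d0 := ζ₁.isContRep_pointValue hT (0 : Fin 3)
  have d1 := ζ₁.isContRep_pointValue hT (1 : Fin 3)
  have f0 := ζ₂.isContRep_pointValue hT (0 : Fin 3)
  have f1 := ζ₂.isContRep_pointValue hT (1 : Fin 3)
  have hU1 : U.D 1 =ᵐ[intervalMeasure 0 T] fun t => TildeH.hatL hS.L_pos (u.D 1 t) := by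
    refine Sobolev.ae_eq_clm_succ U u (TildeH.hatL hS.L_pos) (0 : Fin 1) (0 : Fin 4) ?_
    filter_upwards [hU] with t ht
    rw [TildeH.hatL_apply]
    exact ht
  have hZ : ∀ (Z : Sobolev 0 T (CtrlState n) 1) (ζ : Sobolev 0 T (CtrlState n) 3),
      Z.D 0 =ᵐ[intervalMeasure 0 T] ζ.D 0 → Z.D 1 =ᵐ[intervalMeasure 0 T] ζ.D 1 := fun Z ζ hZ =>
    Sobolev.ae_eq_clm_succ Z ζ (ContinuousLinearMap.id ℝ _) (0 : Fin 1) (0 : Fin 3) hZ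
  refine ⟨fun w => ?_, ?_⟩
  · -- the second time derivative in `V'` is represented by the one in `V`
    have w1 : HasWeakDeriv 0 T (fun t => (S.massL hS).flip w (u.D 1 t))
        (fun t => (S.massL hS).flip w (u.D 2 t)) :=
      (u.hasWeakDeriv_D (1 : Fin 4)).clm_comp (u.integrable_D _) (u.integrable_D _) _
    have hpair : (fun t => S.innerH (U.D 1 t) w.hat) =ᵐ[intervalMeasure 0 T]
        fun t => (S.massL hS).flip w (u.D 1 t) := by
      filter_upwards [hU1] with t ht
      rw [ht, TildeH.hatL_apply]
      exact (S.massL_apply hS (u.D 1 t) w).symm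
    have hFw := ((hF w).congr hpair (EventuallyEq.refl _ _)).ae_unique w1
      (integrable_strongDual_apply F w) (((S.massL hS).flip w).integrable_comp (u.integrable_D 2))
    have hae : (fun t => (S.massL hS).flip w (pointValue 0 T (u.D 2) t)
        + (S.stiffL hS).flip w (pointValue 0 T (u.D 0) t)
        + (S.dampL hS).flip w (pointValue 0 T (u.D 1) t)
        + (S.outputL hS).flip w (pointValue 0 T (ζ₁.D 0) t, pointValue 0 T (ζ₂.D 0) t))
        =ᵐ[intervalMeasure 0 T] fun _ => 0 := by
      filter_upwards [hFw, hU1, heq, c0.2, c1.2, c2.2, d0.2, f0.2]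
        with t h1 h2 h3 g0 g1 g2 g3 g4
      have e := h3 w
      rw [h1, h2, TildeH.hatL_apply, ← S.stiffL_apply hS, ← S.dampL_apply hS,
        ← S.outputL_apply hS (ζ₁.D 0 t, ζ₂.D 0 t)] at e
      have g0' : u.D 0 t = pointValue 0 T (u.D 0) t := g0
      have g1' : u.D 1 t = pointValue 0 T (u.D 1) t := g1
      have g2' : u.D 2 t = pointValue 0 T (u.D 2) t := g2
      have g3' : ζ₁.D 0 t = pointValue 0 T (ζ₁.D 0) t := g3
      have g4' : ζ₂.D 0 t = pointValue 0 T (ζ₂.D 0) t := g4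
      rw [← g0', ← g1', ← g2', ← g3', ← g4']
      exact e
    have hcont : ContinuousOn (fun t => (S.massL hS).flip w (pointValue 0 T (u.D 2) t)
        + (S.stiffL hS).flip w (pointValue 0 T (u.D 0) t)
        + (S.dampL hS).flip w (pointValue 0 T (u.D 1) t)
        + (S.outputL hS).flip w (pointValue 0 T (ζ₁.D 0) t, pointValue 0 T (ζ₂.D 0) t))
        (Icc 0 T) :=
      (((((S.massL hS).flip w).continuous.comp_continuousOn c2.1).add
        (((S.stiffL hS).flip w).continuous.comp_continuousOn c0.1)).add
        (((S.dampL hS).flip w).continuous.comp_continuousOn c1.1)).add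
        (((S.outputL hS).flip w).continuous.comp_continuousOn (d0.1.prodMk f0.1))
    exact eqOn_Icc_of_ae_intervalMeasure hT hae hcont continuousOn_const ht
  · have hae : (fun t => (pointValue 0 T (ζ₁.D 1) t, pointValue 0 T (ζ₂.D 1) t))
        =ᵐ[intervalMeasure 0 T] fun t => ctrlMap S.ctrl₁.A S.ctrl₂.A
          (pointValue 0 T (ζ₁.D 0) t, pointValue 0 T (ζ₂.D 0) t)
          + S.inputL hS (pointValue 0 T (u.D 1) t) := by
      filter_upwards [hU1, hZ Z₁ ζ₁ hZ₁, hZ Z₂ ζ₂ hZ₂, ho₁, ho₂, c1.2, d0.2, f0.2, d1.2, f1.2]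
        with t h1 h2 h3 h4 h5 g1 g2 g3 g4 g5
      have g1' : u.D 1 t = pointValue 0 T (u.D 1) t := g1
      have g2' : ζ₁.D 0 t = pointValue 0 T (ζ₁.D 0) t := g2
      have g3' : ζ₂.D 0 t = pointValue 0 T (ζ₂.D 0) t := g3
      have g4' : ζ₁.D 1 t = pointValue 0 T (ζ₁.D 1) t := g4
      have g5' : ζ₂.D 1 t = pointValue 0 T (ζ₂.D 1) t := g5
      rw [← g1', ← g2', ← g3', ← g4', ← g5', ← h2, ← h3, ctrlMap_apply, S.inputL_apply,
        matrixMap_apply, matrixMap_apply]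
      rw [h1, TildeH.hatL_apply] at h4 h5
      exact Prod.ext (congrArg (WithLp.toLp 2) h4) (congrArg (WithLp.toLp 2) h5)
    exact eqOn_Icc_of_ae_intervalMeasure hT hae (d1.1.prodMk f1.1)
      (((ctrlMap S.ctrl₁.A S.ctrl₂.A).continuous.comp_continuousOn (d0.1.prodMk f0.1)).add
        ((S.inputL hS).continuous.comp_continuousOn c1.1)) ht

/-! ### The error estimate for the beam -/

/-- The chosen projection is the one constructed from the coercivity of the stiffness form. -/
theorem Beam.proj_eq {n : ℕ} (S : Beam n) (hS : S.IsAdmissible) {c : ℝ} (hc : 0 < c)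
    (hcoer : ∀ w : TildeH S.L 2, c * ‖w‖ ^ 2 ≤ S.stiffL hS w w) {N : ℕ}
    {P : TildeH S.L 2 →L[ℝ] TildeH S.L 2} (hPW : ∀ x, P x ∈ hermiteSpace S.L N)
    (hPa : ∀ x, ∀ w ∈ hermiteSpace S.L N, S.stiffL hS (P x) w = S.stiffL hS x w)
    (x : TildeH S.L 2) : S.proj N x = P x := by
  have h : ∃ p ∈ hermiteSpace S.L N, ∀ r ∈ hermiteSpace S.L N, S.formA p r = S.formA x r :=
    ⟨P x, hPW x, fun r hr => by rw [← S.stiffL_apply hS, ← S.stiffL_apply hS, hPa x r hr]⟩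
  rw [Beam.proj, dif_pos h]
  obtain ⟨h1, h2⟩ := h.choose_spec
  set y := h.choose with hy
  have hmem := Submodule.sub_mem _ h1 (hPW x)
  have h3 : S.stiffL hS (y - P x) (y - P x) = 0 := by
    have e := h2 _ hmem
    rw [← S.stiffL_apply hS, ← S.stiffL_apply hS, ← hPa x _ hmem] at e
    rw [(S.stiffL hS).map_sub, sub_apply, e, sub_self]
  have h4 := hcoer (y - P x)
  rw [h3] at h4
  have h5 : ‖y - P x‖ ^ 2 ≤ 0 := nonpos_of_mul_nonpos_right h4 hc
  have h6 : ‖y - P x‖ = 0 := pow_eq_zero_iff two_ne_zero |>.1 (le_antisymm h5 (sq_nonneg _))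
  exact sub_eq_zero.1 (norm_eq_zero.1 h6)

/-- The time derivative of a projected solution is the projection of its time derivative. -/
theorem Sobolev.derivWithin_clm_pointValue {X Y : Type*} [NormedAddCommGroup X] [NormedSpace ℝ X]
    [CompleteSpace X] [NormedAddCommGroup Y] [NormedSpace ℝ Y] {a b : ℝ} (hab : a < b) {m : ℕ}
    (u : Sobolev a b X m) (P : X →L[ℝ] Y) (i j : Fin m) (hij : i.succ = j.castSucc) {t : ℝ}
    (ht : t ∈ Icc a b) :
    derivWithin (fun s => P (pointValue a b (u.D i.castSucc) s)) (Icc a b) t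
      = P (pointValue a b (u.D j.castSucc) t) := by
  have h := hasDerivWithinAt_of_sub_eq_integral hab (u.isContRep_pointValue hab j).1
    (fun s hs t ht => u.pointValue_sub' hab i j hij hs ht) ht
  exact (P.hasFDerivAt.comp_hasDerivWithinAt t h).derivWithin (uniqueDiffOn_Icc hab t ht)

/-- The constant of the error estimate. -/
def errorConst {X Z : Type*} [NormedAddCommGroup X] [NormedSpace ℝ X] [NormedAddCommGroup Z]
    [NormedSpace ℝ Z] (a m : X →L[ℝ] X →L[ℝ] ℝ) (p : Z →L[ℝ] Z →L[ℝ] ℝ) (B : X →L[ℝ] Z)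
    (κ β D T : ℝ) : ℝ :=
  1 + (stepConst a m p B κ β * (2 * Real.sqrt T + T * supConst T)
    + 2 * (Real.sqrt ‖a‖ + Real.sqrt ‖m‖) * supConst T) * (1 + D)

theorem crankNicolson_error_const_nonneg {X Z : Type*} [NormedAddCommGroup X] [NormedSpace ℝ X]
    [NormedAddCommGroup Z] [NormedSpace ℝ Z] (a m : X →L[ℝ] X →L[ℝ] ℝ) (p : Z →L[ℝ] Z →L[ℝ] ℝ)
    (B : X →L[ℝ] Z) {κ β T : ℝ} (hκ : 0 ≤ κ) (hβ : 0 ≤ β) (hT : 0 < T) :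
    0 ≤ stepConst a m p B κ β * (2 * Real.sqrt T + T * supConst T)
      + 2 * (Real.sqrt ‖a‖ + Real.sqrt ‖m‖) * supConst T := by
  rw [stepConst, supConst]
  positivity

theorem errorConst_pos {X Z : Type*} [NormedAddCommGroup X] [NormedSpace ℝ X]
    [NormedAddCommGroup Z] [NormedSpace ℝ Z] (a m : X →L[ℝ] X →L[ℝ] ℝ) (p : Z →L[ℝ] Z →L[ℝ] ℝ)
    (B : X →L[ℝ] Z) {κ β D T : ℝ} (hκ : 0 ≤ κ) (hβ : 0 ≤ β) (hD : 0 ≤ D) (hT : 0 < T) :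
    0 < errorConst a m p B κ β D T := by
  have := crankNicolson_error_const_nonneg a m p B hκ hβ hT
  rw [errorConst]
  positivity

/-- The error estimate with a projection error of order `h²`, and with a single constant. -/
theorem crankNicolson_error_le {X Y Z : Type*} [NormedAddCommGroup X] [NormedSpace ℝ X]
    [CompleteSpace X] [NormedAddCommGroup Y] [NormedSpace ℝ Y] [CompleteSpace Y]
    [NormedAddCommGroup Z] [NormedSpace ℝ Z] [CompleteSpace Z]
    {a m b : X →L[ℝ] X →L[ℝ] ℝ} {p : (Z × Z) →L[ℝ] (Z × Z) →L[ℝ] ℝ}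
    (ha : IsEnergyForm a) (hm : IsEnergyForm m) (hp : IsEnergyForm p)
    {e : (Z × Z) →L[ℝ] X →L[ℝ] ℝ} {A : (Z × Z) →L[ℝ] (Z × Z)} {B : X →L[ℝ] (Z × Z)}
    (hdiss : ∀ ζ v, p ζ (A ζ + B v) ≤ e ζ v + b v v)
    {β : ℝ} (hβ : 0 ≤ β) (hb : ∀ x w, |b x w| ≤ β * ‖x‖ * formNorm m w)
    {W : Submodule ℝ X} {P : X →L[ℝ] X} (hPW : ∀ x, P x ∈ W)
    (hPa : ∀ x, ∀ w ∈ W, a (P x) w = a x w) {κ : ℝ} (hκ : 0 ≤ κ) (hPκ : ∀ x, ‖P x‖ ≤ κ * ‖x‖)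
    {ι : Y →L[ℝ] X} {D h : ℝ} (hD : 0 ≤ D)
    (hPι : ∀ y, ‖ι y - P (ι y)‖ ≤ D * h ^ 2 * ‖y‖)
    {T : ℝ} (hT : 0 < T) (u₂ : Sobolev 0 T X 4) (u₄ : Sobolev 0 T Y 2) (ζ₁ ζ₂ : Sobolev 0 T Z 3)
    (hu₂₄ : u₂.D 0 =ᵐ[intervalMeasure 0 T] fun t => ι (u₄.D 0 t))
    (heq : ∀ t ∈ Icc 0 T, ∀ w ∈ W, m (pointValue 0 T (u₂.D 2) t) w + a (pointValue 0 T (u₂.D 0) t) w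
      + b (pointValue 0 T (u₂.D 1) t) w
      + e (pointValue 0 T (ζ₁.D 0) t, pointValue 0 T (ζ₂.D 0) t) w = 0)
    (hode : ∀ t ∈ Icc 0 T, (pointValue 0 T (ζ₁.D 1) t, pointValue 0 T (ζ₂.D 1) t)
      = A (pointValue 0 T (ζ₁.D 0) t, pointValue 0 T (ζ₂.D 0) t) + B (pointValue 0 T (u₂.D 1) t))
    {R : ℕ} (hR : 0 < R) {u v : ℕ → X} {η : ℕ → Z × Z} (hvW : ∀ k, v k ∈ W)
    (hu : ∀ k < R, u (k + 1) - u k = ((T / R) / 2) • (v (k + 1) + v k))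
    (hv : ∀ k < R, ∀ w ∈ W, m (v (k + 1) - v k) w =
      -(((T / R) / 2) * (a (u (k + 1) + u k) w + b (v (k + 1) + v k) w + e (η (k + 1) + η k) w)))
    (hη : ∀ k < R, η (k + 1) - η k
      = ((T / R) / 2) • (A (η (k + 1) + η k) + B (v (k + 1) + v k)))
    {j : ℕ} (hj : j ≤ R) :
    stateNorm a m p (u j - pointValue 0 T (u₂.D 0) (j * (T / R)))
        (v j - pointValue 0 T (u₂.D 1) (j * (T / R)))
        (η j - (pointValue 0 T (ζ₁.D 0) (j * (T / R)), pointValue 0 T (ζ₂.D 0) (j * (T / R)))) ≤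
      errorConst a m p B κ β D T *
        (stateNorm a m p (u 0 - P (pointValue 0 T (u₂.D 0) 0))
          (v 0 - derivWithin (fun t => P (pointValue 0 T (u₂.D 0) t)) (Icc 0 T) 0)
          (η 0 - (pointValue 0 T (ζ₁.D 0) 0, pointValue 0 T (ζ₂.D 0) 0)) + h ^ 2 * ‖u₄‖ +
        (T / R) ^ 2 * (‖u₄.diff.diff‖ + ‖u₂.diff.diff‖ + ‖ζ₁.diff.diff‖ + ‖ζ₂.diff.diff‖)) := by
  have main := crankNicolson_error ha hm hp hdiss hβ hb hPW hPa hκ hPκ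
    (mul_nonneg hD (sq_nonneg h)) hPι hT u₂ u₄ ζ₁ ζ₂ hu₂₄ heq hode hR hvW hu hv hη hj
  have hderiv : derivWithin (fun t => P (pointValue 0 T (u₂.D 0) t)) (Icc 0 T) 0
      = P (pointValue 0 T (u₂.D 1) 0) :=
    u₂.derivWithin_clm_pointValue hT P (0 : Fin 4) (1 : Fin 4) rfl (left_mem_Icc.2 hT.le)
  have hC := crankNicolson_error_const_nonneg a m p B hκ hβ hT
  rw [hderiv, errorConst]
  refine main.trans ?_
  set C := stepConst a m p B κ β * (2 * Real.sqrt T + T * supConst T)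
    + 2 * (Real.sqrt ‖a‖ + Real.sqrt ‖m‖) * supConst T
  set E := stateNorm a m p (u 0 - P (pointValue 0 T (u₂.D 0) 0))
    (v 0 - P (pointValue 0 T (u₂.D 1) 0))
    (η 0 - (pointValue 0 T (ζ₁.D 0) 0, pointValue 0 T (ζ₂.D 0) 0))
  have hE : 0 ≤ E := Real.sqrt_nonneg _
  set r := h ^ 2 * ‖u₄‖ with hr
  have hr0 : 0 ≤ r := by positivity
  set q := ‖u₂.diff.diff‖ + ‖ζ₁.diff.diff‖ + ‖ζ₂.diff.diff‖ with hq
  have hq0 : 0 ≤ q := by positivity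
  set s := (T / R) ^ 2 with hs
  have hs0 : 0 ≤ s := sq_nonneg _
  have e1 : D * h ^ 2 * ‖u₄‖ = D * r := by rw [hr, mul_assoc]
  have e2 : r + s * q ≤ E + r + s * (‖u₄.diff.diff‖ + ‖u₂.diff.diff‖ + ‖ζ₁.diff.diff‖ +
      ‖ζ₂.diff.diff‖) := by
    have := mul_le_mul_of_nonneg_left (norm_nonneg u₄.diff.diff) hs0
    rw [hq]
    linarith
  have e3 : E ≤ E + r + s * (‖u₄.diff.diff‖ + ‖u₂.diff.diff‖ + ‖ζ₁.diff.diff‖ +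
      ‖ζ₂.diff.diff‖) := by
    have : 0 ≤ s * (‖u₄.diff.diff‖ + ‖u₂.diff.diff‖ + ‖ζ₁.diff.diff‖ + ‖ζ₂.diff.diff‖) := by
      positivity
    linarith
  have e4 : D * r + s * q ≤ (1 + D) * (r + s * q) := by
    have : 0 ≤ D * (s * q) := by positivity
    linarith
  calc E + C * (D * h ^ 2 * ‖u₄‖ + s * q)
      ≤ E + C * ((1 + D) * (r + s * q)) := by
        rw [e1]
        exact add_le_add_right (mul_le_mul_of_nonneg_left e4 hC) _
    _ = E + C * (1 + D) * (r + s * q) := by ring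
    _ ≤ _ := by
        rw [one_add_mul]
        exact add_le_add e3 (mul_le_mul_of_nonneg_left e2 (by positivity))

/-- The projection onto the Hermite cubics of an element of `H̃₀⁴` is accurate to second order. -/
theorem exists_galerkin_projection_hermite {L : ℝ} (hL : 0 < L)
    {a : TildeH L 2 →L[ℝ] TildeH L 2 →L[ℝ] ℝ} {c : ℝ} (hc : 0 < c)
    (ha : ∀ w, c * ‖w‖ ^ 2 ≤ a w w) {N : ℕ} (hN : 0 < N)
    [FiniteDimensional ℝ (hermiteSpace L N)] :
    ∃ P : TildeH L 2 →L[ℝ] TildeH L 2, (∀ x, P x ∈ hermiteSpace L N) ∧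
      (∀ x, ∀ w ∈ hermiteSpace L N, a (P x) w = a x w) ∧ (∀ x, ‖P x‖ ≤ ‖a‖ / c * ‖x‖) ∧
      ∀ y : TildeH L 4, ‖TildeH.incl L y - P (TildeH.incl L y)‖
        ≤ ‖a‖ / c * (1 + L + L ^ 2) * (L / N) ^ 2 * ‖y‖ := by
  obtain ⟨P, hPW, hPa, hPκ, hPc⟩ := exists_galerkin_projection hc ha (hermiteSpace L N)
  refine ⟨P, hPW, hPa, hPκ, fun y => ?_⟩
  obtain ⟨p, hp, hpy⟩ := exists_hermite_approx hL hN y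
  calc ‖TildeH.incl L y - P (TildeH.incl L y)‖
      ≤ ‖a‖ / c * ‖TildeH.incl L y - p‖ := hPc _ p hp
    _ ≤ ‖a‖ / c * ((1 + L + L ^ 2) * ((L / N) ^ 2 * ‖y‖)) := by
        refine mul_le_mul_of_nonneg_left ?_ (by positivity)
        exact (TildeH.norm_le hL _).trans (mul_le_mul_of_nonneg_left hpy (by positivity))
    _ = ‖a‖ / c * (1 + L + L ^ 2) * (L / N) ^ 2 * ‖y‖ := by ring

/-- The error estimate for the beam, with its norms given by the local instances.  The constant is
uniform in the mesh: it is built from the forms and the input map of the beam and controllers, the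
coercivity constant `c`, the damping bound `β`, the length and the horizon `T`. -/
theorem Beam.exists_crankNicolson_error_bound {n : ℕ} (S : Beam n) (hS : S.IsAdmissible)
    (δ₁ δ₂ : ℝ) (hK₁ : S.ctrl₁.IsAdmissible δ₁) (hK₂ : S.ctrl₂.IsAdmissible δ₂)
    (P₁ P₂ : Matrix (Fin n) (Fin n) ℝ) (q₁ q₂ : Fin n → ℝ) (ε₁ ε₂ : ℝ)
    (hP₁ : S.ctrl₁.IsStorage δ₁ P₁ q₁ ε₁) (hP₂ : S.ctrl₂.IsStorage δ₂ P₂ q₂ ε₂)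
    (T : ℝ) (hT : 0 < T) :
    ∃ C : ℝ, 0 < C ∧
      -- the weak solution, `u₂ ∈ H⁴(0,T;H̃₀²)`, which also lies in `H²(0,T;H̃₀⁴)` (as `u₄`)
      ∀ (u₀ : TildeH S.L 2) (v₀ : PivotH S.L) (ζ₁₀ ζ₂₀ : CtrlState n)
        (u₂ : Sobolev 0 T (TildeH S.L 2) 4) (u₄ : Sobolev 0 T (TildeH S.L 4) 2)
        (ζ₁ ζ₂ : Sobolev 0 T (CtrlState n) 3),
        (∀ᵐ t ∂(intervalMeasure 0 T),
          (u₄.D 0 t).D 0 =ᵐ[intervalMeasure 0 S.L] (u₂.D 0 t).D 0) →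
        S.IsWeakSolution T u₀ v₀ ζ₁₀ ζ₂₀ (u₂.D 0) (ζ₁.D 0) (ζ₂.D 0) →
        -- the mesh with `N` cells, `R` time steps, and the discrete solution
        ∀ (N R m : ℕ), 0 < N → 0 < R →
        ∀ (w : Module.Basis (Fin m) ℝ (hermiteSpace S.L N))
          (U V : ℕ → Fin m → ℝ) (η₁ η₂ : ℕ → CtrlState n),
          S.IsCrankNicolson w (T / R) R U V η₁ η₂ →
          ∀ j ≤ R,
            S.energyNorm P₁ P₂
              (reconstruct w (U j) - pointValue 0 T (u₂.D 0) (j * (T / R)),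
                reconstruct w (V j) - pointValue 0 T (u₂.D 1) (j * (T / R)),
                η₁ j - pointValue 0 T (ζ₁.D 0) (j * (T / R)),
                η₂ j - pointValue 0 T (ζ₂.D 0) (j * (T / R))) ≤
            C * (S.energyNorm P₁ P₂
                  (reconstruct w (U 0) - S.proj N (pointValue 0 T (u₂.D 0) 0),
                    reconstruct w (V 0) -
                      derivWithin (fun t => S.proj N (pointValue 0 T (u₂.D 0) t)) (Icc 0 T) 0,
                    η₁ 0 - pointValue 0 T (ζ₁.D 0) 0,
                    η₂ 0 - pointValue 0 T (ζ₂.D 0) 0) +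
                (S.L / N) ^ 2 * ‖u₄‖ +
                (T / R) ^ 2 * (‖u₄.diff.diff‖ + ‖u₂.diff.diff‖ + ‖ζ₁.diff.diff‖ +
                  ‖ζ₂.diff.diff‖)) := by
  obtain ⟨c, hc, hcoer⟩ := S.exists_coercive_stiffL hS hK₁.k_pos hK₂.k_pos
  obtain ⟨β, hβ, hb⟩ := S.exists_dampL_bound hS
  have hL := hS.L_pos
  have : CompleteSpace (TildeH S.L 2) := TildeH.completeSpace hL 0
  have : CompleteSpace (TildeH S.L 4) := TildeH.completeSpace hL 2
  have hκ : 0 ≤ ‖S.stiffL hS‖ / c := div_nonneg (norm_nonneg (S.stiffL hS)) hc.le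
  have hD : 0 ≤ ‖S.stiffL hS‖ / c * (1 + S.L + S.L ^ 2) := mul_nonneg hκ (by positivity)
  refine ⟨errorConst (S.stiffL hS) (S.massL hS) (ctrlForm P₁ P₂) (S.inputL hS)
    (‖S.stiffL hS‖ / c) β (‖S.stiffL hS‖ / c * (1 + S.L + S.L ^ 2)) T,
    errorConst_pos _ _ _ _ hκ hβ hD hT, ?_⟩
  intro u₀ v₀ ζ₁₀ ζ₂₀ u₂ u₄ ζ₁ ζ₂ hu₂₄ hsol N R m hN hR w U V η₁ η₂ hCN j hj
  have hfin : FiniteDimensional ℝ (hermiteSpace S.L N) := Module.Finite.of_basis w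
  obtain ⟨P, hPW, hPa, hPκ, hPι⟩ := exists_galerkin_projection_hermite hL hc hcoer hN
  have hτ : 0 < T / R := div_pos hT (Nat.cast_pos.2 hR)
  have hincl : u₂.D 0 =ᵐ[intervalMeasure 0 T] fun t => TildeH.incl S.L (u₄.D 0 t) := by
    filter_upwards [hu₂₄] with t ht
    exact TildeH.ext_of_ae ht.symm
  rw [S.energyNorm_eq hS, S.energyNorm_eq hS, funext (S.proj_eq hS hc hcoer hPW hPa)]
  exact crankNicolson_error_le (S.isEnergyForm_stiffL hS hK₁.k_pos hK₂.k_pos)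
    (S.isEnergyForm_massL hS) (isEnergyForm_ctrlForm hP₁.posDef hP₂.posDef)
    (S.ctrl_dissipation hS hK₁ hK₂ hP₁ hP₂) hβ hb hPW hPa hκ hPκ hD hPι hT u₂ u₄ ζ₁ ζ₂ hincl
    (fun t ht w _ => (hsol.pointwise hS hT ht).1 w) (fun t ht => (hsol.pointwise hS hT ht).2) hR
    (u := fun k => reconstruct w (U k)) (v := fun k => reconstruct w (V k))
    (η := fun k => (η₁ k, η₂ k)) (fun k => reconstruct_mem w (V k))
    (fun k hk => (hCN.variational hS hK₁.k_pos hK₂.k_pos hτ hk).1)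
    (fun k hk => (hCN.variational hS hK₁.k_pos hK₂.k_pos hτ hk).2.1)
    (fun k hk => (hCN.variational hS hK₁.k_pos hK₂.k_pos hτ hk).2.2) hj

end

theorem mainTheorem4 {n : ℕ} (S : Beam n) (hS : S.IsAdmissible)
    (δ₁ δ₂ : ℝ) (hK₁ : S.ctrl₁.IsAdmissible δ₁) (hK₂ : S.ctrl₂.IsAdmissible δ₂)
    (P₁ P₂ : Matrix (Fin n) (Fin n) ℝ) (q₁ q₂ : Fin n → ℝ) (ε₁ ε₂ : ℝ)
    (hP₁ : S.ctrl₁.IsStorage δ₁ P₁ q₁ ε₁) (hP₂ : S.ctrl₂.IsStorage δ₂ P₂ q₂ ε₂)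
    (T : ℝ) (hT : 0 < T) :
    ∃ C : ℝ, 0 < C ∧
      -- the weak solution, `u₂ ∈ H⁴(0,T;H̃₀²)`, which also lies in `H²(0,T;H̃₀⁴)` (as `u₄`)
      ∀ (u₀ : TildeH S.L 2) (v₀ : PivotH S.L) (ζ₁₀ ζ₂₀ : CtrlState n)
        (u₂ : Sobolev 0 T (TildeH S.L 2) 4) (u₄ : Sobolev 0 T (TildeH S.L 4) 2)
        (ζ₁ ζ₂ : Sobolev 0 T (CtrlState n) 3),
        (∀ᵐ t ∂(intervalMeasure 0 T),
          (u₄.D 0 t).D 0 =ᵐ[intervalMeasure 0 S.L] (u₂.D 0 t).D 0) →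
        S.IsWeakSolution T u₀ v₀ ζ₁₀ ζ₂₀ (u₂.D 0) (ζ₁.D 0) (ζ₂.D 0) →
        -- the mesh with `N` cells, `R` time steps, and the discrete solution
        ∀ (N R m : ℕ), 0 < N → 0 < R →
        ∀ (w : Module.Basis (Fin m) ℝ (hermiteSpace S.L N))
          (U V : ℕ → Fin m → ℝ) (η₁ η₂ : ℕ → CtrlState n),
          S.IsCrankNicolson w (T / R) R U V η₁ η₂ →
          ∀ j ≤ R,
            S.energyNorm P₁ P₂
              (reconstruct w (U j) - pointValue 0 T (u₂.D 0) (j * (T / R)),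
                reconstruct w (V j) - pointValue 0 T (u₂.D 1) (j * (T / R)),
                η₁ j - pointValue 0 T (ζ₁.D 0) (j * (T / R)),
                η₂ j - pointValue 0 T (ζ₂.D 0) (j * (T / R))) ≤
            C * (S.energyNorm P₁ P₂
                  (reconstruct w (U 0) - S.proj N (pointValue 0 T (u₂.D 0) 0),
                    reconstruct w (V 0) -
                      derivWithin (fun t => S.proj N (pointValue 0 T (u₂.D 0) t)) (Icc 0 T) 0,
                    η₁ 0 - pointValue 0 T (ζ₁.D 0) 0,
                    η₂ 0 - pointValue 0 T (ζ₂.D 0) 0) +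
                (S.L / N) ^ 2 * ‖u₄‖ +
                (T / R) ^ 2 * (‖u₄.diff.diff‖ + ‖u₂.diff.diff‖ + ‖ζ₁.diff.diff‖ +
                  ‖ζ₂.diff.diff‖)) := by
  -- the norms here are the inferred ones, to which the local instances unfold
  exact S.exists_crankNicolson_error_bound hS δ₁ δ₂ hK₁ hK₂ P₁ P₂ q₁ q₂ ε₁ ε₂ hP₁ hP₂ T hT
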